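/- Let $d\ge 0$, $\mathcal O=\mathbb C[x_1,\dots,x_d]$, let $\mathfrak X=\mathrm{Der}_{\mathbb C}(\mathcal O)$ be the polynomial vector fields on $\mathbb C^d$ and $\mathfrak X^k=\bigwedge^k_{\mathcal O}\mathfrak X$ the $k$-vector fields. For $\varphi\in\mathcal O$ let $\iota_{\mathrm d\varphi}:\mathfrak X^{k+1}\to\mathfrak X^{k}$ be the contraction, $\iota_{\mathrm d\varphi}(X\wedge P)=X[\varphi]\,P-X\wedge\iota_{\mathrm d\varphi}P$ for $X\in\mathfrak X$. Assume that $\varphi$ is a Koszul polynomial, i.e. the complex $\cdots\to\mathfrak X^3\to\mathfrak X^2\to\mathfrak X^1\to\mathcal O$ with differential $\iota_{\mathrm d\varphi}$ is exact in all degrees except possibly in degree $0$. Let $\mathcal F_\varphi=\{X\in\mathfrak X: X[\varphi]=0\}$, a Lie–Rinehart subalgebra of $\mathfrak X$. Recall that a (negatively graded) Lie $\infty$-algebroid over $\mathcal O$ consists of projective $\mathcal O$-modules $(\mathcal E_{i})_{i\le -1}$, graded symmetric $\mathbb C$-multilinear brackets $\ell_n$ of arity $n\ge1$ and degree $+1$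 on $\mathcal E=\bigoplus_i\mathcal E_i$, and an $\mathcal O$-linear anchor $\rho:\mathcal E_{-1}\to\mathrm{Der}(\mathcal O)$ (extended by $0$ to the other $\mathcal E_i$), such that: for all $n\geq 1$ and homogeneous $x_1,\dots,x_n$, $\sum_{i=1}^n\sum_{\sigma}\epsilon(\sigma)\,\ell_{n-i+1}(\ell_i(x_{\sigma(1)},\dots,x_{\sigma(i)}),x_{\sigma(i+1)},\dots,x_{\sigma(n)})=0$, where $\sigma$ runs over the $(i,n-i)$-shuffles and $\epsilon(\sigma)$ is the Koszul sign; $\ell_n$ is $\mathcal O$-multilinear for $n\ne2$; $\ell_2(x,fy)=\rho(x)[f]\,y+f\,\ell_2(x,y)$; $\rho\circ\ell_1=0$ on $\mathcal E_{-2}$; and $\rho(\ell_2(x,y))=[\rho(x),\rho(y)]$ on $\mathcal E_{-1}$. It is universal for a Lie–Rinehart algebra $\mathcal A$ through an $\mathcal O$-linear map $\pi:\mathcal E_{-1}\to\mathcal A$ (the hook) if $\rho_{\mathcal A}\circ\pi=\rho$, $[\pi(x),\pi(y)]_{\mathcal A}=\pi(\ell_2(x,y))$ on $\mathcal E_{-1}$,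 and $\cdots\to\mathcal E_{-3}\xrightarrow{\ell_1}\mathcal E_{-2}\xrightarrow{\ell_1}\mathcal E_{-1}\xrightarrow{\pi}\mathcal A\to0$ is a projective resolution of $\mathcal A$. Then the $\mathcal O$-modules $\mathcal E_{-i}:=\mathfrak X^{i+1}$, $i\ge1$, are free, and there is exactly one Lie $\infty$-algebroid structure on $(\mathcal E_{-i})_{i\ge1}$ which is universal for $\mathcal F_\varphi$ through the hook $-\iota_{\mathrm d\varphi}:\mathfrak X^2\to\mathcal F_\varphi$ and such that * the unary bracket is $\ell_1=\iota_{\mathrm d\varphi}$ on $\mathcal E_{-i}$, $i\ge2$; * the anchor is $\rho=-\iota_{\mathrm d\varphi}$ on $\mathcal E_{-1}=\mathfrak X^2$; explicitly, $\rho\big(\tfrac{\partial}{\partial x_i}\wedge\tfrac{\partial}{\partial x_j}\big)=\tfrac{\partial\varphi}{\partial x_j}\tfrac{\partial}{\partial x_i}-\tfrac{\partial\varphi}{\partial x_i}\tfrac{\partial}{\partial x_j}$ for all $i,j\in\{1,\dots,d\}$; * for all $n\ge1$ and all multi-indices (finite sequences) $I_1,\dots,I_n$ in $\{1,\dots,d\}$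 of length at least $2$ (at least $3$ if $n=1$), $$\ell_n(\partial_{I_1},\dots,\partial_{I_n})=\sum_{i_1\in I_1,\dots,i_n\in I_n}\epsilon(i_1,\dots,i_n)\,\varphi_{i_1\cdots i_n}\,\partial_{I_1^{i_1}\bullet\cdots\bullet I_n^{i_n}} .$$ Here $\partial_J=\tfrac{\partial}{\partial x_{j_1}}\wedge\cdots\wedge\tfrac{\partial}{\partial x_{j_p}}$ for $J=(j_1,\dots,j_p)$; $\varphi_{i_1\cdots i_n}=\tfrac{\partial^n\varphi}{\partial x_{i_1}\cdots\partial x_{i_n}}$; the sum runs over the choices of one entry $i_k$ (at a given position) in each $I_k$; $I_k^{i_k}$ is $I_k$ with this entry removed; $\bullet$ is concatenation; and $\epsilon(i_1,\dots,i_n)=\prod_{k=1}^n(-1)^{a_k-1}$, where $a_k$ is the position of $i_k$ in $I_k$, i.e. the product over $k$ of the signatures of the permutations that bring $i_k$ to the first slot of $I_k$. -/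

import Mathlib

/-! ### Lie `∞`-algebroids over a commutative algebra -/

/-- The Koszul sign `ε(σ; x_1, …, x_n)` for homogeneous elements of degrees `a_1, …, a_n`, defined by
`x_{σ(1)} ⊙ ⋯ ⊙ x_{σ(n)} = ε(σ; x_1, …, x_n) x_1 ⊙ ⋯ ⊙ x_n` in the graded symmetric algebra: every
inversion `p < q`, `σ(q) < σ(p)` contributes `(-1) ^ (a_{σ(p)} a_{σ(q)})`. -/
def koszulSign {n : ℕ} (a : Fin n → ℤ) (σ : Equiv.Perm (Fin n)) : ℤˣ :=
  ∏ p ∈ (Finset.univ : Finset (Fin n × Fin n)).filter (fun p => p.1 < p.2 ∧ σ p.2 < σ p.1),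
    Int.negOnePow (a (σ p.1) * a (σ p.2))

/-- `σ` is an `(i, n - i)`-shuffle: it is increasing on the first `i` slots and on the remaining
ones. -/
def IsShuffle {n : ℕ} (i : ℕ) (σ : Equiv.Perm (Fin n)) : Prop :=
  ∀ p q : Fin n, p < q → ((q : ℕ) < i ∨ i ≤ (p : ℕ)) → σ p < σ q

instance {n : ℕ} (i : ℕ) : DecidablePred (IsShuffle (n := n) i) := fun σ =>
  inferInstanceAs (Decidable (∀ p q : Fin n, p < q → ((q : ℕ) < i ∨ i ≤ (p : ℕ)) → σ p < σ q))

/-- A (negatively graded) Lie `∞`-algebroid over the commutative `K`-algebra `O`, on the graded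
`O`-module `E = ⨁ i, 𝓔 i`. The map `bracket n` is the bracket of arity `n + 1`, so that `bracket 0`
is the differential and `bracket 1` the binary bracket. The anchor is extended by zero outside of
degree `-1`. -/
structure LieInftyAlgebroid (K O : Type*) [Field K] [CharZero K] [CommRing O] [Algebra K O]
    {E : Type*} [AddCommGroup E] [Module K E] [Module O E] [IsScalarTower K O E]
    (𝓔 : ℤ → Submodule O E) where
  isInternal : DirectSum.IsInternal 𝓔
  negatively_graded : ∀ i : ℤ, 0 ≤ i → 𝓔 i = ⊥
  projective : ∀ i : ℤ, Module.Projective O (𝓔 i)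
  bracket (n : ℕ) : MultilinearMap K (fun _ : Fin (n + 1) => E) E
  anchor : E →ₗ[O] Derivation K O O
  /-- the brackets have degree `+1` -/
  bracket_mem : ∀ (n : ℕ) (a : Fin (n + 1) → ℤ) (x : Fin (n + 1) → E), (∀ k, x k ∈ 𝓔 (a k)) →
    bracket n x ∈ 𝓔 (∑ k, a k + 1)
  /-- the brackets are graded symmetric -/
  bracket_symm : ∀ (n : ℕ) (a : Fin (n + 1) → ℤ) (x : Fin (n + 1) → E), (∀ k, x k ∈ 𝓔 (a k)) →
    ∀ σ : Equiv.Perm (Fin (n + 1)), bracket n (fun k => x (σ k)) = koszulSign a σ • bracket n x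
  /-- higher Jacobi identity for `n + 1` arguments; the inner bracket has arity `i + 1` and the
  outer one arity `n - i + 1` -/
  jacobi : ∀ (n : ℕ) (a : Fin (n + 1) → ℤ) (x : Fin (n + 1) → E), (∀ k, x k ∈ 𝓔 (a k)) →
    ∑ i : Fin (n + 1),
      ∑ σ ∈ (Finset.univ : Finset (Equiv.Perm (Fin (n + 1)))).filter (IsShuffle ((i : ℕ) + 1)),
        koszulSign a σ •
          bracket (n - i)
            (Fin.cons (bracket i fun k : Fin ((i : ℕ) + 1) => x (σ ⟨k, by omega⟩))
              fun k : Fin (n - i) => x (σ ⟨(i : ℕ) + 1 + k, by omega⟩)) = 0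
  /-- all brackets but the binary one are `O`-multilinear -/
  bracket_smul : ∀ n : ℕ, n ≠ 1 → ∀ (x : Fin (n + 1) → E) (k : Fin (n + 1)) (f : O),
    bracket n (Function.update x k (f • x k)) = f • bracket n x
  /-- Leibniz identity for the binary bracket -/
  leibniz : ∀ (x y : E) (f : O),
    bracket 1 ![x, f • y] = anchor x f • y + f • bracket 1 ![x, y]
  anchor_eq_zero : ∀ i : ℤ, i ≠ -1 → ∀ x ∈ 𝓔 i, anchor x = 0
  anchor_differential : ∀ x ∈ 𝓔 (-2), anchor (bracket 0 ![x]) = 0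
  anchor_bracket : ∀ x ∈ 𝓔 (-1), ∀ y ∈ 𝓔 (-1), anchor (bracket 1 ![x, y]) = ⁅anchor x, anchor y⁆

namespace LieInftyAlgebroid

variable {K O : Type*} [Field K] [CharZero K] [CommRing O] [Algebra K O]
  {E : Type*} [AddCommGroup E] [Module K E] [Module O E] [IsScalarTower K O E]
  {𝓔 : ℤ → Submodule O E}

theorem binary_mem (L : LieInftyAlgebroid K O 𝓔) (x y : 𝓔 (-1)) :
    L.bracket 1 ![(x : E), (y : E)] ∈ 𝓔 (-1) := by
  have h := L.bracket_mem 1 ![-1, -1] ![(x : E), (y : E)] (by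
    intro k
    fin_cases k
    · exact x.2
    · exact y.2)
  simpa using h

/-- `L` terminates at the Lie-Rinehart algebra `A` through the hook `π`. -/
structure TerminatesAt (L : LieInftyAlgebroid K O 𝓔) {A : Type*} [LieRing A] [Module O A]
    [LieRingModule A O] [LieRinehartRing O A] [LieAlgebra K A] [LieRinehartAlgebra K O A]
    (π : 𝓔 (-1) →ₗ[O] A) : Prop where
  anchor_hook : ∀ x : 𝓔 (-1), LieRinehartAlgebra.anchor K O A (π x) = L.anchor (x : E)
  hook_bracket : ∀ x y : 𝓔 (-1),
    ⁅π x, π y⁆ = π ⟨L.bracket 1 ![(x : E), (y : E)], L.binary_mem x y⟩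

/-- `L` is universal for the Lie-Rinehart algebra `A` through the hook `π`: it terminates at `A`
and `⋯ → 𝓔 (-3) → 𝓔 (-2) → 𝓔 (-1) → A → 0` is a (projective) resolution of `A`. -/
structure IsUniversalFor (L : LieInftyAlgebroid K O 𝓔) {A : Type*} [LieRing A] [Module O A]
    [LieRingModule A O] [LieRinehartRing O A] [LieAlgebra K A] [LieRinehartAlgebra K O A]
    (π : 𝓔 (-1) →ₗ[O] A) : Prop extends L.TerminatesAt π where
  hook_surjective : Function.Surjective π
  exact_hook : ∀ x : 𝓔 (-1), π x = 0 ↔ ∃ y ∈ 𝓔 (-2), L.bracket 0 ![y] = x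
  exact_differential : ∀ i : ℤ, i ≤ -2 → ∀ x ∈ 𝓔 i,
    L.bracket 0 ![x] = 0 ↔ ∃ y ∈ 𝓔 (i - 1), L.bracket 0 ![y] = x

end LieInftyAlgebroid

/-! ### Polyvector fields on `ℂ^d` with polynomial coefficients -/

/-- Polynomial functions on `ℂ^d`. -/
abbrev PolyFun (d : ℕ) : Type := MvPolynomial (Fin d) ℂ

/-- Polynomial vector fields on `ℂ^d`. -/
abbrev VecField (d : ℕ) : Type := Derivation ℂ (PolyFun d) (PolyFun d)

/-- The exterior algebra of all polyvector fields; `𝔛^k` is its submodule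
`⋀[PolyFun d]^k (VecField d)`. -/
abbrev Polyvector (d : ℕ) : Type := ExteriorAlgebra (PolyFun d) (VecField d)

/-- The contraction `ι_{dφ}` of polyvector fields, i.e. the `PolyFun d`-linear map with
`ι_{dφ}(X ∧ P) = X[φ] P - X ∧ ι_{dφ} P` and `ι_{dφ} f = 0`. -/
noncomputable def contractD {d : ℕ} (φ : PolyFun d) : Polyvector d →ₗ[PolyFun d] Polyvector d :=
  CliffordAlgebra.contractLeft
    ({ toFun := fun X => X φ
       map_add' := fun _ _ => rfl
       map_smul' := fun _ _ => rfl } : Module.Dual (PolyFun d) (VecField d))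

/-- `φ` is a Koszul polynomial: the complex `⋯ → 𝔛^2 → 𝔛^1 → 𝔛^0` with differential `ι_{dφ}` is
exact in all degrees but `0`. -/
def IsKoszulPolynomial {d : ℕ} (φ : PolyFun d) : Prop :=
  ∀ k : ℕ, 1 ≤ k → ∀ x ∈ ⋀[PolyFun d]^k (VecField d),
    contractD φ x = 0 ↔ ∃ y ∈ ⋀[PolyFun d]^(k + 1) (VecField d), contractD φ y = x

/-- The singular foliation `𝓕_φ = {X : X[φ] = 0}`, as a Lie-Rinehart subalgebra of all vector
fields. -/
def foliation {d : ℕ} (φ : PolyFun d) : LieRinehartSubalgebra (PolyFun d) (VecField d) where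
  carrier := {X | X φ = 0}
  add_mem' := by
    intro X Y hX hY
    change X φ = 0 at hX
    change Y φ = 0 at hY
    change (X + Y) φ = 0
    simp [hX, hY]
  zero_mem' := by simp
  smul_mem' := by
    intro f X hX
    change X φ = 0 at hX
    change (f • X) φ = 0
    simp [hX]
  lie_mem' := by
    intro X Y hX hY
    change X φ = 0 at hX
    change Y φ = 0 at hY
    change ⁅X, Y⁆ φ = 0
    simp [Derivation.commutator_apply, hX, hY]

/-- The underlying module `⨁_{k ≥ 2} 𝔛^k` of the truncated Koszul complex. -/
noncomputable def truncPolyvector (d : ℕ) : Submodule (PolyFun d) (Polyvector d) :=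
  ⨆ k : ℕ, ⋀[PolyFun d]^(k + 2) (VecField d)

/-- The grading of the truncated Koszul complex: `𝔛^(i+1)` sits in degree `-i`, for `i ≥ 1`.
Here `Int.negSucc k = -(k + 1)`. -/
noncomputable def truncGrading (d : ℕ) : ℤ → Submodule (PolyFun d) (truncPolyvector d)
  | Int.negSucc k => (⋀[PolyFun d]^(k + 2) (VecField d)).comap (truncPolyvector d).subtype
  | Int.ofNat _ => ⊥

/-- `∂_J = ∂/∂x_{j_1} ∧ ⋯ ∧ ∂/∂x_{j_p}` for a multi-index `J = (j_1, …, j_p)`. -/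
noncomputable def wedgePartial {d : ℕ} (J : List (Fin d)) : Polyvector d :=
  (J.map fun j => ExteriorAlgebra.ι (PolyFun d) (MvPolynomial.pderiv j : VecField d)).prod

theorem wedgePartial_mem_exteriorPower {d : ℕ} (J : List (Fin d)) :
    wedgePartial J ∈ ⋀[PolyFun d]^J.length (VecField d) := by
  induction J with
  | nil => simp [wedgePartial]
  | cons j J ih =>
    have h : wedgePartial (j :: J)
        = ExteriorAlgebra.ι (PolyFun d) (MvPolynomial.pderiv j : VecField d) * wedgePartial J := by
      simp [wedgePartial]
    rw [h, List.length_cons, ExteriorAlgebra.exteriorPower, pow_succ']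
    exact Submodule.mul_mem_mul (LinearMap.mem_range_self _ _) ih

theorem wedgePartial_mem_trunc {d : ℕ} (J : List (Fin d)) (hJ : 2 ≤ J.length) :
    wedgePartial J ∈ truncPolyvector d := by
  have h := wedgePartial_mem_exteriorPower J
  obtain ⟨k, hk⟩ := Nat.exists_eq_add_of_le' hJ
  rw [hk] at h
  exact Submodule.mem_iSup_of_mem k h

/-- `∂_J`, for a multi-index of length at least `2`, in the truncated Koszul complex. -/
noncomputable def truncPartial {d : ℕ} (J : List (Fin d)) (hJ : 2 ≤ J.length) :
    truncPolyvector d :=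
  ⟨wedgePartial J, wedgePartial_mem_trunc J hJ⟩

/-- The iterated partial derivative `φ_{i_1 ⋯ i_n}`. -/
noncomputable def iterPartial {d : ℕ} (I : List (Fin d)) (φ : PolyFun d) : PolyFun d :=
  I.foldr (fun i f => MvPolynomial.pderiv i f) φ

/-- The polyvector field
`∑_{i_1 ∈ I_1, …, i_n ∈ I_n} ε(i_1, …, i_n) φ_{i_1 ⋯ i_n} ∂_{I_1^{i_1} • ⋯ • I_n^{i_n}}`,
where `i_k` is the entry of `I_k` in (zero-based) position `s k`, the multi-index `I_k^{i_k}` is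
`I_k` with this entry removed, `•` is concatenation, and `ε(i_1, …, i_n) = ∏ k, (-1) ^ s k` is the
sign of moving each `i_k` to the first slot of `I_k`. -/
noncomputable def koszulBracket {d n : ℕ} (φ : PolyFun d) (I : Fin n → List (Fin d)) :
    Polyvector d :=
  ∑ s : (k : Fin n) → Fin (I k).length,
    ((∏ k, (-1 : PolyFun d) ^ (s k : ℕ)) *
        iterPartial (List.ofFn fun k => (I k).get (s k)) φ) •
      wedgePartial (List.ofFn fun k => (I k).eraseIdx (s k)).flatten

/-!
A polyvector field is a polynomial in the even variables `x_i` and the odd variables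
`θ_i = ∂/∂x_i`. The brackets on `⨁_{k ≥ 2} 𝔛^k` are

  `ℓ_n(P_1, …, P_n) = ∑ φ_{i_1 ⋯ i_n} (∂P_1/∂θ_{i_1}) ∧ ⋯ ∧ (∂P_n/∂θ_{i_n})`,

which is `O`-multilinear (`taylorBracket`), corrected in arity two by
`∇_{ρ(P)} Q + (-1)^{|P| |Q|} ∇_{ρ(Q)} P` (`leibnizTerm`), where `ρ = -ι_{dφ}` on bivector fields and
`∇` is the flat torsion free connection for which the coordinate vector fields are parallel
(`covDeriv`). The correction gives the Leibniz identity, it vanishes on coordinate polyvector fields,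
and so the brackets of these are the prescribed ones. A second correction is that `ℓ_1` has to be
zero on bivector fields, where `ι_{dφ}` takes values outside of the complex (`truncLinear`).

The Jacobi identity is a sum over shuffles, that is over the set `S` of arguments of the inner
bracket (`sum_isShuffle`); the Koszul signs restore the original order of the factors
(`koszulSign_smul_prod_ofFn` and `koszulSign_smul_signBefore_smul_prod_ofFn`). Every composition of
brackets is expanded into four kinds of terms:

* the composition of the multilinear parts differentiates one argument `P_k`, `k ∈ S`, twice in the
  odd variables (`jacobiTerm`); as `∂²P_k/∂θ_i∂θ_j` is antisymmetric, the terms for `S` and for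
  `Sᶜ ∪ {k}` cancel (`sum_jacobiTerm`);
* the truncation of `ℓ_1` removes the terms with `S = {b}`, `P_b` a bivector field
  (`truncationTerm`), and these come back from the correction of the outer binary bracket, when
  `∇_{ρ(P_b)}` differentiates the coefficients `φ_{i_1 ⋯ i_n}` of the inner bracket
  (`koszulSign_smul_covDeriv_taylorBracket`);
* the same covariant derivative also differentiates the arguments of the inner bracket
  (`connectionTerm`), and these terms are cancelled by the correction of the inner binary bracket
  (`koszulSign_smul_taylorBracket_leibnizTerm`);
* for three arguments there are terms with two covariant derivatives, which cancel since `∇` is flat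
  and the anchor is a morphism for the binary bracket (`sum_secondOrderTerm`,
  `anchorMap_polyBracket_two`).

The argument breaks down only for at most two arguments that are all bivector fields, and then the
identity holds for reasons of degree. Universality is the exactness of the Koszul complex. For
uniqueness, the axioms determine all brackets from the anchor and the brackets of coordinate
polyvector fields, by `O`-multilinearity or by the Leibniz identity
(`algebroid_eq_of_truncPartial`).
-/

/-! ### Koszul signs -/

/-- A symmetric function of pairs of indices may be multiplied up over the pairs `τ(p), τ(q)`. -/
theorem prod_lt_comp_perm {n : ℕ} {M : Type*} [CommMonoid M] (τ : Equiv.Perm (Fin n))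
    (g : Fin n → Fin n → M) (hg : ∀ p q, p ≠ q → g p q = g q p) :
    ∏ p ∈ (Finset.univ : Finset (Fin n × Fin n)).filter (fun p => p.1 < p.2), g (τ p.1) (τ p.2)
      = ∏ p ∈ (Finset.univ : Finset (Fin n × Fin n)).filter (fun p => p.1 < p.2), g p.1 p.2 := by
  have hs : ∀ (e : Equiv.Perm (Fin n)) (x y : Fin n), x < y → ¬ e x < e y → e y < e x :=
    fun e x y h h' => lt_of_le_of_ne (not_lt.mp h') fun h'' => h.ne' (e.injective h'')
  refine Finset.prod_nbij'
    (fun p => if τ p.1 < τ p.2 then (τ p.1, τ p.2) else (τ p.2, τ p.1))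
    (fun p => if τ.symm p.1 < τ.symm p.2 then (τ.symm p.1, τ.symm p.2)
      else (τ.symm p.2, τ.symm p.1)) ?_ ?_ ?_ ?_ ?_
  · rintro ⟨x, y⟩ h
    simp only [Finset.mem_filter, Finset.mem_univ, true_and] at h ⊢
    split_ifs with h'
    · exact h'
    · exact hs τ x y h h'
  · rintro ⟨x, y⟩ h
    simp only [Finset.mem_filter, Finset.mem_univ, true_and] at h ⊢
    split_ifs with h'
    · exact h'
    · exact hs τ.symm x y h h'
  · rintro ⟨x, y⟩ h
    simp only [Finset.mem_filter, Finset.mem_univ, true_and] at h ⊢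
    split_ifs with h' h'' h'' <;> simp_all [lt_asymm]
  · rintro ⟨x, y⟩ h
    simp only [Finset.mem_filter, Finset.mem_univ, true_and] at h ⊢
    split_ifs with h' h'' h'' <;> simp_all [lt_asymm]
  · rintro ⟨x, y⟩ h
    simp only [Finset.mem_filter, Finset.mem_univ, true_and] at h ⊢
    split_ifs with h'
    · rfl
    · exact hg _ _ fun h'' => h.ne (τ.injective h'')

theorem koszulSign_eq_prod_ite {n : ℕ} (a : Fin n → ℤ) (σ : Equiv.Perm (Fin n)) :
    koszulSign a σ = ∏ p ∈ (Finset.univ : Finset (Fin n × Fin n)).filter (fun p => p.1 < p.2),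
      if σ p.2 < σ p.1 then Int.negOnePow (a (σ p.1) * a (σ p.2)) else 1 := by
  rw [koszulSign, ← Finset.prod_filter, Finset.filter_filter]

theorem Int.units_mul_self_eq_one (u : ℤˣ) : u * u = 1 := by
  rcases Int.units_eq_one_or u with h | h <;> simp [h]

/-- The Koszul sign is a cocycle for the action of permutations on the degrees. -/
theorem koszulSign_mul {n : ℕ} (a : Fin n → ℤ) (σ τ : Equiv.Perm (Fin n)) :
    koszulSign a (σ * τ) = koszulSign a σ * koszulSign (a ∘ σ) τ := by
  have hinj : ∀ (e : Equiv.Perm (Fin n)) (x y : Fin n), x ≠ y → e x ≠ e y :=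
    fun e x y h h' => h (e.injective h')
  have key : koszulSign a σ =
      ∏ p ∈ (Finset.univ : Finset (Fin n × Fin n)).filter (fun p => p.1 < p.2),
        (fun x y : Fin n => if (x < y ↔ σ y < σ x) then
          Int.negOnePow (a (σ x) * a (σ y)) else 1) p.1 p.2 := by
    rw [koszulSign_eq_prod_ite]
    refine Finset.prod_congr rfl fun p hp => ?_
    have : p.1 < p.2 := by simpa using hp
    simp [this]
  rw [key, ← prod_lt_comp_perm τ (fun x y : Fin n => if (x < y ↔ σ y < σ x) then
      Int.negOnePow (a (σ x) * a (σ y)) else 1), koszulSign_eq_prod_ite, koszulSign_eq_prod_ite,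
    ← Finset.prod_mul_distrib]
  · refine Finset.prod_congr rfl fun p hp => ?_
    have hp' : p.1 ≠ p.2 := (show p.1 < p.2 by simpa using hp).ne
    have h1 := hinj τ _ _ hp'
    have h2 := hinj σ _ _ h1
    simp only [Equiv.Perm.mul_apply, Function.comp_apply]
    rcases lt_or_gt_of_ne h1 with h1 | h1 <;> rcases lt_or_gt_of_ne h2 with h2 | h2 <;>
      simp [h1, h2, lt_asymm h1, lt_asymm h2]
  · intro p q hpq
    have h2 := hinj σ _ _ hpq
    rcases lt_or_gt_of_ne hpq with h1 | h1 <;> rcases lt_or_gt_of_ne h2 with h2 | h2 <;>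
      simp [h1, h2, lt_asymm h1, lt_asymm h2, mul_comm]

theorem koszulSign_one {n : ℕ} (a : Fin n → ℤ) : koszulSign a 1 = 1 := by
  rw [koszulSign_eq_prod_ite]
  refine Finset.prod_eq_one fun p hp => ?_
  have : p.1 < p.2 := by simpa using hp
  simp [lt_asymm this]

theorem koszulSign_adjacent_swap {n : ℕ} (a : Fin (n + 1) → ℤ) (i : Fin n) :
    koszulSign a (Equiv.swap i.castSucc i.succ)
      = Int.negOnePow (a i.castSucc * a i.succ) := by
  rw [koszulSign]
  have : (Finset.univ : Finset (Fin (n + 1) × Fin (n + 1))).filter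
      (fun p => p.1 < p.2 ∧ Equiv.swap i.castSucc i.succ p.2 < Equiv.swap i.castSucc i.succ p.1)
      = {(i.castSucc, i.succ)} := by
    ext ⟨p, q⟩
    simp only [Finset.mem_filter, Finset.mem_univ, true_and, Finset.mem_singleton, Prod.mk.injEq]
    simp only [Equiv.swap_apply_def, Fin.ext_iff, Fin.lt_def]
    constructor
    · rintro ⟨h1, h2⟩
      split_ifs at h2 <;> simp_all <;> omega
    · rintro ⟨h1, h2⟩
      simp [h1, h2]
  rw [this]
  simp [mul_comm]

/-- In a graded commutative product, exchanging two neighbouring factors produces their sign. -/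
theorem prod_ofFn_adjacent_swap {A : Type*} [Ring A] {n : ℕ} (a : Fin (n + 1) → ℤ)
    (H : Fin (n + 1) → A) (i : Fin n)
    (hH : H i.castSucc * H i.succ
      = Int.negOnePow (a i.castSucc * a i.succ) • (H i.succ * H i.castSucc)) :
    (List.ofFn fun k => H (Equiv.swap i.castSucc i.succ k)).prod
      = Int.negOnePow (a i.castSucc * a i.succ) • (List.ofFn H).prod := by
  induction n with
  | zero => exact i.elim0
  | succ n ih =>
    induction i using Fin.cases with
    | zero =>
      have hne : ∀ k : Fin n, Equiv.swap (0 : Fin (n + 2)) 1 k.succ.succ = k.succ.succ := fun k =>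
        Equiv.swap_apply_of_ne_of_ne (Fin.succ_ne_zero _)
          (by simp [Fin.ext_iff])
      have h1 : Equiv.swap (0 : Fin (n + 2)) 1 (Fin.succ 0) = 0 := Equiv.swap_apply_right _ _
      simp only [Fin.castSucc_zero, Fin.succ_zero_eq_one] at hH ⊢
      simp only [List.ofFn_succ, List.prod_cons, hne]
      simp only [Fin.succ_zero_eq_one, Equiv.swap_apply_left, Equiv.swap_apply_right]
      rw [← mul_assoc, ← mul_assoc, hH, smul_mul_assoc, smul_smul, Int.units_mul_self_eq_one,
        one_smul]
    | succ i =>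
      have h0 : Equiv.swap i.succ.castSucc i.succ.succ (0 : Fin (n + 2)) = 0 :=
        Equiv.swap_apply_of_ne_of_ne (by simp [Fin.ext_iff]) (by simp [Fin.ext_iff])
      have hs : ∀ k : Fin (n + 1), Equiv.swap i.succ.castSucc i.succ.succ k.succ
          = (Equiv.swap i.castSucc i.succ k).succ := by
        intro k
        rw [← Fin.succ_castSucc]
        simp only [Equiv.swap_apply_def, Fin.succ_inj]
        split_ifs <;> rfl
      have := ih (fun k => a k.succ) (fun k => H k.succ) i (by simpa using hH)
      rw [List.ofFn_succ, List.prod_cons]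
      simp only [h0, hs]
      rw [this, List.ofFn_succ (f := H), List.prod_cons, mul_smul_comm]
      rfl

/-- Sorting a product of homogeneous elements of a graded commutative ring. -/
theorem koszulSign_smul_prod_ofFn {A : Type*} [Ring A] {n : ℕ} (σ : Equiv.Perm (Fin n)) :
    ∀ (a : Fin n → ℤ) (H : Fin n → A),
      (∀ k l, k ≠ l → H k * H l = Int.negOnePow (a k * a l) • (H l * H k)) →
      koszulSign a σ • (List.ofFn fun k => H (σ k)).prod = (List.ofFn H).prod := by
  cases n with
  | zero =>
    intro a H _
    simp [koszulSign]
  | succ n =>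
    have hσ : σ ∈ Submonoid.closure
        (Set.range fun i : Fin n => Equiv.swap i.castSucc i.succ) := by
      rw [Equiv.Perm.mclosure_swap_castSucc_succ]; trivial
    induction hσ using Submonoid.closure_induction with
    | mem x hx =>
      obtain ⟨i, rfl⟩ := hx
      intro a H hH
      rw [koszulSign_adjacent_swap, prod_ofFn_adjacent_swap a H i
        (hH _ _ (by simp [Fin.ext_iff])), smul_smul, Int.units_mul_self_eq_one, one_smul]
    | one =>
      intro a H _
      simp [koszulSign_one]
    | mul σ τ _ _ hσ hτ =>
      intro a H hH
      have := hτ (a ∘ σ) (H ∘ σ) fun k l hkl => hH _ _ fun h => hkl (σ.injective h)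
      simp only [Function.comp_apply] at this
      simp only [Equiv.Perm.mul_apply]
      rw [koszulSign_mul, mul_smul, this]
      exact hσ a H hH

/-- The sign of moving an odd operator past the factors preceding the `k`-th one. -/
def signBefore {n : ℕ} (a : Fin n → ℤ) (k : Fin n) : ℤˣ :=
  ∏ l ∈ Finset.univ.filter (· < k), Int.negOnePow (a l)

/-- If only the pairs that contain `q` contribute, a product over pairs is one over the partners of
`q`. -/
theorem prod_lt_eq_prod_of_mem {n : ℕ} {M : Type*} [CommMonoid M] (q : Fin n)
    (f : Fin n → Fin n → M) (hf : ∀ p r, p ≠ q → r ≠ q → f p r = 1) :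
    ∏ p ∈ (Finset.univ : Finset (Fin n × Fin n)).filter (fun p => p.1 < p.2), f p.1 p.2
      = ∏ r, if r < q then f r q else if q < r then f q r else 1 := by
  have hne : ∀ p : Fin n × Fin n, p.1 < p.2 → (p.1 ≠ q ∧ p.2 ≠ q) ∨
      (p.1 = q ∧ q < p.2) ∨ (p.2 = q ∧ p.1 < q) := by
    rintro ⟨x, y⟩ h
    dsimp only at h ⊢
    by_cases hx : x = q
    · subst hx; exact Or.inr (Or.inl ⟨rfl, h⟩)
    · by_cases hy : y = q
      · subst hy; exact Or.inr (Or.inr ⟨rfl, h⟩)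
      · exact Or.inl ⟨hx, hy⟩
  have hrhs : (∏ r, if r < q then f r q else if q < r then f q r else 1)
      = ∏ r ∈ Finset.univ.filter (· ≠ q), if r < q then f r q else f q r := by
    rw [Finset.prod_filter]
    refine Finset.prod_congr rfl fun r _ => ?_
    rcases lt_trichotomy r q with h | h | h
    · simp [h, h.ne]
    · simp [h]
    · simp [h, h.ne', lt_asymm h]
  rw [hrhs, ← Finset.prod_filter_mul_prod_filter_not _ (fun p => p.1 = q ∨ p.2 = q)]
  have h2 : ∏ p ∈ ((Finset.univ : Finset (Fin n × Fin n)).filter (fun p => p.1 < p.2)).filter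
      (fun p => ¬ (p.1 = q ∨ p.2 = q)), f p.1 p.2 = 1 := by
    refine Finset.prod_eq_one fun p hp => ?_
    simp only [Finset.mem_filter, not_or] at hp
    exact hf _ _ hp.2.1 hp.2.2
  rw [h2, mul_one]
  refine Finset.prod_nbij' (fun p => if p.1 = q then p.2 else p.1)
    (fun r => if r < q then (r, q) else (q, r)) ?_ ?_ ?_ ?_ ?_
  · rintro ⟨x, y⟩ h
    simp only [Finset.mem_filter, Finset.mem_univ, true_and] at h ⊢
    rcases h with ⟨h, rfl | rfl⟩
    · simpa using h.ne'
    · simp [h.ne]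
  · intro r h
    simp only [Finset.mem_filter, Finset.mem_univ, true_and] at h ⊢
    split_ifs with h'
    · simp [h']
    · simpa using lt_of_le_of_ne (not_lt.mp h') (Ne.symm h)
  · rintro ⟨x, y⟩ h
    simp only [Finset.mem_filter, Finset.mem_univ, true_and] at h ⊢
    rcases h with ⟨h, rfl | rfl⟩
    · simp [lt_asymm h]
    · simp [h.ne, h]
  · intro r h
    simp only [Finset.mem_filter, Finset.mem_univ, true_and] at h ⊢
    split_ifs with h' <;> simp_all
  · rintro ⟨x, y⟩ h
    simp only [Finset.mem_filter, Finset.mem_univ, true_and] at h ⊢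
    rcases h with ⟨h, rfl | rfl⟩
    · simp [lt_asymm h]
    · simp [h.ne, h]

/-- Changing the parity of one element changes the Koszul sign by the factors that move an odd
operator to that element, before and after the permutation. -/
theorem koszulSign_mul_signBefore {n : ℕ} (a : Fin n → ℤ) (σ : Equiv.Perm (Fin n)) (q : Fin n) :
    koszulSign a σ * signBefore (a ∘ σ) q
      = koszulSign (Function.update a (σ q) (a (σ q) + 1)) σ * signBefore a (σ q) := by
  set a' := Function.update a (σ q) (a (σ q) + 1) with ha'
  have hne : ∀ r, r ≠ q → a' (σ r) = a (σ r) := fun r hr =>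
    Function.update_of_ne (fun h => hr (σ.injective h)) _ _
  have hq : a' (σ q) = a (σ q) + 1 := Function.update_self _ _ _
  have key : koszulSign a σ * koszulSign a' σ
      = ∏ r, if r < q then (if σ q < σ r then Int.negOnePow (a (σ r)) else 1)
          else if q < r then (if σ r < σ q then Int.negOnePow (a (σ r)) else 1) else 1 := by
    have hA : ∀ u v : ℤ, Int.negOnePow (u * v) * Int.negOnePow (u * (v + 1)) = Int.negOnePow u := by
      intro u v
      rw [← Int.negOnePow_add, show u * v + u * (v + 1) = u + 2 * (u * v) by ring,
        Int.negOnePow_add, Int.negOnePow_two_mul, mul_one]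
    rw [koszulSign_eq_prod_ite, koszulSign_eq_prod_ite, ← Finset.prod_mul_distrib,
      prod_lt_eq_prod_of_mem q (fun x y =>
        (if σ y < σ x then Int.negOnePow (a (σ x) * a (σ y)) else 1) *
        (if σ y < σ x then Int.negOnePow (a' (σ x) * a' (σ y)) else 1))]
    · refine Finset.prod_congr rfl fun r _ => ?_
      rcases lt_trichotomy r q with h | h | h
      · simp only [h, if_true, hne r h.ne, hq]
        split_ifs
        · exact hA _ _
        · simp
      · simp [h]
      · simp only [h, lt_asymm h, if_true, if_false, hne r h.ne', hq]
        split_ifs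
        · rw [mul_comm (a (σ q)), mul_comm (a (σ q) + 1)]
          exact hA _ _
        · simp
    · intro x y hx hy
      simp only [hne x hx, hne y hy]
      split_ifs
      · exact Int.units_mul_self_eq_one _
      · simp
  have hb : signBefore a (σ q) = ∏ r, if σ r < σ q then Int.negOnePow (a (σ r)) else 1 := by
    rw [signBefore, Finset.prod_filter, ← Equiv.prod_comp σ]
  have hb' : signBefore (a ∘ σ) q = ∏ r, if r < q then Int.negOnePow (a (σ r)) else 1 := by
    rw [signBefore, Finset.prod_filter]
    rfl
  have h3 : koszulSign a σ * koszulSign a' σ * signBefore (a ∘ σ) q = signBefore a (σ q) := by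
    rw [key, hb, hb', ← Finset.prod_mul_distrib]
    refine Finset.prod_congr rfl fun r _ => ?_
    rcases lt_trichotomy r q with h | h | h
    · rcases lt_trichotomy (σ r) (σ q) with h' | h' | h'
      · simp [h, h', lt_asymm h']
      · exact absurd (σ.injective h') h.ne
      · simp [h, h', lt_asymm h']
    · simp [h]
    · rcases lt_trichotomy (σ r) (σ q) with h' | h' | h'
      · simp [h, h', lt_asymm h]
      · exact absurd (σ.injective h') h.ne'
      · simp [h, lt_asymm h', lt_asymm h]
  rw [← h3, mul_comm (koszulSign a σ) (koszulSign a' σ), mul_assoc, ← mul_assoc,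
    ← mul_assoc, Int.units_mul_self_eq_one, one_mul]

/-- Sorting a product in which the factor number `q` has been hit by an odd operator: it is `a`,
with the parity of the entry at `σ q` shifted by one, which describes the parities of `H`. -/
theorem koszulSign_smul_signBefore_smul_prod_ofFn {A : Type*} [Ring A] {n : ℕ}
    (σ : Equiv.Perm (Fin n)) (a : Fin n → ℤ) (q : Fin n) (H : Fin n → A)
    (hH : ∀ k l, k ≠ l → H k * H l
      = Int.negOnePow (Function.update a (σ q) (a (σ q) + 1) k
          * Function.update a (σ q) (a (σ q) + 1) l) • (H l * H k)) :
    koszulSign a σ • signBefore (a ∘ σ) q • (List.ofFn fun k => H (σ k)).prod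
      = signBefore a (σ q) • (List.ofFn H).prod := by
  rw [smul_smul, koszulSign_mul_signBefore, mul_comm, mul_smul, koszulSign_smul_prod_ofFn σ _ H hH]

/-! ### Calculus of polyvector fields -/

section Calculus

variable {d : ℕ}

theorem contractD_ι_mul (f : PolyFun d) (X : VecField d) (P : Polyvector d) :
    contractD f (ExteriorAlgebra.ι (PolyFun d) X * P)
      = X f • P - ExteriorAlgebra.ι (PolyFun d) X * contractD f P :=
  CliffordAlgebra.contractLeft_ι_mul _ _ _

theorem contractD_ι (f : PolyFun d) (X : VecField d) :
    contractD f (ExteriorAlgebra.ι (PolyFun d) X) = algebraMap (PolyFun d) (Polyvector d) (X f) :=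
  CliffordAlgebra.contractLeft_ι _ _ _

theorem contractD_algebraMap (f g : PolyFun d) :
    contractD f (algebraMap (PolyFun d) (Polyvector d) g) = 0 :=
  CliffordAlgebra.contractLeft_algebraMap _ _ _

theorem contractD_contractD (f : PolyFun d) (x : Polyvector d) :
    contractD f (contractD f x) = 0 :=
  CliffordAlgebra.contractLeft_contractLeft _ _

theorem contractD_comm (f g : PolyFun d) (x : Polyvector d) :
    contractD f (contractD g x) = -contractD g (contractD f x) :=
  CliffordAlgebra.contractLeft_comm _ _ _

/-- The parity automorphism of the algebra of polyvector fields. -/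
noncomputable abbrev parity : Polyvector d →ₐ[PolyFun d] Polyvector d :=
  CliffordAlgebra.involute

/-- Contractions are odd derivations of the algebra of polyvector fields. -/
theorem contractD_mul (f : PolyFun d) (x y : Polyvector d) :
    contractD f (x * y) = contractD f x * y + parity x * contractD f y := by
  induction x using CliffordAlgebra.left_induction with
  | algebraMap r =>
    have h : (algebraMap (PolyFun d) (CliffordAlgebra (0 : QuadraticForm (PolyFun d) (VecField d))) r)
      = algebraMap (PolyFun d) (Polyvector d) r := rfl
    rw [h, contractD_algebraMap, AlgHom.commutes, zero_mul, zero_add, ← Algebra.smul_def,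
      map_smul, Algebra.smul_def]
  | add x z hx hz =>
    rw [add_mul, map_add, hx, hz, map_add, map_add]
    noncomm_ring
  | ι_mul x m hx =>
    have h : CliffordAlgebra.ι (0 : QuadraticForm (PolyFun d) (VecField d)) m
      = ExteriorAlgebra.ι (PolyFun d) m := rfl
    have h2 : parity (ExteriorAlgebra.ι (PolyFun d) m) = - ExteriorAlgebra.ι (PolyFun d) m :=
      CliffordAlgebra.involute_ι _
    rw [h, mul_assoc, contractD_ι_mul, hx, contractD_ι_mul, map_mul, h2, sub_mul, smul_mul_assoc,
      mul_add, ← mul_assoc, ← mul_assoc]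
    noncomm_ring

theorem derivation_sum_apply {ι : Type*} (s : Finset ι) (X : ι → VecField d) (f : PolyFun d) :
    (∑ i ∈ s, X i) f = ∑ i ∈ s, X i f := by
  classical
  induction s using Finset.induction_on with
  | empty => simp
  | insert a s ha ih => simp [Finset.sum_insert ha, ih]

theorem derivation_eq_sum (X : VecField d) :
    X = ∑ i, X (MvPolynomial.X i) • (MvPolynomial.pderiv i : VecField d) := by
  classical
  refine MvPolynomial.derivation_ext fun j => ?_
  simp only [derivation_sum_apply, Derivation.smul_apply, MvPolynomial.pderiv_X, smul_eq_mul]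
  simp [Pi.single_apply]

theorem derivation_apply_eq_sum (X : VecField d) (f : PolyFun d) :
    X f = ∑ i, X (MvPolynomial.X i) * MvPolynomial.pderiv i f := by
  conv_lhs => rw [derivation_eq_sum X]
  simp [derivation_sum_apply]

theorem contractD_eq_sum (f : PolyFun d) (x : Polyvector d) :
    contractD f x = ∑ i, MvPolynomial.pderiv i f • contractD (MvPolynomial.X i) x := by
  induction x using CliffordAlgebra.left_induction with
  | algebraMap r =>
    have h : (algebraMap (PolyFun d) (CliffordAlgebra (0 : QuadraticForm (PolyFun d) (VecField d))) r)
      = algebraMap (PolyFun d) (Polyvector d) r := rfl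
    simp [h, contractD_algebraMap]
  | add x z hx hz => simp [hx, hz, Finset.sum_add_distrib]
  | ι_mul x m hx =>
    have h : CliffordAlgebra.ι (0 : QuadraticForm (PolyFun d) (VecField d)) m
      = ExteriorAlgebra.ι (PolyFun d) m := rfl
    simp only [h, contractD_ι_mul, hx, smul_sub, Finset.sum_sub_distrib]
    rw [derivation_apply_eq_sum m f, Finset.sum_smul, Finset.mul_sum]
    congr 1
    · exact Finset.sum_congr rfl fun i _ => by rw [smul_smul, mul_comm]
    · exact Finset.sum_congr rfl fun i _ => by rw [mul_smul_comm]

/-! ### Degrees and parities -/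

theorem ι_mem_exteriorPower_one (X : VecField d) :
    ExteriorAlgebra.ι (PolyFun d) X ∈ ⋀[PolyFun d]^1 (VecField d) := by
  rw [ExteriorAlgebra.exteriorPower, pow_one]
  exact LinearMap.mem_range_self _ _

theorem exteriorPower_induction {k : ℕ} {p : Polyvector d → Prop} 
    (hadd : ∀ x y, p x → p y → p (x + y))
    (hmul : ∀ (X : VecField d), ∀ y ∈ ⋀[PolyFun d]^k (VecField d),
      p (ExteriorAlgebra.ι (PolyFun d) X * y))
    {x : Polyvector d} (hx : x ∈ ⋀[PolyFun d]^(k + 1) (VecField d)) : p x := by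
  rw [ExteriorAlgebra.exteriorPower, pow_succ'] at hx
  refine Submodule.mul_induction_on hx ?_ hadd
  rintro _ ⟨X, rfl⟩ y hy
  exact hmul X y hy

theorem exists_algebraMap_of_mem_exteriorPower_zero {x : Polyvector d}
    (hx : x ∈ ⋀[PolyFun d]^0 (VecField d)) :
    ∃ f, x = algebraMap (PolyFun d) (Polyvector d) f := by
  rw [ExteriorAlgebra.exteriorPower, pow_zero, Submodule.mem_one] at hx
  obtain ⟨f, hf⟩ := hx
  exact ⟨f, hf.symm⟩

theorem exists_ι_of_mem_exteriorPower_one {x : Polyvector d}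
    (hx : x ∈ ⋀[PolyFun d]^1 (VecField d)) :
    ∃ X : VecField d, x = ExteriorAlgebra.ι (PolyFun d) X := by
  rw [ExteriorAlgebra.exteriorPower, pow_one] at hx
  obtain ⟨X, hX⟩ := hx
  exact ⟨X, hX.symm⟩

theorem mul_mem_exteriorPower {k l : ℕ} {x y : Polyvector d}
    (hx : x ∈ ⋀[PolyFun d]^k (VecField d)) (hy : y ∈ ⋀[PolyFun d]^l (VecField d)) :
    x * y ∈ ⋀[PolyFun d]^(k + l) (VecField d) := by
  rw [ExteriorAlgebra.exteriorPower, pow_add]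
  exact Submodule.mul_mem_mul hx hy

theorem contractD_of_mem_exteriorPower_zero (f : PolyFun d) {x : Polyvector d}
    (hx : x ∈ ⋀[PolyFun d]^0 (VecField d)) : contractD f x = 0 := by
  obtain ⟨g, rfl⟩ := exists_algebraMap_of_mem_exteriorPower_zero hx
  exact contractD_algebraMap _ _

theorem contractD_mem_exteriorPower (f : PolyFun d) {k : ℕ} {x : Polyvector d}
    (hx : x ∈ ⋀[PolyFun d]^(k + 1) (VecField d)) :
    contractD f x ∈ ⋀[PolyFun d]^k (VecField d) := by
  induction k generalizing x with
  | zero =>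
    obtain ⟨X, rfl⟩ := exists_ι_of_mem_exteriorPower_one hx
    rw [contractD_ι, ExteriorAlgebra.exteriorPower, pow_zero, Submodule.mem_one]
    exact ⟨_, rfl⟩
  | succ k ih =>
    refine exteriorPower_induction (p := fun x => contractD f x ∈ ⋀[PolyFun d]^(k + 1) (VecField d))
      (fun x y hx hy => by rw [map_add]; exact add_mem hx hy) (fun X y hy => ?_) hx
    rw [contractD_ι_mul]
    refine sub_mem (Submodule.smul_mem _ _ hy) ?_
    rw [add_comm]
    exact mul_mem_exteriorPower (ι_mem_exteriorPower_one X) (ih hy)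

theorem parity_of_mem_exteriorPower {k : ℕ} {x : Polyvector d}
    (hx : x ∈ ⋀[PolyFun d]^k (VecField d)) : parity x = Int.negOnePow k • x := by
  induction k generalizing x with
  | zero =>
    obtain ⟨f, rfl⟩ := exists_algebraMap_of_mem_exteriorPower_zero hx
    simp
  | succ k ih =>
    refine exteriorPower_induction (p := fun x => parity x = Int.negOnePow (k + 1 : ℕ) • x)
      (fun x y hx hy => by rw [map_add, smul_add, hx, hy]) (fun X y hy => ?_) hx
    have h2 : parity (ExteriorAlgebra.ι (PolyFun d) X) = - ExteriorAlgebra.ι (PolyFun d) X :=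
      CliffordAlgebra.involute_ι _
    rw [map_mul, h2, ih hy, neg_mul, mul_smul_comm, Nat.cast_succ, Int.negOnePow_succ,
      Units.neg_smul]

/-- The polyvector field `x` has the parity of the integer `a`. -/
def HasParity (a : ℤ) (x : Polyvector d) : Prop :=
  x ∈ CliffordAlgebra.evenOdd (0 : QuadraticForm (PolyFun d) (VecField d)) (a : ZMod 2)

theorem HasParity.congr {a b : ℤ} {x : Polyvector d} (h : HasParity a x) (hab : Even (a - b)) :
    HasParity b x := by
  have : (a : ZMod 2) = b := by
    rw [← sub_eq_zero, ← Int.cast_sub]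
    exact (ZMod.intCast_zmod_eq_zero_iff_dvd _ 2).2 (even_iff_two_dvd.mp hab)
  rw [HasParity, ← this]
  exact h

theorem hasParity_of_mem_exteriorPower {k : ℕ} {x : Polyvector d}
    (hx : x ∈ ⋀[PolyFun d]^k (VecField d)) : HasParity k x := by
  rw [HasParity, CliffordAlgebra.evenOdd]
  exact Submodule.mem_iSup_of_mem (⟨k, by simp⟩ : { n : ℕ // (n : ZMod 2) = ((k : ℤ) : ZMod 2) }) hx

theorem HasParity.mul_comm {a b : ℤ} {x y : Polyvector d} (hx : HasParity a x)
    (hy : HasParity b y) : x * y = Int.negOnePow (a * b) • (y * x) := by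
  have h := CliffordAlgebra.map_mul_map_of_isOrtho_of_mem_evenOdd
    (Q₁ := (0 : QuadraticForm (PolyFun d) (VecField d)))
    (Q₂ := (0 : QuadraticForm (PolyFun d) (VecField d)))
    (QuadraticMap.Isometry.id _) (QuadraticMap.Isometry.id _)
    (fun x y => by simp [QuadraticMap.IsOrtho]) x y hx hy
  simp only [CliffordAlgebra.map_id, AlgHom.id_apply] at h
  refine h.trans ?_
  congr 1
  rw [← Int.cast_mul, _root_.mul_comm]
  rcases Int.even_or_odd (a * b) with h | h
  · rw [Int.negOnePow_even _ h, (ZMod.intCast_zmod_eq_zero_iff_dvd _ 2).2 (even_iff_two_dvd.mp h)]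
    simp
  · rw [Int.negOnePow_odd _ h]
    obtain ⟨c, hc⟩ := h
    have h2 : (2 : ZMod 2) = 0 := rfl
    rw [hc]
    push_cast
    rw [h2, zero_mul, zero_add]
    simp
end Calculus

/-! ### Coefficientwise derivatives -/

section CoeffDeriv

variable {d : ℕ}

/-- The dual numbers `P + ε P` over the algebra `P` of polyvector fields, regarded as an algebra over
the polynomials through `f ↦ f + ε ∂f/∂x_j`. Algebra maps `P → P + ε P` lifting the identity are the
derivations of `P` that extend `∂/∂x_j`. -/
def TwistedDualNumber (d : ℕ) (_ : Fin d) : Type := TrivSqZeroExt (Polyvector d) (Polyvector d)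

noncomputable instance (j : Fin d) : Ring (TwistedDualNumber d j) :=
  inferInstanceAs (Ring (TrivSqZeroExt (Polyvector d) (Polyvector d)))

/-- The element `x + ε y`. -/
def TwistedDualNumber.mk (j : Fin d) (x y : Polyvector d) : TwistedDualNumber d j := (x, y)

/-- The part without `ε`. -/
def TwistedDualNumber.re {j : Fin d} (z : TwistedDualNumber d j) : Polyvector d := z.1

/-- The coefficient of `ε`. -/
def TwistedDualNumber.im {j : Fin d} (z : TwistedDualNumber d j) : Polyvector d := z.2

namespace TwistedDualNumber

variable {j : Fin d}

theorem ext' {z w : TwistedDualNumber d j} (h1 : z.re = w.re) (h2 : z.im = w.im) : z = w :=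
  Prod.ext h1 h2

@[simp] theorem re_mk (x y : Polyvector d) : (mk j x y).re = x := rfl
@[simp] theorem im_mk (x y : Polyvector d) : (mk j x y).im = y := rfl
@[simp] theorem re_add (z w : TwistedDualNumber d j) : (z + w).re = z.re + w.re := rfl
@[simp] theorem im_add (z w : TwistedDualNumber d j) : (z + w).im = z.im + w.im := rfl
@[simp] theorem re_zero : (0 : TwistedDualNumber d j).re = 0 := rfl
@[simp] theorem im_zero : (0 : TwistedDualNumber d j).im = 0 := rfl
@[simp] theorem re_one : (1 : TwistedDualNumber d j).re = 1 := rfl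
@[simp] theorem im_one : (1 : TwistedDualNumber d j).im = 0 := rfl
@[simp] theorem re_mul (z w : TwistedDualNumber d j) : (z * w).re = z.re * w.re := rfl
@[simp] theorem im_mul (z w : TwistedDualNumber d j) :
    (z * w).im = z.re * w.im + z.im * w.re := rfl

noncomputable instance : Algebra (PolyFun d) (TwistedDualNumber d j) :=
  RingHom.toAlgebra'
    { toFun := fun f => mk j (algebraMap _ _ f) (algebraMap _ _ (MvPolynomial.pderiv j f))
      map_one' := ext' (by simp) (by simp)
      map_zero' := ext' (by simp) (by simp)
      map_add' := fun f g => ext' (by simp) (by simp)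
      map_mul' := fun f g => ext' (by simp) (by
        simp only [im_mk, im_mul, re_mk, ← map_mul, ← map_add, Derivation.leibniz, smul_eq_mul]
        ring_nf) }
    (by
      intro f z
      refine ext' ?_ ?_
      · exact Algebra.commutes _ _
      · simp only [RingHom.coe_mk, MonoidHom.coe_mk, OneHom.coe_mk, im_mul, re_mk, im_mk]
        rw [Algebra.commutes, Algebra.commutes, add_comm])

theorem algebraMap_def (f : PolyFun d) : algebraMap (PolyFun d) (TwistedDualNumber d j) f
    = mk j (algebraMap _ _ f) (algebraMap _ _ (MvPolynomial.pderiv j f)) := rfl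

theorem smul_def (f : PolyFun d) (z : TwistedDualNumber d j) :
    f • z = mk j (f • z.re) (f • z.im + MvPolynomial.pderiv j f • z.re) := by
  rw [Algebra.smul_def, algebraMap_def]
  exact ext' (by simp [Algebra.smul_def]) (by simp [Algebra.smul_def])

end TwistedDualNumber

open TwistedDualNumber in
/-- The lift of the identity to twisted dual numbers that sends a vector field `X` to
`X + ε [∂/∂x_j, X]`. -/
noncomputable def twistedLift (j : Fin d) : Polyvector d →ₐ[PolyFun d] TwistedDualNumber d j :=
  ExteriorAlgebra.lift (PolyFun d)
    ⟨{ toFun := fun X => mk j (ExteriorAlgebra.ι _ X)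
          (ExteriorAlgebra.ι _ ⁅(MvPolynomial.pderiv j : VecField d), X⁆)
       map_add' := fun X Y => ext' (by simp) (by
        simp only [im_add, im_mk]
        rw [← map_add]
        congr 1
        ext1
        simp only [Derivation.commutator_apply, Derivation.add_apply, map_add]
        ring)
       map_smul' := fun f X => by
        have h : ⁅(MvPolynomial.pderiv j : VecField d), f • X⁆
            = f • ⁅(MvPolynomial.pderiv j : VecField d), X⁆ + MvPolynomial.pderiv j f • X := by
          ext1
          simp only [Derivation.commutator_apply, Derivation.smul_apply, Derivation.add_apply,
            Derivation.leibniz, smul_eq_mul]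
          ring
        rw [TwistedDualNumber.smul_def]
        exact ext' (by simp) (by simp [h]) },
     fun X => ext' (by simp) (by
      simp only [im_mul, LinearMap.coe_mk, AddHom.coe_mk, re_mk, im_mk, im_zero]
      have := ExteriorAlgebra.ι_add_mul_swap (R := PolyFun d) X ⁅(MvPolynomial.pderiv j : VecField d), X⁆
      exact this)⟩

theorem twistedLift_ι (j : Fin d) (X : VecField d) :
    twistedLift j (ExteriorAlgebra.ι _ X) = TwistedDualNumber.mk j (ExteriorAlgebra.ι _ X)
      (ExteriorAlgebra.ι _ ⁅(MvPolynomial.pderiv j : VecField d), X⁆) :=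
  ExteriorAlgebra.lift_ι_apply _ _ _ _

theorem twistedLift_re (j : Fin d) (x : Polyvector d) : (twistedLift j x).re = x := by
  induction x using ExteriorAlgebra.induction with
  | algebraMap r => rw [AlgHom.commutes]; rfl
  | ι X => rw [twistedLift_ι]; rfl
  | mul a b ha hb => simp [ha, hb]
  | add a b ha hb => simp [ha, hb]

theorem twistedLift_im_smul (j : Fin d) (f : PolyFun d) (x : Polyvector d) :
    (twistedLift j (f • x)).im = f • (twistedLift j x).im + MvPolynomial.pderiv j f • x := by
  rw [map_smul, TwistedDualNumber.smul_def, TwistedDualNumber.im_mk, twistedLift_re]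

/-- The derivative of the coefficients of a polyvector field in the direction of the coordinate
`x_j`; equivalently, its Lie derivative along `∂/∂x_j`. -/
noncomputable def coeffDeriv (j : Fin d) : Polyvector d →ₗ[ℂ] Polyvector d where
  toFun x := (twistedLift j x).im
  map_add' x y := by rw [map_add]; rfl
  map_smul' c x := by
    have : c • x = (MvPolynomial.C c : PolyFun d) • x := by
      rw [← MvPolynomial.algebraMap_eq, algebraMap_smul]
    rw [this, twistedLift_im_smul, MvPolynomial.pderiv_C, zero_smul, add_zero,
      ← MvPolynomial.algebraMap_eq, algebraMap_smul]
    rfl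

theorem coeffDeriv_smul (j : Fin d) (f : PolyFun d) (x : Polyvector d) :
    coeffDeriv j (f • x) = f • coeffDeriv j x + MvPolynomial.pderiv j f • x :=
  twistedLift_im_smul j f x

theorem coeffDeriv_mul (j : Fin d) (x y : Polyvector d) :
    coeffDeriv j (x * y) = coeffDeriv j x * y + x * coeffDeriv j y := by
  change (twistedLift j (x * y)).im = (twistedLift j x).im * y + x * (twistedLift j y).im
  rw [map_mul, TwistedDualNumber.im_mul, twistedLift_re, twistedLift_re, add_comm]

theorem coeffDeriv_ι (j : Fin d) (X : VecField d) :
    coeffDeriv j (ExteriorAlgebra.ι _ X)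
      = ExteriorAlgebra.ι _ ⁅(MvPolynomial.pderiv j : VecField d), X⁆ := by
  change (twistedLift j _).im = _
  rw [twistedLift_ι]; rfl

theorem coeffDeriv_algebraMap (j : Fin d) (f : PolyFun d) :
    coeffDeriv j (algebraMap (PolyFun d) (Polyvector d) f)
      = algebraMap (PolyFun d) (Polyvector d) (MvPolynomial.pderiv j f) := by
  change (twistedLift j _).im = _
  rw [AlgHom.commutes]; rfl

theorem coeffDeriv_one (j : Fin d) : coeffDeriv j (1 : Polyvector d) = 0 := by
  simpa using coeffDeriv_algebraMap j 1

theorem coeffDeriv_mem_exteriorPower (j : Fin d) {k : ℕ} {x : Polyvector d}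
    (hx : x ∈ ⋀[PolyFun d]^k (VecField d)) : coeffDeriv j x ∈ ⋀[PolyFun d]^k (VecField d) := by
  induction k generalizing x with
  | zero =>
    obtain ⟨f, rfl⟩ := exists_algebraMap_of_mem_exteriorPower_zero hx
    rw [coeffDeriv_algebraMap, ExteriorAlgebra.exteriorPower, pow_zero, Submodule.mem_one]
    exact ⟨_, rfl⟩
  | succ k ih =>
    refine exteriorPower_induction
      (p := fun x => coeffDeriv j x ∈ ⋀[PolyFun d]^(k + 1) (VecField d))
      (fun x y hx hy => by rw [map_add]; exact add_mem hx hy) (fun X y hy => ?_) hx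
    rw [coeffDeriv_mul, coeffDeriv_ι, add_comm k]
    exact add_mem (mul_mem_exteriorPower (ι_mem_exteriorPower_one _) hy)
      (mul_mem_exteriorPower (ι_mem_exteriorPower_one _) (ih hy))

/-! ### Constant polyvector fields -/

theorem wedgePartial_nil : wedgePartial ([] : List (Fin d)) = 1 := by simp [wedgePartial]

theorem wedgePartial_cons (i : Fin d) (J : List (Fin d)) :
    wedgePartial (i :: J)
      = ExteriorAlgebra.ι (PolyFun d) (MvPolynomial.pderiv i : VecField d) * wedgePartial J := by
  simp [wedgePartial]

theorem wedgePartial_append (I J : List (Fin d)) :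
    wedgePartial (I ++ J) = wedgePartial I * wedgePartial J := by
  simp [wedgePartial]

/-- Every `k`-vector field is a combination of wedge products of `k` coordinate vector fields. -/
theorem exteriorPower_le_span_wedgePartial (k : ℕ) :
    ⋀[PolyFun d]^k (VecField d)
      ≤ Submodule.span (PolyFun d) {x | ∃ J : List (Fin d), J.length = k ∧ wedgePartial J = x} := by
  induction k with
  | zero =>
    intro x hx
    obtain ⟨f, rfl⟩ := exists_algebraMap_of_mem_exteriorPower_zero hx
    rw [Algebra.algebraMap_eq_smul_one]
    exact Submodule.smul_mem _ _ (Submodule.subset_span ⟨[], rfl, wedgePartial_nil⟩)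
  | succ k ih =>
    intro x hx
    refine exteriorPower_induction (p := fun x => x ∈ Submodule.span (PolyFun d) _)
      (fun x y hx hy => add_mem hx hy) (fun X y hy => ?_) hx
    have := ih hy
    refine Submodule.span_induction (p := fun y _ => ExteriorAlgebra.ι (PolyFun d) X * y ∈
      Submodule.span (PolyFun d) {x | ∃ J : List (Fin d), J.length = k + 1 ∧ wedgePartial J = x})
      ?_ ?_ ?_ ?_ this
    · rintro _ ⟨J, hJ, rfl⟩
      rw [derivation_eq_sum X, map_sum, Finset.sum_mul]
      refine Submodule.sum_mem _ fun i _ => ?_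
      rw [map_smul, smul_mul_assoc, ← wedgePartial_cons]
      exact Submodule.smul_mem _ _ (Submodule.subset_span ⟨i :: J, by simp [hJ], rfl⟩)
    · simp
    · intro y z _ _ hy hz
      rw [mul_add]
      exact add_mem hy hz
    · intro f y _ hy
      rw [mul_smul_comm]
      exact Submodule.smul_mem _ _ hy

/-- The `k`-vector fields are additively generated by the `f ∂_J` with `J` of length `k`. -/
theorem exteriorPower_induction_wedgePartial {k : ℕ} {p : Polyvector d → Prop} (h0 : p 0)
    (hadd : ∀ x y, p x → p y → p (x + y))
    (hmon : ∀ (f : PolyFun d) (J : List (Fin d)), J.length = k → p (f • wedgePartial J))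
    {x : Polyvector d} (hx : x ∈ ⋀[PolyFun d]^k (VecField d)) : p x := by
  refine Submodule.closure_induction (p := fun x _ => p x) h0 (fun x y _ _ => hadd x y) ?_
    (exteriorPower_le_span_wedgePartial k hx)
  rintro f _ ⟨J, hJ, rfl⟩
  exact hmon f J hJ

/-- The algebra of polyvector fields is additively generated by the `f ∂_J`. -/
theorem polyvector_induction {p : Polyvector d → Prop} (hadd : ∀ x y, p x → p y → p (x + y))
    (hmon : ∀ (f : PolyFun d) (J : List (Fin d)), p (f • wedgePartial J)) (x : Polyvector d) :
    p x := by
  have h1 : x ∈ Submodule.span (PolyFun d) (Set.range (wedgePartial (d := d))) := by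
    have : ⊤ ≤ Submodule.span (PolyFun d) (Set.range (wedgePartial (d := d))) := by
      rw [← CliffordAlgebra.iSup_ι_range_eq_top, iSup_le_iff]
      intro k
      refine (exteriorPower_le_span_wedgePartial k).trans (Submodule.span_mono ?_)
      rintro _ ⟨J, _, rfl⟩
      exact ⟨J, rfl⟩
    exact this Submodule.mem_top
  have h0 : p 0 := by simpa using hmon 0 []
  refine Submodule.closure_induction (p := fun x _ => p x) h0 (fun x y _ _ => hadd x y) ?_ h1
  rintro f _ ⟨J, rfl⟩
  exact hmon f J

theorem coeffDeriv_wedgePartial (j : Fin d) (J : List (Fin d)) :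
    coeffDeriv j (wedgePartial J) = 0 := by
  classical
  induction J with
  | nil => rw [wedgePartial_nil, coeffDeriv_one]
  | cons i J ih =>
    have h : ⁅(MvPolynomial.pderiv j : VecField d), (MvPolynomial.pderiv i : VecField d)⁆ = 0 := by
      refine MvPolynomial.derivation_ext fun k => ?_
      simp [Derivation.commutator_apply, MvPolynomial.pderiv_X, Pi.single_apply, apply_ite]
    rw [wedgePartial_cons, coeffDeriv_mul, ih, coeffDeriv_ι, h]
    simp

theorem coeffDeriv_contractD_wedgePartial (i j : Fin d) (J : List (Fin d)) :
    coeffDeriv j (contractD (MvPolynomial.X i) (wedgePartial J)) = 0 := by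
  classical
  induction J with
  | nil =>
    rw [wedgePartial_nil, ← map_one (algebraMap (PolyFun d) (Polyvector d)), contractD_algebraMap,
      map_zero]
  | cons k J ih =>
    rw [wedgePartial_cons, contractD_ι_mul, map_sub, coeffDeriv_mul, ih, coeffDeriv_smul,
      coeffDeriv_wedgePartial, ← mul_one (ExteriorAlgebra.ι _ _), ← wedgePartial_nil,
      ← wedgePartial_cons, coeffDeriv_wedgePartial]
    simp [MvPolynomial.pderiv_X, Pi.single_apply, apply_ite]

/-- Coefficientwise derivatives commute with the contractions by the coordinate differentials. -/
theorem coeffDeriv_contractD_X (i j : Fin d) (x : Polyvector d) :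
    coeffDeriv j (contractD (MvPolynomial.X i) x)
      = contractD (MvPolynomial.X i) (coeffDeriv j x) := by
  induction x using polyvector_induction with
  | hadd x y hx hy => simp [hx, hy]
  | hmon f J =>
    rw [map_smul, coeffDeriv_smul, coeffDeriv_smul, coeffDeriv_contractD_wedgePartial,
      coeffDeriv_wedgePartial]
    simp

theorem pderiv_comm (i j : Fin d) (f : PolyFun d) :
    MvPolynomial.pderiv i (MvPolynomial.pderiv j f)
      = MvPolynomial.pderiv j (MvPolynomial.pderiv i f) := by
  classical
  have h : ⁅(MvPolynomial.pderiv i : VecField d), (MvPolynomial.pderiv j : VecField d)⁆ = 0 := by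
    refine MvPolynomial.derivation_ext fun k => ?_
    simp [Derivation.commutator_apply, MvPolynomial.pderiv_X, Pi.single_apply, apply_ite]
  have := congrArg (fun D : VecField d => D f) h
  simpa [Derivation.commutator_apply, sub_eq_zero] using this

theorem coeffDeriv_parity (j : Fin d) (x : Polyvector d) :
    coeffDeriv j (parity x) = parity (coeffDeriv j x) := by
  induction x using polyvector_induction with
  | hadd x y hx hy => simp [hx, hy]
  | hmon f J =>
    rw [map_smul, parity_of_mem_exteriorPower (wedgePartial_mem_exteriorPower J)]
    rcases Int.units_eq_one_or (Int.negOnePow J.length) with h | h <;>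
      simp [h, coeffDeriv_smul, coeffDeriv_wedgePartial,
        parity_of_mem_exteriorPower (wedgePartial_mem_exteriorPower J)]

end CoeffDeriv

/-! ### Derivations of products of polyvector fields -/

section Products

variable {d : ℕ}

theorem signBefore_zero {n : ℕ} (a : Fin (n + 1) → ℤ) : signBefore a 0 = 1 := by
  simp [signBefore]

theorem signBefore_succ {n : ℕ} (a : Fin (n + 1) → ℤ) (q : Fin n) :
    signBefore a q.succ = Int.negOnePow (a 0) * signBefore (fun k => a k.succ) q := by
  simp only [signBefore, Finset.prod_filter, Fin.prod_univ_succ, Fin.succ_lt_succ_iff,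
    Fin.succ_pos, if_true]

theorem contractD_prod_ofFn (f : PolyFun d) {n : ℕ} (a : Fin n → ℤ) (H : Fin n → Polyvector d)
    (hH : ∀ k, parity (H k) = Int.negOnePow (a k) • H k) :
    contractD f (List.ofFn H).prod
      = ∑ q, signBefore a q • (List.ofFn (Function.update H q (contractD f (H q)))).prod := by
  induction n with
  | zero =>
    rw [List.ofFn_zero, List.prod_nil, ← map_one (algebraMap (PolyFun d) (Polyvector d)),
      contractD_algebraMap]
    simp
  | succ n ih =>
    rw [List.ofFn_succ, List.prod_cons, contractD_mul,
      ih (fun k => a k.succ) (fun k => H k.succ) fun k => hH k.succ, Fin.sum_univ_succ, hH,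
      signBefore_zero, one_smul, Finset.mul_sum]
    congr 1
    · simp [List.ofFn_succ]
    · refine Finset.sum_congr rfl fun q _ => ?_
      have h0 : Function.update H q.succ (contractD f (H q.succ)) 0 = H 0 :=
        Function.update_of_ne (Fin.succ_ne_zero q).symm _ _
      have hs : (fun k : Fin n => Function.update H q.succ (contractD f (H q.succ)) k.succ)
          = Function.update (fun k => H k.succ) q (contractD f (H q.succ)) := by
        funext k
        simp [Function.update_apply, Fin.succ_inj]
      rw [signBefore_succ, List.ofFn_succ, List.prod_cons, h0, hs, mul_smul_comm, smul_mul_assoc,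
        smul_smul, mul_comm]

theorem coeffDeriv_prod_ofFn (j : Fin d) {n : ℕ} (H : Fin n → Polyvector d) :
    coeffDeriv j (List.ofFn H).prod
      = ∑ q, (List.ofFn (Function.update H q (coeffDeriv j (H q)))).prod := by
  induction n with
  | zero =>
    rw [List.ofFn_zero, List.prod_nil, coeffDeriv_one]
    simp
  | succ n ih =>
    rw [List.ofFn_succ, List.prod_cons, coeffDeriv_mul,
      ih (fun k => H k.succ), Fin.sum_univ_succ, Finset.mul_sum]
    congr 1
    · simp [List.ofFn_succ]
    · refine Finset.sum_congr rfl fun q _ => ?_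
      have h0 : Function.update H q.succ (coeffDeriv j (H q.succ)) 0 = H 0 :=
        Function.update_of_ne (Fin.succ_ne_zero q).symm _ _
      have hs : (fun k : Fin n => Function.update H q.succ (coeffDeriv j (H q.succ)) k.succ)
          = Function.update (fun k => H k.succ) q (coeffDeriv j (H q.succ)) := by
        funext k
        simp [Function.update_apply, Fin.succ_inj]
      rw [List.ofFn_succ, List.prod_cons, h0, hs]

theorem parity_prod_ofFn {n : ℕ} (a : Fin n → ℤ) (H : Fin n → Polyvector d)
    (hH : ∀ k, parity (H k) = Int.negOnePow (a k) • H k) :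
    parity (List.ofFn H).prod = (∏ k, Int.negOnePow (a k)) • (List.ofFn H).prod := by
  induction n with
  | zero => simp
  | succ n ih =>
    rw [List.ofFn_succ, List.prod_cons, map_mul,
      ih (fun k => a k.succ) (fun k => H k.succ) fun k => hH k.succ, hH, Fin.prod_univ_succ,
      smul_mul_assoc, mul_smul_comm, smul_smul]

theorem mul_comm_of_hasParity {n : ℕ} (a : Fin n → ℤ) (H : Fin n → Polyvector d)
    (hH : ∀ k, HasParity (a k) (H k)) (k l : Fin n) :
    H k * H l = Int.negOnePow (a k * a l) • (H l * H k) :=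
  (hH k).mul_comm (hH l)

theorem prod_ofFn_mem_exteriorPower {n : ℕ} (m : Fin n → ℕ) (H : Fin n → Polyvector d)
    (hH : ∀ k, H k ∈ ⋀[PolyFun d]^(m k) (VecField d)) :
    (List.ofFn H).prod ∈ ⋀[PolyFun d]^(∑ k, m k) (VecField d) := by
  have := SetLike.list_prod_ofFn_mem_graded (A := fun k : ℕ => ⋀[PolyFun d]^k (VecField d)) m H hH
  rwa [List.sum_ofFn] at this

end Products

/-! ### The brackets of the Koszul complex -/

section Brackets

variable {d : ℕ}

instance : LeftCommutative fun (i : Fin d) (f : PolyFun d) => MvPolynomial.pderiv i f :=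
  ⟨fun i j f => pderiv_comm i j f⟩

/-- The mixed partial derivative of `φ` along an unordered multi-index. -/
noncomputable def mixedPartial (s : Multiset (Fin d)) (φ : PolyFun d) : PolyFun d :=
  s.foldr (fun i f => MvPolynomial.pderiv i f) φ

theorem mixedPartial_cons (i : Fin d) (s : Multiset (Fin d)) (φ : PolyFun d) :
    mixedPartial (i ::ₘ s) φ = MvPolynomial.pderiv i (mixedPartial s φ) :=
  Multiset.foldr_cons _ _ _ _

theorem mixedPartial_singleton (i : Fin d) (φ : PolyFun d) :
    mixedPartial {i} φ = MvPolynomial.pderiv i φ :=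
  Multiset.foldr_singleton _ _ _

theorem iterPartial_ofFn {n : ℕ} (ι : Fin n → Fin d) (φ : PolyFun d) :
    iterPartial (List.ofFn ι) φ = mixedPartial (Finset.univ.val.map ι) φ := by
  rw [Fin.univ_val_map, mixedPartial, Multiset.coe_foldr]
  rfl

/-- The derivation `∂/∂θ_i` of polyvector fields, these being the polynomials in the `x_j` and the
odd variables `θ_j = ∂/∂x_j`: the contraction with `dx_i`. -/
noncomputable abbrev thetaDeriv (i : Fin d) : Polyvector d →ₗ[PolyFun d] Polyvector d :=
  contractD (MvPolynomial.X i)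

theorem thetaDeriv_comm (i j : Fin d) (x : Polyvector d) :
    thetaDeriv i (thetaDeriv j x) = -thetaDeriv j (thetaDeriv i x) :=
  contractD_comm _ _ _

/-- The `O`-multilinear operation
`(x_1, …, x_n) ↦ ∑ φ_{i_1 ⋯ i_n} (∂x_1/∂θ_{i_1}) ∧ ⋯ ∧ (∂x_n/∂θ_{i_n})` on polyvector fields. -/
noncomputable def taylorBracket (φ : PolyFun d) (n : ℕ) :
    MultilinearMap (PolyFun d) (fun _ : Fin n => Polyvector d) (Polyvector d) :=
  ∑ ι : Fin n → Fin d, mixedPartial (Finset.univ.val.map ι) φ •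
    (MultilinearMap.mkPiAlgebraFin (PolyFun d) n (Polyvector d)).compLinearMap
      fun k => thetaDeriv (ι k)

theorem taylorBracket_apply (φ : PolyFun d) (n : ℕ) (x : Fin n → Polyvector d) :
    taylorBracket φ n x = ∑ ι : Fin n → Fin d, mixedPartial (Finset.univ.val.map ι) φ •
      (List.ofFn fun k => thetaDeriv (ι k) (x k)).prod := by
  simp [taylorBracket]

theorem taylorBracket_one (φ : PolyFun d) (x : Fin 1 → Polyvector d) :
    taylorBracket φ 1 x = contractD φ (x 0) := by
  rw [taylorBracket_apply, contractD_eq_sum, ← (Equiv.funUnique (Fin 1) (Fin d)).symm.sum_comp]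
  refine Finset.sum_congr rfl fun i _ => ?_
  simp [mixedPartial_singleton, Equiv.funUnique]

theorem taylorBracket_cons (φ : PolyFun d) (n : ℕ) (u : Polyvector d) (x : Fin n → Polyvector d) :
    taylorBracket φ (n + 1) (Fin.cons u x) = ∑ j, ∑ ι : Fin n → Fin d,
      mixedPartial (j ::ₘ Finset.univ.val.map ι) φ •
        (thetaDeriv j u * (List.ofFn fun k => thetaDeriv (ι k) (x k)).prod) := by
  rw [taylorBracket_apply, ← (Fin.consEquiv fun _ : Fin (n + 1) => Fin d).sum_comp,
    Fintype.sum_prod_type]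
  refine Finset.sum_congr rfl fun j _ => Finset.sum_congr rfl fun ι _ => ?_
  have h : (Finset.univ : Finset (Fin (n + 1))).val.map (Fin.cons j ι : Fin (n + 1) → Fin d)
      = j ::ₘ Finset.univ.val.map ι := by
    rw [Fin.univ_val_map, Fin.univ_val_map, List.ofFn_succ]
    simp
  simp only [Fin.consEquiv, Equiv.coe_fn_mk]
  rw [h, List.ofFn_succ, List.prod_cons]
  simp

/-- The `n`-ary operation raises the degree by one. -/
theorem taylorBracket_mem (φ : PolyFun d) {n : ℕ} (m : Fin n → ℕ) (x : Fin n → Polyvector d)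
    (hx : ∀ k, x k ∈ ⋀[PolyFun d]^(m k + 1) (VecField d)) :
    taylorBracket φ n x ∈ ⋀[PolyFun d]^(∑ k, m k) (VecField d) := by
  rw [taylorBracket_apply]
  exact Submodule.sum_mem _ fun ι _ => Submodule.smul_mem _ _
    (prod_ofFn_mem_exteriorPower m _ fun k => contractD_mem_exteriorPower _ (hx k))

/-- The `O`-linear map `-ι_{dφ}` from bivector fields to vector fields, extended by zero. -/
noncomputable def anchorMap (φ : PolyFun d) : Polyvector d →ₗ[PolyFun d] VecField d :=
  -(ExteriorAlgebra.ιInv ∘ₗ contractD φ)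

theorem anchorMap_apply (φ : PolyFun d) (x : Polyvector d) :
    anchorMap φ x = -ExteriorAlgebra.ιInv (contractD φ x) := rfl

theorem ι_anchorMap (φ : PolyFun d) {x : Polyvector d}
    (hx : x ∈ ⋀[PolyFun d]^2 (VecField d)) :
    ExteriorAlgebra.ι (PolyFun d) (anchorMap φ x) = -contractD φ x := by
  obtain ⟨X, hX⟩ := exists_ι_of_mem_exteriorPower_one (contractD_mem_exteriorPower φ hx)
  rw [anchorMap_apply, hX, ExteriorAlgebra.ι_leftInverse, map_neg]

theorem ιInv_algebraMap {R M : Type*} [CommRing R] [AddCommGroup M] [Module R M] (r : R) :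
    ExteriorAlgebra.ιInv (algebraMap R (ExteriorAlgebra R M) r) = 0 := by
  let : Module Rᵐᵒᵖ M := Module.compHom _ ((RingHom.id R).fromOpposite mul_comm)
  have : IsCentralScalar R M := ⟨fun r m => rfl⟩
  simp [ExteriorAlgebra.ιInv, TrivSqZeroExt.algebraMap_eq_inl]

theorem ιInv_ι_mul_ι_mul {R M : Type*} [CommRing R] [AddCommGroup M] [Module R M] (X Y : M)
    (z : ExteriorAlgebra R M) :
    ExteriorAlgebra.ιInv (ExteriorAlgebra.ι R X * (ExteriorAlgebra.ι R Y * z)) = 0 := by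
  let : Module Rᵐᵒᵖ M := Module.compHom _ ((RingHom.id R).fromOpposite mul_comm)
  have : IsCentralScalar R M := ⟨fun r m => rfl⟩
  simp [ExteriorAlgebra.ιInv]

theorem ιInv_of_mem_exteriorPower {k : ℕ} (hk : k ≠ 1) {x : Polyvector d}
    (hx : x ∈ ⋀[PolyFun d]^k (VecField d)) : ExteriorAlgebra.ιInv x = 0 := by
  rcases k with _ | _ | k
  · obtain ⟨f, rfl⟩ := exists_algebraMap_of_mem_exteriorPower_zero hx
    exact ιInv_algebraMap f
  · exact absurd rfl hk
  · refine exteriorPower_induction (p := fun y => ExteriorAlgebra.ιInv y = 0)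
      (fun x y hx hy => by rw [map_add, hx, hy, add_zero]) (fun X y hy => ?_) hx
    refine exteriorPower_induction
      (p := fun y => ExteriorAlgebra.ιInv (ExteriorAlgebra.ι (PolyFun d) X * y) = 0)
      (fun x y hx hy => by rw [mul_add, map_add, hx, hy, add_zero]) (fun Y z _ => ?_) hy
    exact ιInv_ι_mul_ι_mul X Y z

theorem anchorMap_of_mem_exteriorPower (φ : PolyFun d) {k : ℕ} (hk : k ≠ 2) {x : Polyvector d}
    (hx : x ∈ ⋀[PolyFun d]^k (VecField d)) : anchorMap φ x = 0 := by
  rw [anchorMap_apply, neg_eq_zero]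
  rcases k with _ | k
  · rw [contractD_of_mem_exteriorPower_zero φ hx, map_zero]
  · exact ιInv_of_mem_exteriorPower (by omega) (contractD_mem_exteriorPower φ hx)

/-- The flat connection on polyvector fields for which coordinate vector fields are parallel. -/
noncomputable def covDeriv (X : VecField d) : Polyvector d →ₗ[ℂ] Polyvector d :=
  ∑ j, X (MvPolynomial.X j) • coeffDeriv j

theorem covDeriv_apply (X : VecField d) (y : Polyvector d) :
    covDeriv X y = ∑ j, X (MvPolynomial.X j) • coeffDeriv j y := by
  simp [covDeriv]

theorem covDeriv_zero_left (y : Polyvector d) : covDeriv (0 : VecField d) y = 0 := by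
  simp [covDeriv_apply]

theorem covDeriv_add_left (X Y : VecField d) (y : Polyvector d) :
    covDeriv (X + Y) y = covDeriv X y + covDeriv Y y := by
  simp [covDeriv_apply, add_smul, Finset.sum_add_distrib]

theorem covDeriv_smul_left (f : PolyFun d) (X : VecField d) (y : Polyvector d) :
    covDeriv (f • X) y = f • covDeriv X y := by
  simp [covDeriv_apply, Finset.smul_sum, mul_smul]

theorem covDeriv_smul (f : PolyFun d) (X : VecField d) (y : Polyvector d) :
    covDeriv X (f • y) = X f • y + f • covDeriv X y := by
  simp only [covDeriv_apply, coeffDeriv_smul, smul_add, Finset.sum_add_distrib, Finset.smul_sum]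
  rw [derivation_apply_eq_sum X f, Finset.sum_smul, add_comm]
  congr 1
  · exact Finset.sum_congr rfl fun j _ => by rw [smul_smul]
  · exact Finset.sum_congr rfl fun j _ => smul_comm _ _ _

theorem covDeriv_mem_exteriorPower (X : VecField d) {k : ℕ} {y : Polyvector d}
    (hy : y ∈ ⋀[PolyFun d]^k (VecField d)) : covDeriv X y ∈ ⋀[PolyFun d]^k (VecField d) := by
  rw [covDeriv_apply]
  exact Submodule.sum_mem _ fun j _ => Submodule.smul_mem _ _ (coeffDeriv_mem_exteriorPower j hy)

theorem covDeriv_thetaDeriv (X : VecField d) (i : Fin d) (y : Polyvector d) :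
    covDeriv X (thetaDeriv i y) = thetaDeriv i (covDeriv X y) := by
  simp [covDeriv_apply, coeffDeriv_contractD_X]

theorem covDeriv_parity (X : VecField d) (y : Polyvector d) :
    covDeriv X (parity y) = parity (covDeriv X y) := by
  simp [covDeriv_apply, coeffDeriv_parity]

theorem covDeriv_wedgePartial (X : VecField d) (J : List (Fin d)) :
    covDeriv X (wedgePartial J) = 0 := by
  simp [covDeriv_apply, coeffDeriv_wedgePartial]

theorem covDeriv_ι (X Y : VecField d) :
    covDeriv X (ExteriorAlgebra.ι (PolyFun d) Y)
      = ∑ j, X (Y (MvPolynomial.X j)) •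
        ExteriorAlgebra.ι (PolyFun d) (MvPolynomial.pderiv j : VecField d) := by
  conv_lhs => rw [derivation_eq_sum Y, map_sum, map_sum]
  refine Finset.sum_congr rfl fun j _ => ?_
  have : ExteriorAlgebra.ι (PolyFun d) (MvPolynomial.pderiv j : VecField d) = wedgePartial [j] := by
    simp [wedgePartial]
  rw [map_smul, covDeriv_smul, this, covDeriv_wedgePartial, smul_zero, add_zero]

/-- The connection is torsion free. -/
theorem covDeriv_ι_sub_covDeriv_ι (X Y : VecField d) :
    covDeriv X (ExteriorAlgebra.ι (PolyFun d) Y) - covDeriv Y (ExteriorAlgebra.ι (PolyFun d) X)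
      = ExteriorAlgebra.ι (PolyFun d) ⁅X, Y⁆ := by
  rw [covDeriv_ι, covDeriv_ι, derivation_eq_sum ⁅X, Y⁆, map_sum, ← Finset.sum_sub_distrib]
  refine Finset.sum_congr rfl fun j _ => ?_
  rw [map_smul, Derivation.commutator_apply, sub_smul]

/-- The connection is flat. -/
theorem covDeriv_lie (X Y : VecField d) (y : Polyvector d) :
    covDeriv ⁅X, Y⁆ y = covDeriv X (covDeriv Y y) - covDeriv Y (covDeriv X y) := by
  induction y using polyvector_induction with
  | hadd x y hx hy => simp only [map_add, hx, hy]; abel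
  | hmon f J =>
    simp only [covDeriv_smul, covDeriv_wedgePartial, smul_zero, add_zero,
      Derivation.commutator_apply, sub_smul]

/-- The failure of the binary bracket to be `O`-bilinear:
`∇_{ρ(x)} y + (-1)^{|x| |y|} ∇_{ρ(y)} x`. Only an odd `y` has a nonzero anchor `ρ(y)`, so the sign is
`(-1)^{|x|}`, which is the opposite of the parity of the polyvector field `x`. -/
noncomputable def leibnizTerm (φ : PolyFun d) :
    MultilinearMap ℂ (fun _ : Fin 2 => Polyvector d) (Polyvector d) where
  toFun x := covDeriv (anchorMap φ (x 0)) (x 1) - covDeriv (anchorMap φ (x 1)) (parity (x 0))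
  map_update_add' x i u v := by
    fin_cases i
    · simp [covDeriv_add_left]; abel
    · simp [covDeriv_add_left]; abel
  map_update_smul' x i c u := by
    have h : ∀ z : Polyvector d, c • z = (MvPolynomial.C c : PolyFun d) • z := fun z => by
      rw [← MvPolynomial.algebraMap_eq, algebraMap_smul]
    fin_cases i
    · simp only [Fin.isValue, Fin.zero_eta, Function.update_self, ne_eq, one_ne_zero,
        not_false_eq_true, Function.update_of_ne]
      rw [smul_sub, h u, map_smul, covDeriv_smul_left, map_smul, ← h, ← h, map_smul]
    · simp only [Fin.isValue, Fin.mk_one, Function.update_self, ne_eq, zero_ne_one,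
        not_false_eq_true, Function.update_of_ne]
      rw [smul_sub, map_smul, h u, map_smul, covDeriv_smul_left, ← h]

theorem leibnizTerm_apply (φ : PolyFun d) (x : Fin 2 → Polyvector d) :
    leibnizTerm φ x = covDeriv (anchorMap φ (x 0)) (x 1)
      - covDeriv (anchorMap φ (x 1)) (parity (x 0)) := rfl

/-- The non-`O`-multilinear part of the brackets, which exists in arity two only. -/
noncomputable def correction (φ : PolyFun d) :
    (n : ℕ) → MultilinearMap ℂ (fun _ : Fin n => Polyvector d) (Polyvector d)
  | 2 => leibnizTerm φ
  | _ => 0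

/-- The `n`-ary bracket, before truncation. -/
noncomputable def polyBracket (φ : PolyFun d) (n : ℕ) :
    MultilinearMap ℂ (fun _ : Fin n => Polyvector d) (Polyvector d) :=
  (taylorBracket φ n).restrictScalars ℂ + correction φ n

theorem correction_of_ne (φ : PolyFun d) {n : ℕ} (hn : n ≠ 2) (x : Fin n → Polyvector d) :
    correction φ n x = 0 := by
  match n with
  | 0 => rfl
  | 1 => rfl
  | 2 => exact absurd rfl hn
  | n + 3 => rfl

end Brackets

/-! ### Compositions of brackets along a permutation -/

section Compositions

variable {d : ℕ}

/-- The set of the first `r` entries of the sequence `σ(0), σ(1), …`. -/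
def headImage {N : ℕ} (σ : Equiv.Perm (Fin N)) (r : ℕ) : Finset (Fin N) :=
  Finset.univ.filter fun k => (σ.symm k : ℕ) < r

theorem mem_headImage {N : ℕ} {σ : Equiv.Perm (Fin N)} {r : ℕ} {k : Fin N} :
    k ∈ headImage σ r ↔ (σ.symm k : ℕ) < r := by simp [headImage]

theorem headImage_eq_map {r s : ℕ} (σ : Equiv.Perm (Fin (r + s))) :
    headImage σ r = Finset.univ.map ((Fin.castAddEmb s).trans σ.toEmbedding) := by
  ext k
  simp only [mem_headImage, Finset.mem_map, Finset.mem_univ, true_and]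
  constructor
  · intro h
    exact ⟨⟨σ.symm k, h⟩, by simp [Fin.castAdd, Fin.castLE]⟩
  · rintro ⟨p, rfl⟩
    simp

theorem compl_headImage_eq_map {r s : ℕ} (σ : Equiv.Perm (Fin (r + s))) :
    (headImage σ r)ᶜ = Finset.univ.map ((Fin.natAddEmb r).trans σ.toEmbedding) := by
  ext k
  simp only [mem_headImage, Finset.mem_compl, Finset.mem_map, Finset.mem_univ, true_and, not_lt]
  constructor
  · intro h
    refine ⟨⟨(σ.symm k : ℕ) - r, by omega⟩, ?_⟩
    have : Fin.natAdd r (⟨(σ.symm k : ℕ) - r, by omega⟩ : Fin s) = σ.symm k := by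
      ext; simp; omega
    simp [this]
  · rintro ⟨p, rfl⟩
    simp

theorem map_val_headImage {r s : ℕ} {α : Type*} (σ : Equiv.Perm (Fin (r + s)))
    (ι : Fin (r + s) → α) :
    (headImage σ r).val.map ι = Finset.univ.val.map fun p : Fin r => ι (σ (Fin.castAdd s p)) := by
  rw [headImage_eq_map, Finset.map_val, Multiset.map_map]
  rfl

theorem map_val_compl_headImage {r s : ℕ} {α : Type*} (σ : Equiv.Perm (Fin (r + s)))
    (ι : Fin (r + s) → α) :
    (headImage σ r)ᶜ.val.map ι
      = Finset.univ.val.map fun p : Fin s => ι (σ (Fin.natAdd r p)) := by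
  rw [compl_headImage_eq_map, Finset.map_val, Multiset.map_map]
  rfl

theorem sum_headImage {r s : ℕ} {A : Type*} [AddCommMonoid A] (σ : Equiv.Perm (Fin (r + s)))
    (f : Fin (r + s) → A) :
    ∑ k ∈ headImage σ r, f k = ∑ p : Fin r, f (σ (Fin.castAdd s p)) := by
  rw [headImage_eq_map, Finset.sum_map]
  rfl

/-- A pair of multi-indices, for the arguments before and after position `r`, is a multi-index for all
the arguments. -/
theorem sum_sum_eq_sum_comp_perm {r s : ℕ} {A : Type*} [AddCommMonoid A]
    (σ : Equiv.Perm (Fin (r + s))) (G : (Fin r → Fin d) → (Fin s → Fin d) → A) :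
    ∑ κ, ∑ l, G l κ = ∑ ι : Fin (r + s) → Fin d,
      G (fun p => ι (σ (Fin.castAdd s p))) (fun p => ι (σ (Fin.natAdd r p))) := by
  rw [Finset.sum_comm, ← Fintype.sum_prod_type']
  symm
  let e : (Fin (r + s) → Fin d) ≃ (Fin r → Fin d) × (Fin s → Fin d) :=
    (Equiv.arrowCongr σ.symm (Equiv.refl _)).trans (Fin.appendEquiv r s).symm
  exact Fintype.sum_equiv e _ (fun p => G p.1 p.2) fun ι => rfl

theorem signBefore_castAdd {r s : ℕ} (a : Fin (r + s) → ℤ) (q : Fin r) :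
    signBefore a (Fin.castAdd s q) = signBefore (fun p => a (Fin.castAdd s p)) q := by
  rw [signBefore, signBefore, Finset.prod_filter, Finset.prod_filter, Fin.prod_univ_add]
  have : ∀ x : Fin s, ¬ Fin.natAdd r x < Fin.castAdd s q := by
    intro x
    simp only [Fin.lt_def, Fin.val_natAdd, Fin.val_castAdd]
    omega
  simp only [this, if_false, Finset.prod_const_one, mul_one]
  rfl

theorem prod_ofFn_add {A : Type*} [Monoid A] {r s : ℕ} (H : Fin (r + s) → A) :
    (List.ofFn H).prod = (List.ofFn fun p => H (Fin.castAdd s p)).prod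
      * (List.ofFn fun p => H (Fin.natAdd r p)).prod := by
  rw [List.ofFn_add, List.prod_append]
  rfl

/-- A family of homogeneous polyvector fields of degree at least two, together with its degrees in
the truncated Koszul complex: `𝔛^(m + 2)` sits in degree `-(m + 1)`. -/
structure HomogeneousFamily {N : ℕ} (m : Fin N → ℕ) (a : Fin N → ℤ) (y : Fin N → Polyvector d) :
    Prop where
  mem : ∀ k, y k ∈ ⋀[PolyFun d]^(m k + 2) (VecField d)
  deg : ∀ k, a k = -((m k : ℤ) + 1)

namespace HomogeneousFamily

variable {N : ℕ} {m : Fin N → ℕ} {a : Fin N → ℤ} {y : Fin N → Polyvector d}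

theorem negOnePow_deg (h : HomogeneousFamily m a y) (k : Fin N) :
    Int.negOnePow (a k) = Int.negOnePow ((m k + 1 : ℕ) : ℤ) := by
  rw [h.deg, Int.negOnePow_neg]
  norm_num

theorem hasParity_thetaDeriv (h : HomogeneousFamily m a y) (i : Fin d) (k : Fin N) :
    HasParity (a k) (thetaDeriv i (y k)) :=
  (hasParity_of_mem_exteriorPower (contractD_mem_exteriorPower _ (h.mem k))).congr
    ⟨(m k : ℤ) + 1, by rw [h.deg]; push_cast; ring⟩

theorem parity_thetaDeriv (h : HomogeneousFamily m a y) (i : Fin d) (k : Fin N) :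
    parity (thetaDeriv i (y k)) = Int.negOnePow (a k) • thetaDeriv i (y k) := by
  rw [h.negOnePow_deg]
  exact parity_of_mem_exteriorPower (contractD_mem_exteriorPower _ (h.mem k))

theorem hasParity_coeffDeriv_thetaDeriv (h : HomogeneousFamily m a y) (i j : Fin d) (k : Fin N) :
    HasParity (a k) (coeffDeriv j (thetaDeriv i (y k))) :=
  (hasParity_of_mem_exteriorPower (coeffDeriv_mem_exteriorPower _
    (contractD_mem_exteriorPower _ (h.mem k)))).congr
    ⟨(m k : ℤ) + 1, by rw [h.deg]; push_cast; ring⟩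

theorem hasParity_thetaDeriv_thetaDeriv (h : HomogeneousFamily m a y) (i j : Fin d) (k : Fin N) :
    HasParity (a k + 1) (thetaDeriv j (thetaDeriv i (y k))) :=
  (hasParity_of_mem_exteriorPower (contractD_mem_exteriorPower _
    (contractD_mem_exteriorPower _ (h.mem k)))).congr ⟨(m k : ℤ), by rw [h.deg]; ring⟩

end HomogeneousFamily

/-- The contribution to the Jacobi identity in which the inner bracket takes the arguments in `S`
and the outer bracket differentiates the argument number `k ∈ S`. -/
noncomputable def jacobiTerm (φ : PolyFun d) {N : ℕ} (a : Fin N → ℤ) (y : Fin N → Polyvector d)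
    (S : Finset (Fin N)) (k : Fin N) : Polyvector d :=
  ∑ j, ∑ ι : Fin N → Fin d,
    (mixedPartial (S.val.map ι) φ * mixedPartial (j ::ₘ Sᶜ.val.map ι) φ) • signBefore a k •
      (List.ofFn (Function.update (fun l => thetaDeriv (ι l) (y l)) k
        (thetaDeriv j (thetaDeriv (ι k) (y k))))).prod

/-- The contribution to the Jacobi identity in which the coefficients of the argument number `c` are
differentiated along the anchor of the argument number `b`. -/
noncomputable def connectionTerm (φ : PolyFun d) {N : ℕ} (a : Fin N → ℤ)
    (y : Fin N → Polyvector d) (b c : Fin N) : Polyvector d :=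
  ∑ j, ∑ ι : Fin N → Fin d,
    (MvPolynomial.pderiv (ι b) φ * mixedPartial (({b} : Finset (Fin N))ᶜ.val.map ι) φ) •
      signBefore a b •
      (List.ofFn (Function.update (Function.update (fun l => thetaDeriv (ι l) (y l)) b
        (thetaDeriv j (thetaDeriv (ι b) (y b)))) c (coeffDeriv j (thetaDeriv (ι c) (y c))))).prod

/-- The composition of the multilinear parts of two brackets: the outer bracket contracts the inner
one with `dx_j`, and this odd derivation hits one of the factors of the inner bracket. -/
theorem koszulSign_smul_taylorBracket_taylorBracket (φ : PolyFun d) {N r s : ℕ} (hN : r + s = N)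
    {m : Fin N → ℕ} {a : Fin N → ℤ} {y : Fin N → Polyvector d} (hy : HomogeneousFamily m a y)
    (σ : Equiv.Perm (Fin N)) :
    koszulSign a σ • taylorBracket φ (s + 1)
      (Fin.cons (taylorBracket φ r fun p => y (σ ⟨p, by omega⟩))
        fun p => y (σ ⟨r + p, by omega⟩))
      = ∑ k ∈ headImage σ r, jacobiTerm φ a y (headImage σ r) k := by
  subst hN
  rw [taylorBracket_cons, taylorBracket_apply, sum_headImage]
  simp only [jacobiTerm]
  conv_rhs => rw [Finset.sum_comm]
  rw [Finset.smul_sum]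
  refine Finset.sum_congr rfl fun j _ => ?_
  conv_rhs => rw [Finset.sum_comm]
  simp only [map_sum, Finset.sum_mul, Finset.smul_sum]
  rw [sum_sum_eq_sum_comp_perm (A := Polyvector d) σ
    (fun (l : Fin r → Fin d) (κ : Fin s → Fin d) => koszulSign a σ •
    mixedPartial (j ::ₘ Finset.univ.val.map κ) φ •
      (thetaDeriv j (mixedPartial (Finset.univ.val.map l) φ •
        (List.ofFn fun k : Fin r => thetaDeriv (l k) (y (σ ⟨k, by omega⟩))).prod) *
      (List.ofFn fun k : Fin s => thetaDeriv (κ k) (y (σ ⟨r + k, by omega⟩))).prod))]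
  refine Finset.sum_congr rfl fun ι _ => ?_
  rw [map_val_headImage, map_val_compl_headImage, map_smul,
    contractD_prod_ofFn _ (fun p => a (σ (Fin.castAdd s p)))
      (fun p : Fin r => thetaDeriv (ι (σ (Fin.castAdd s p))) (y (σ ⟨p, by omega⟩)))
      (fun p => hy.parity_thetaDeriv _ _), smul_mul_assoc, smul_smul, smul_comm (koszulSign a σ),
    mul_comm, Finset.sum_mul, Finset.smul_sum, Finset.smul_sum]
  refine Finset.sum_congr rfl fun q _ => ?_
  congr 1
  rw [← koszulSign_smul_signBefore_smul_prod_ofFn, prod_ofFn_add, smul_mul_assoc,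
    signBefore_castAdd]
  · congr 4
    · congr 1
      funext p
      by_cases hp : p = q
      · subst hp
        simp
        rfl
      · have : Fin.castAdd s p ≠ Fin.castAdd s q := fun h => hp (Fin.castAdd_injective _ _ h)
        simp [Function.update_of_ne hp, this]
        rfl
    · congr 1
      funext p
      have : Fin.natAdd r p ≠ Fin.castAdd s q := by
        intro h
        have := congrArg Fin.val h
        simp at this
        omega
      simp [this]
      rfl
  · intro k l _
    refine mul_comm_of_hasParity _ _ (fun k => ?_) k l
    by_cases hk : k = σ (Fin.castAdd s q)
    · subst hk
      simpa using hy.hasParity_thetaDeriv_thetaDeriv _ _ _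
    · simpa [Function.update_of_ne hk] using hy.hasParity_thetaDeriv _ _

/-- The contributions that do not differentiate coefficients of the arguments cancel in pairs:
exchanging the roles of the two derivatives `φ_{i_S}` and `φ_{j i_{Sᶜ}}` of `φ` replaces
`∂²y_k/∂θ_j∂θ_{i_k}` by its opposite. -/
theorem sum_jacobiTerm (φ : PolyFun d) {N : ℕ} (a : Fin N → ℤ) (y : Fin N → Polyvector d) :
    ∑ S : Finset (Fin N), ∑ k ∈ S, jacobiTerm φ a y S k = 0 := by
  have h1 : ∑ S : Finset (Fin N), ∑ k ∈ S, jacobiTerm φ a y S k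
      = ∑ k, ∑ S ∈ Finset.univ.filter (fun S : Finset (Fin N) => k ∈ S), jacobiTerm φ a y S k := by
    simp only [Finset.sum_filter]
    rw [Finset.sum_comm]
    refine Finset.sum_congr rfl fun S _ => ?_
    rw [← Finset.sum_filter]
    simp
  rw [h1]
  refine Finset.sum_eq_zero fun k _ => ?_
  set F : Finset (Fin N) × Fin d × (Fin N → Fin d) → Polyvector d := fun p =>
    (mixedPartial (p.1.val.map p.2.2) φ * mixedPartial (p.2.1 ::ₘ p.1ᶜ.val.map p.2.2) φ) •
      signBefore a k • (List.ofFn (Function.update (fun l => thetaDeriv (p.2.2 l) (y l)) k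
        (thetaDeriv p.2.1 (thetaDeriv (p.2.2 k) (y k))))).prod with hF
  set T : Finset (Finset (Fin N) × Fin d × (Fin N → Fin d)) :=
    (Finset.univ.filter fun S : Finset (Fin N) => k ∈ S) ×ˢ Finset.univ with hT
  have h2 : ∑ S ∈ Finset.univ.filter (fun S : Finset (Fin N) => k ∈ S), jacobiTerm φ a y S k
      = ∑ p ∈ T, F p := by
    rw [hT, Finset.sum_product]
    refine Finset.sum_congr rfl fun S _ => ?_
    rw [Fintype.sum_prod_type]
    rfl
  rw [h2]
  -- the involution exchanging `S` with `Sᶜ ∪ {k}` and the index `j` with `ι k`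
  let inv : Finset (Fin N) × Fin d × (Fin N → Fin d) → Finset (Fin N) × Fin d × (Fin N → Fin d) :=
    fun p => (insert k p.1ᶜ, p.2.2 k, Function.update p.2.2 k p.2.1)
  have hinv : ∀ p ∈ T, inv (inv p) = p := by
    rintro ⟨S, j, ι⟩ hp
    simp only [hT, Finset.mem_product, Finset.mem_filter, Finset.mem_univ, true_and,
      and_true] at hp
    simp only [inv, Function.update_self, Function.update_idem, Function.update_eq_self,
      Prod.mk.injEq, and_true]
    rw [Finset.compl_insert, compl_compl, Finset.insert_erase hp]
  have hmem : ∀ p ∈ T, inv p ∈ T := by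
    rintro ⟨S, j, ι⟩ _
    simp [hT, inv]
  have hneg : ∀ p ∈ T, F (inv p) = -F p := by
    rintro ⟨S, j, ι⟩ hp
    simp only [hT, Finset.mem_product, Finset.mem_filter, Finset.mem_univ, true_and,
      and_true] at hp
    have hu : ∀ s : Finset (Fin N), k ∉ s →
        s.val.map (Function.update ι k j) = s.val.map ι := by
      intro s hs
      refine Multiset.map_congr rfl fun l hl => Function.update_of_ne ?_ _ _
      rintro rfl
      exact hs hl
    have e1 : (insert k Sᶜ).val.map (Function.update ι k j) = j ::ₘ Sᶜ.val.map ι := by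
      rw [Finset.insert_val_of_notMem (by simpa using hp), Multiset.map_cons,
        Function.update_self, hu _ (by simpa using hp)]
    have e2 : ι k ::ₘ (insert k Sᶜ)ᶜ.val.map (Function.update ι k j) = S.val.map ι := by
      rw [Finset.compl_insert, compl_compl, hu _ (by simp), ← Multiset.map_cons]
      conv_rhs => rw [← Finset.insert_erase hp, Finset.insert_val_of_notMem (by simp)]
    have e3 : Function.update (fun l => thetaDeriv (Function.update ι k j l) (y l)) k
        (thetaDeriv (ι k) (thetaDeriv (Function.update ι k j k) (y k)))
        = Function.update (fun l => thetaDeriv (ι l) (y l)) k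
          (-thetaDeriv j (thetaDeriv (ι k) (y k))) := by
      funext l
      by_cases hl : l = k
      · subst hl
        simp [thetaDeriv_comm (ι l) j]
      · simp [hl]
    have e4 : (List.ofFn (Function.update (fun l => thetaDeriv (ι l) (y l)) k
          (-thetaDeriv j (thetaDeriv (ι k) (y k))))).prod
        = -(List.ofFn (Function.update (fun l => thetaDeriv (ι l) (y l)) k
          (thetaDeriv j (thetaDeriv (ι k) (y k))))).prod := by
      have := (MultilinearMap.mkPiAlgebraFin (PolyFun d) N (Polyvector d)).map_update_neg
        (fun l => thetaDeriv (ι l) (y l)) k (thetaDeriv j (thetaDeriv (ι k) (y k)))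
      rwa [MultilinearMap.mkPiAlgebraFin_apply, MultilinearMap.mkPiAlgebraFin_apply] at this
    simp only [hF, inv]
    rw [e1, e2, e3, e4, smul_neg, smul_neg, mul_comm]
  have h3 : ∑ p ∈ T, F p = -∑ p ∈ T, F p := by
    rw [← Finset.sum_neg_distrib]
    refine Finset.sum_nbij' inv inv hmem hmem hinv hinv fun p hp => ?_
    rw [hneg p hp, neg_neg]
  have h4 : (2 : ℂ) • ∑ p ∈ T, F p = 0 := by
    rw [two_smul]
    exact add_eq_zero_iff_eq_neg.mpr h3
  exact (smul_eq_zero.mp h4).resolve_left two_ne_zero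

end Compositions

/-! ### Compositions with the flat connection -/

section Connection

variable {d : ℕ}

theorem algebraMap_anchorMap (φ : PolyFun d) {x : Polyvector d}
    (hx : x ∈ ⋀[PolyFun d]^2 (VecField d)) (j : Fin d) :
    algebraMap (PolyFun d) (Polyvector d) (anchorMap φ x (MvPolynomial.X j))
      = -∑ i, MvPolynomial.pderiv i φ • thetaDeriv j (thetaDeriv i x) := by
  rw [← contractD_ι, ι_anchorMap φ hx, map_neg, contractD_eq_sum φ, map_sum]
  simp only [map_smul]

/-- The coefficients `∂²x/∂θ_j∂θ_i` of the anchor are written as factors in the exterior algebra, on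
either side, in order to combine them with the factors of a bracket. -/
theorem covDeriv_anchorMap (φ : PolyFun d) {x : Polyvector d}
    (hx : x ∈ ⋀[PolyFun d]^2 (VecField d)) (z : Polyvector d) :
    covDeriv (anchorMap φ x) z = -∑ j, ∑ i,
      MvPolynomial.pderiv i φ • (thetaDeriv j (thetaDeriv i x) * coeffDeriv j z) := by
  rw [covDeriv_apply, ← Finset.sum_neg_distrib]
  refine Finset.sum_congr rfl fun j _ => ?_
  rw [Algebra.smul_def, algebraMap_anchorMap φ hx, neg_mul, Finset.sum_mul]
  simp only [smul_mul_assoc]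

theorem thetaDeriv_thetaDeriv_mul_comm {x : Polyvector d}
    (hx : x ∈ ⋀[PolyFun d]^2 (VecField d)) (i j : Fin d) (z : Polyvector d) :
    thetaDeriv j (thetaDeriv i x) * z = z * thetaDeriv j (thetaDeriv i x) := by
  obtain ⟨f, hf⟩ := exists_algebraMap_of_mem_exteriorPower_zero
    (contractD_mem_exteriorPower (MvPolynomial.X j)
      (contractD_mem_exteriorPower (MvPolynomial.X i) hx))
  rw [hf, Algebra.commutes]

theorem covDeriv_anchorMap' (φ : PolyFun d) {x : Polyvector d}
    (hx : x ∈ ⋀[PolyFun d]^2 (VecField d)) (z : Polyvector d) :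
    covDeriv (anchorMap φ x) z = -∑ j, ∑ i,
      MvPolynomial.pderiv i φ • (coeffDeriv j z * thetaDeriv j (thetaDeriv i x)) := by
  rw [covDeriv_anchorMap φ hx]
  simp only [thetaDeriv_thetaDeriv_mul_comm hx]

theorem units_smul_smul_comm (u : ℤˣ) (f : PolyFun d) (x : Polyvector d) :
    u • f • x = f • u • x := by
  rcases Int.units_eq_one_or u with h | h <;> simp [h]

/-- Sorting the factors of the products occurring in the connection terms. -/
theorem koszulSign_smul_prod_connectionTerm {N : ℕ} {m : Fin N → ℕ} {a : Fin N → ℤ}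
    {y : Fin N → Polyvector d} (hy : HomogeneousFamily m a y) (σ : Equiv.Perm (Fin N))
    (ι : Fin N → Fin d) (j : Fin d) (q p : Fin N) (hpq : p ≠ q) :
    koszulSign a σ • signBefore (a ∘ σ) q • (List.ofFn fun k => Function.update
        (Function.update (fun l => thetaDeriv (ι l) (y l)) (σ q)
          (thetaDeriv j (thetaDeriv (ι (σ q)) (y (σ q))))) (σ p)
          (coeffDeriv j (thetaDeriv (ι (σ p)) (y (σ p)))) (σ k)).prod
      = signBefore a (σ q) • (List.ofFn (Function.update
        (Function.update (fun l => thetaDeriv (ι l) (y l)) (σ q)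
          (thetaDeriv j (thetaDeriv (ι (σ q)) (y (σ q))))) (σ p)
          (coeffDeriv j (thetaDeriv (ι (σ p)) (y (σ p)))))).prod := by
  refine koszulSign_smul_signBefore_smul_prod_ofFn σ a q _ fun k l _ => ?_
  refine mul_comm_of_hasParity _ _ (fun k => ?_) k l
  have hne : σ p ≠ σ q := fun h => hpq (σ.injective h)
  by_cases hk : k = σ p
  · subst hk
    simpa [hne] using hy.hasParity_coeffDeriv_thetaDeriv _ _ _
  · by_cases hk' : k = σ q
    · subst hk'
      simpa [hk] using hy.hasParity_thetaDeriv_thetaDeriv _ _ _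
    · simpa [hk, hk'] using hy.hasParity_thetaDeriv _ _

/-- Sorting the factors of the products occurring in the terms with two odd derivatives. -/
theorem koszulSign_smul_prod_jacobiTerm {N : ℕ} {m : Fin N → ℕ} {a : Fin N → ℤ}
    {y : Fin N → Polyvector d} (hy : HomogeneousFamily m a y) (σ : Equiv.Perm (Fin N))
    (ι : Fin N → Fin d) (j : Fin d) (q : Fin N) :
    koszulSign a σ • signBefore (a ∘ σ) q • (List.ofFn fun k =>
        Function.update (fun l => thetaDeriv (ι l) (y l)) (σ q)
          (thetaDeriv j (thetaDeriv (ι (σ q)) (y (σ q)))) (σ k)).prod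
      = signBefore a (σ q) • (List.ofFn
        (Function.update (fun l => thetaDeriv (ι l) (y l)) (σ q)
          (thetaDeriv j (thetaDeriv (ι (σ q)) (y (σ q)))))).prod := by
  refine koszulSign_smul_signBefore_smul_prod_ofFn σ a q _ fun k l _ => ?_
  refine mul_comm_of_hasParity _ _ (fun k => ?_) k l
  by_cases hk' : k = σ q
  · subst hk'
    simpa using hy.hasParity_thetaDeriv_thetaDeriv _ _ _
  · simpa [hk'] using hy.hasParity_thetaDeriv _ _

theorem parity_taylorBracket (φ : PolyFun d) {N : ℕ} {m : Fin N → ℕ} {a : Fin N → ℤ}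
    {y : Fin N → Polyvector d} (hy : HomogeneousFamily m a y) :
    parity (taylorBracket φ N y) = (∏ k, Int.negOnePow (a k)) • taylorBracket φ N y := by
  rw [taylorBracket_apply, map_sum, Finset.smul_sum]
  refine Finset.sum_congr rfl fun ι _ => ?_
  rw [map_smul, parity_prod_ofFn a _ (fun k => hy.parity_thetaDeriv _ _), units_smul_smul_comm]

theorem HomogeneousFamily.comp {N M : ℕ} {m : Fin N → ℕ} {a : Fin N → ℤ}
    {y : Fin N → Polyvector d} (hy : HomogeneousFamily m a y) (f : Fin M → Fin N) :
    HomogeneousFamily (fun k => m (f k)) (fun k => a (f k)) (fun k => y (f k)) :=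
  ⟨fun _ => hy.mem _, fun _ => hy.deg _⟩

/-- The covariant derivative of a bracket along the anchor of the last argument. Differentiating the
coefficients `φ_{i_1 ⋯ i_r}` gives the first term, differentiating the factors gives the others. -/
theorem koszulSign_smul_covDeriv_taylorBracket (φ : PolyFun d) {N r : ℕ} (hN : r + 1 = N)
    {m : Fin N → ℕ} {a : Fin N → ℤ} {y : Fin N → Polyvector d} (hy : HomogeneousFamily m a y)
    (σ : Equiv.Perm (Fin N)) (b : Fin N) (hb : b = σ ⟨r, by omega⟩) :
    koszulSign a σ • covDeriv (anchorMap φ (y b))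
        (parity (taylorBracket φ r fun p => y (σ ⟨p, by omega⟩)))
      = -if m b = 0 then jacobiTerm φ a y {b} b + ∑ c ∈ ({b} : Finset (Fin N))ᶜ,
          connectionTerm φ a y b c else 0 := by
  subst hN
  have hb' : b = σ (Fin.natAdd r 0) := hb
  by_cases hm : m b = 0
  swap
  · rw [anchorMap_of_mem_exteriorPower φ (k := m b + 2) (by omega) (hy.mem b), covDeriv_zero_left,
      if_neg hm, smul_zero, neg_zero]
  have hyb : y b ∈ ⋀[PolyFun d]^2 (VecField d) := by simpa [hm] using hy.mem b
  have hS : (headImage σ r)ᶜ = {b} := by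
    rw [compl_headImage_eq_map, hb', Finset.univ_unique, Finset.map_singleton]
    rfl
  have hS' : ({b} : Finset (Fin (r + 1)))ᶜ = headImage σ r := by rw [← hS, compl_compl]
  have hsign : signBefore (a ∘ σ) (Fin.natAdd r 0)
      = ∏ k : Fin r, Int.negOnePow (a (σ (Fin.castAdd 1 k))) := by
    rw [signBefore, Finset.prod_filter, Fin.prod_univ_add]
    simp [Fin.lt_def]
  rw [if_pos hm, hS', sum_headImage, parity_taylorBracket φ (hy.comp fun p : Fin r => σ ⟨p, by omega⟩)]
  change koszulSign a σ • covDeriv (anchorMap φ (y b))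
      ((∏ k : Fin r, Int.negOnePow (a (σ (Fin.castAdd 1 k)))) • _) = _
  rw [← hsign, covDeriv_anchorMap' φ hyb, smul_neg]
  congr 1
  simp only [jacobiTerm, connectionTerm]
  conv_rhs => enter [2]; rw [Finset.sum_comm]
  rw [← Finset.sum_add_distrib, Finset.smul_sum]
  refine Finset.sum_congr rfl fun j _ => ?_
  conv_rhs => enter [2]; rw [Finset.sum_comm]
  rw [← Finset.sum_add_distrib]
  have h1 : ∀ i, koszulSign a σ • MvPolynomial.pderiv i φ •
      (coeffDeriv j (signBefore (a ∘ σ) (Fin.natAdd r 0) •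
        taylorBracket φ r fun p => y (σ ⟨p, by omega⟩)) * thetaDeriv j (thetaDeriv i (y b)))
      = ∑ l : Fin r → Fin d, koszulSign a σ • signBefore (a ∘ σ) (Fin.natAdd r 0) •
        MvPolynomial.pderiv i φ •
        (coeffDeriv j (mixedPartial (Finset.univ.val.map l) φ •
          (List.ofFn fun p : Fin r => thetaDeriv (l p) (y (σ (Fin.castAdd 1 p)))).prod)
          * thetaDeriv j (thetaDeriv i (y b))) := by
    intro i
    rw [Units.smul_def (signBefore _ _), map_zsmul, ← Units.smul_def, smul_mul_assoc,
      ← units_smul_smul_comm, taylorBracket_apply, map_sum, Finset.sum_mul, Finset.smul_sum,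
      Finset.smul_sum, Finset.smul_sum]
    rfl
  rw [Finset.smul_sum, Finset.sum_congr rfl fun i _ => h1 i,
    ← (Equiv.funUnique (Fin 1) (Fin d)).sum_comp,
    sum_sum_eq_sum_comp_perm (A := Polyvector d) σ
      (fun (l : Fin r → Fin d) (κ : Fin 1 → Fin d) =>
        koszulSign a σ • signBefore (a ∘ σ) (Fin.natAdd r 0) •
        MvPolynomial.pderiv (Equiv.funUnique (Fin 1) (Fin d) κ) φ •
        (coeffDeriv j (mixedPartial (Finset.univ.val.map l) φ •
          (List.ofFn fun p : Fin r => thetaDeriv (l p) (y (σ (Fin.castAdd 1 p)))).prod)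
          * thetaDeriv j (thetaDeriv (Equiv.funUnique (Fin 1) (Fin d) κ) (y b))))]
  refine Finset.sum_congr rfl fun ι _ => ?_
  have hι : Equiv.funUnique (Fin 1) (Fin d) (fun p => ι (σ (Fin.natAdd r p))) = ι b := by
    rw [hb']; rfl
  rw [hι, hS', Finset.singleton_val, Multiset.map_singleton, mixedPartial_singleton,
    map_val_headImage, mixedPartial_cons, coeffDeriv_smul, add_mul, smul_add, smul_add,
    smul_add]
  refine (add_comm _ _).trans ?_
  congr 1
  · rw [smul_mul_assoc, smul_smul (MvPolynomial.pderiv _ _), units_smul_smul_comm, units_smul_smul_comm]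
    congr 1
    have := koszulSign_smul_prod_jacobiTerm hy σ ι j (Fin.natAdd r 0)
    rw [← hb'] at this
    rw [← this, prod_ofFn_add]
    congr 3
    · refine congrArg (fun H => (List.ofFn H).prod) (funext fun p => ?_)
      have : σ (Fin.castAdd 1 p) ≠ b := by
        rw [hb']
        intro h
        have := congrArg Fin.val (σ.injective h)
        simp at this
        omega
      simp [this]
    · simp [← hb']
  · rw [smul_mul_assoc, smul_smul (MvPolynomial.pderiv _ _), units_smul_smul_comm, units_smul_smul_comm,
      coeffDeriv_prod_ofFn, Finset.sum_mul, Finset.smul_sum, Finset.smul_sum, Finset.smul_sum]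
    refine Finset.sum_congr rfl fun q _ => ?_
    congr 1
    have hne : ∀ p : Fin r, Fin.castAdd 1 p ≠ Fin.natAdd r 0 := by
      intro p h
      have := congrArg Fin.val h
      simp at this
      omega
    have hne' : ∀ p : Fin r, σ (Fin.castAdd 1 p) ≠ b := by
      intro p h
      rw [hb'] at h
      exact hne p (σ.injective h)
    have := koszulSign_smul_prod_connectionTerm hy σ ι j (Fin.natAdd r 0) (Fin.castAdd 1 q) (hne q)
    rw [← hb'] at this
    rw [← this, prod_ofFn_add]
    congr 3
    · refine congrArg (fun H => (List.ofFn H).prod) (funext fun p => ?_)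
      by_cases hp : p = q
      · subst hp
        simp
      · have h2 : Fin.castAdd 1 p ≠ Fin.castAdd 1 q := fun h => hp (Fin.castAdd_injective _ _ h)
        simp [hp, h2, hne' p]
    · have := (hne' q).symm
      simp [← hb', this]

theorem sum_sum_eq_sum_fin_two {A : Type*} [AddCommMonoid A] (q p : Fin 2) (hpq : p ≠ q)
    (f : Fin d → Fin d → A) : ∑ i, ∑ i', f i i' = ∑ l : Fin 2 → Fin d, f (l q) (l p) := by
  rw [← (finTwoArrowEquiv (Fin d)).symm.sum_comp, Fintype.sum_prod_type]
  fin_cases q <;> fin_cases p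
  · exact absurd rfl hpq
  · rfl
  · exact Finset.sum_comm
  · exact absurd rfl hpq

/-- A bracket containing the covariant derivative of one of the two first arguments along the anchor
of the other one. -/
theorem koszulSign_smul_taylorBracket_covDeriv (φ : PolyFun d) {N s : ℕ} (hN : 2 + s = N)
    {m : Fin N → ℕ} {a : Fin N → ℤ} {y : Fin N → Polyvector d} (hy : HomogeneousFamily m a y)
    (σ : Equiv.Perm (Fin N)) (q p : Fin 2) (hpq : p ≠ q) (b c : Fin N)
    (hb : b = σ ⟨q, by omega⟩) (hc : c = σ ⟨p, by omega⟩) :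
    koszulSign a σ • signBefore (a ∘ σ) ⟨q, by omega⟩ • taylorBracket φ (s + 1)
      (Fin.cons (covDeriv (anchorMap φ (y b)) (y c)) fun p => y (σ ⟨2 + p, by omega⟩))
      = -if m b = 0 then connectionTerm φ a y b c else 0 := by
  subst hN
  have hb' : b = σ (Fin.castAdd s q) := hb
  have hc' : c = σ (Fin.castAdd s p) := hc
  by_cases hm : m b = 0
  swap
  · rw [anchorMap_of_mem_exteriorPower φ (k := m b + 2) (by omega) (hy.mem b), covDeriv_zero_left,
      if_neg hm, neg_zero]
    have : taylorBracket φ (s + 1)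
        (Fin.cons 0 fun p => y (σ ⟨2 + p, by omega⟩)) = 0 :=
      (taylorBracket φ (s + 1)).map_coord_zero 0 rfl
    rw [this, smul_zero, smul_zero]
  have hyb : y b ∈ ⋀[PolyFun d]^2 (VecField d) := by simpa [hm] using hy.mem b
  have hne : Fin.castAdd s p ≠ Fin.castAdd s q := fun h => hpq (Fin.castAdd_injective _ _ h)
  have hcb : c ≠ b := by
    rw [hb', hc']
    exact fun h => hne (σ.injective h)
  have hS : ({b} : Finset (Fin (2 + s)))ᶜ = insert c (headImage σ 2)ᶜ := by
    ext k
    simp only [Finset.mem_compl, Finset.mem_singleton, Finset.mem_insert, mem_headImage, not_lt]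
    rw [hb', hc', ← σ.symm_apply_eq, ← σ.symm_apply_eq, Fin.ext_iff, Fin.ext_iff,
      Fin.val_castAdd, Fin.val_castAdd]
    have := p.2
    have := q.2
    have : (p : ℕ) ≠ q := fun h => hpq (Fin.ext h)
    omega
  have hcS : c ∉ (headImage σ 2)ᶜ := by
    simpa [mem_headImage, hc'] using Nat.le_of_lt_succ p.2
  rw [if_pos hm, taylorBracket_cons, connectionTerm, ← Finset.sum_neg_distrib]
  simp only [← covDeriv_thetaDeriv]
  simp only [covDeriv_anchorMap φ hyb, neg_mul, Finset.sum_mul,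
    smul_neg, Finset.smul_sum, Finset.sum_neg_distrib]
  congr 1
  have h1 : ∀ F : Fin d → (Fin s → Fin d) → Fin d → Fin d → Polyvector d,
      ∑ i', ∑ κ, ∑ j, ∑ i, F i' κ j i = ∑ j, ∑ κ, ∑ i, ∑ i', F i' κ j i := by
    intro F
    rw [Finset.sum_comm, Finset.sum_congr rfl fun κ _ => Finset.sum_comm, Finset.sum_comm]
    exact Finset.sum_congr rfl fun j _ => Finset.sum_congr rfl fun κ _ => Finset.sum_comm
  rw [h1]
  refine Finset.sum_congr rfl fun j _ => ?_
  rw [Finset.sum_congr rfl fun κ _ => sum_sum_eq_sum_fin_two q p hpq _,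
    sum_sum_eq_sum_comp_perm (A := Polyvector d) σ
      (fun (l : Fin 2 → Fin d) (κ : Fin s → Fin d) =>
        koszulSign a σ • signBefore (a ∘ σ) ⟨q, by omega⟩ •
        mixedPartial (l p ::ₘ Finset.univ.val.map κ) φ • (MvPolynomial.pderiv (l q) φ •
        (thetaDeriv j (thetaDeriv (l q) (y b)) * coeffDeriv j (thetaDeriv (l p) (y c))) *
        (List.ofFn fun k : Fin s => thetaDeriv (κ k) (y (σ ⟨2 + k, by omega⟩))).prod))]
  refine Finset.sum_congr rfl fun ι _ => ?_
  beta_reduce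
  rw [hS, Finset.insert_val_of_notMem hcS, Multiset.map_cons, map_val_compl_headImage, ← hb', ← hc',
    smul_mul_assoc, smul_smul (mixedPartial _ _), mul_comm (mixedPartial _ _), units_smul_smul_comm,
    units_smul_smul_comm]
  congr 1
  have := koszulSign_smul_prod_connectionTerm hy σ ι j (Fin.castAdd s q) (Fin.castAdd s p) hne
  rw [← hb', ← hc'] at this
  rw [← this, prod_ofFn_add]
  congr 3
  · rw [List.ofFn_succ, List.ofFn_succ, List.ofFn_zero, List.prod_cons, List.prod_cons,
      List.prod_nil, mul_one]
    fin_cases q <;> fin_cases p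
    · exact absurd rfl hpq
    · have e1 : σ (Fin.castAdd s 0) = b := hb'.symm
      have e2 : σ (Fin.castAdd s (Fin.succ 0)) = c := hc'.symm
      rw [e1, e2]
      simp [hcb.symm]
    · have e1 : σ (Fin.castAdd s 0) = c := hc'.symm
      have e2 : σ (Fin.castAdd s (Fin.succ 0)) = b := hb'.symm
      rw [e1, e2, thetaDeriv_thetaDeriv_mul_comm hyb]
      simp [hcb.symm]
    · exact absurd rfl hpq
  · refine congrArg (fun H => (List.ofFn H).prod) (funext fun k => ?_)
    have e : ∀ x : Fin 2, σ (Fin.natAdd 2 k) ≠ σ (Fin.castAdd s x) := by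
      intro x h
      have := congrArg Fin.val (σ.injective h)
      simp at this
      omega
    have e1 : σ (Fin.natAdd 2 k) ≠ b := by rw [hb']; exact e q
    have e2 : σ (Fin.natAdd 2 k) ≠ c := by rw [hc']; exact e p
    simp [e1, e2]
    rfl

/-- A bracket containing the part of the inner binary bracket that differentiates coefficients. -/
theorem koszulSign_smul_taylorBracket_leibnizTerm (φ : PolyFun d) {N s : ℕ} (hN : 2 + s = N)
    {m : Fin N → ℕ} {a : Fin N → ℤ} {y : Fin N → Polyvector d} (hy : HomogeneousFamily m a y)
    (σ : Equiv.Perm (Fin N)) (b c : Fin N)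
    (hb : b = σ ⟨0, by omega⟩) (hc : c = σ ⟨1, by omega⟩) :
    koszulSign a σ • taylorBracket φ (s + 1)
      (Fin.cons (leibnizTerm φ fun p => y (σ ⟨p, by omega⟩)) fun p => y (σ ⟨2 + p, by omega⟩))
      = -(if m b = 0 then connectionTerm φ a y b c else 0)
        - (if m c = 0 then connectionTerm φ a y c b else 0) := by
  subst hN
  have h1 := koszulSign_smul_taylorBracket_covDeriv φ rfl hy σ 0 1 (by decide) b c hb hc
  have h2 := koszulSign_smul_taylorBracket_covDeriv φ rfl hy σ 1 0 (by decide) c b hc hb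
  have s0 : signBefore (a ∘ σ) (⟨(0 : Fin 2), by omega⟩ : Fin (2 + s)) = 1 := by
    rw [signBefore, Finset.prod_filter]
    exact Finset.prod_eq_one fun k _ => by simp
  have s1 : signBefore (a ∘ σ) (⟨(1 : Fin 2), by omega⟩ : Fin (2 + s)) = Int.negOnePow (a b) := by
    have : Finset.univ.filter (· < (⟨(1 : Fin 2), by omega⟩ : Fin (2 + s)))
        = {⟨0, by omega⟩} := by
      ext k
      simp only [Finset.mem_filter, Finset.mem_univ, true_and, Finset.mem_singleton, Fin.ext_iff]
      change (k : ℕ) < 1 ↔ (k : ℕ) = 0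
      omega
    rw [signBefore, this, Finset.prod_singleton, hb]
    rfl
  rw [s0, one_smul] at h1
  rw [s1] at h2
  have h3 : leibnizTerm φ (fun p : Fin 2 => y (σ ⟨p, by omega⟩))
      = covDeriv (anchorMap φ (y b)) (y c)
        - covDeriv (anchorMap φ (y c)) (parity (y b)) := by
    subst hb hc
    rfl
  have h4 : parity (y b) = -(Int.negOnePow (a b) • y b) := by
    rw [parity_of_mem_exteriorPower (hy.mem b), hy.negOnePow_deg, ← Units.neg_smul,
      ← Int.negOnePow_succ]
    rfl
  have h5 : taylorBracket φ (s + 1) (Fin.cons (leibnizTerm φ fun p => y (σ ⟨p, by omega⟩))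
        fun p => y (σ ⟨2 + p, by omega⟩))
      = taylorBracket φ (s + 1) (Fin.cons (covDeriv (anchorMap φ (y b)) (y c))
        fun p => y (σ ⟨2 + p, by omega⟩))
      + Int.negOnePow (a b) • taylorBracket φ (s + 1)
        (Fin.cons (covDeriv (anchorMap φ (y c)) (y b)) fun p => y (σ ⟨2 + p, by omega⟩)) := by
    rw [h3, h4]
    rcases Int.units_eq_one_or (Int.negOnePow (a b)) with h | h
    · rw [h, one_smul, one_smul, map_neg, sub_neg_eq_add, MultilinearMap.cons_add]
    · rw [h, Units.neg_smul, one_smul, Units.neg_smul, one_smul, neg_neg, sub_eq_add_neg,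
        MultilinearMap.cons_add, ← neg_one_smul (PolyFun d) (covDeriv _ _),
        MultilinearMap.cons_smul, neg_one_smul]
  rw [h5, smul_add, h1, h2, sub_eq_add_neg]

end Connection

/-! ### Shuffles and subsets -/

section Shuffles

theorem card_headImage {N r : ℕ} (hr : r ≤ N) (σ : Equiv.Perm (Fin N)) :
    (headImage σ r).card = r := by
  obtain ⟨s, rfl⟩ := Nat.exists_eq_add_of_le hr
  rw [headImage_eq_map, Finset.card_map, Finset.card_univ, Fintype.card_fin]

theorem isShuffle_eq_of_headImage_eq {r s : ℕ} {σ τ : Equiv.Perm (Fin (r + s))}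
    (hσ : IsShuffle r σ) (hτ : IsShuffle r τ) (h : headImage σ r = headImage τ r) : σ = τ := by
  have hmono : ∀ {σ : Equiv.Perm (Fin (r + s))}, IsShuffle r σ →
      StrictMono (fun p : Fin r => σ (Fin.castAdd s p)) ∧
      StrictMono (fun p : Fin s => σ (Fin.natAdd r p)) := by
    intro σ hσ
    refine ⟨fun p q hpq => hσ _ _ hpq (Or.inl (by simp)), fun p q hpq => hσ _ _ ?_ (Or.inr ?_)⟩
    · simpa using hpq
    · simp
  have hc : ∀ σ : Equiv.Perm (Fin (r + s)), (headImage σ r).card = r :=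
    card_headImage (Nat.le_add_right r s)
  have hcc : ∀ σ : Equiv.Perm (Fin (r + s)), (headImage σ r)ᶜ.card = s := fun σ => by
    rw [Finset.card_compl, hc, Fintype.card_fin]; omega
  have h1 : ∀ {σ : Equiv.Perm (Fin (r + s))}, IsShuffle r σ →
      (fun p : Fin r => σ (Fin.castAdd s p)) = (headImage σ r).orderEmbOfFin (hc σ) :=
    fun {σ} hσ => Finset.orderEmbOfFin_unique _ (fun p => by simp [mem_headImage]) (hmono hσ).1
  have h2 : ∀ {σ : Equiv.Perm (Fin (r + s))}, IsShuffle r σ →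
      (fun p : Fin s => σ (Fin.natAdd r p)) = (headImage σ r)ᶜ.orderEmbOfFin (hcc σ) :=
    fun {σ} hσ => Finset.orderEmbOfFin_unique _ (fun p => by simp [mem_headImage]) (hmono hσ).2
  ext k : 1
  refine Fin.addCases (fun p => ?_) (fun p => ?_) k
  · have := (congrFun (h1 hσ) p).trans (Eq.trans ?_ (congrFun (h1 hτ) p).symm)
    · exact this
    · congr 2
  · have := (congrFun (h2 hσ) p).trans (Eq.trans ?_ (congrFun (h2 hτ) p).symm)
    · exact this
    · congr 3

theorem exists_isShuffle_headImage_eq {r s : ℕ} (S : Finset (Fin (r + s))) (hS : S.card = r) :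
    ∃ σ : Equiv.Perm (Fin (r + s)), IsShuffle r σ ∧ headImage σ r = S := by
  have hSc : Sᶜ.card = s := by
    rw [Finset.card_compl, hS, Fintype.card_fin]; omega
  let σ : Equiv.Perm (Fin (r + s)) := finSumFinEquiv.symm.trans (finSumEquivOfFinset hS hSc)
  have h1 : ∀ p : Fin r, σ (Fin.castAdd s p) = S.orderEmbOfFin hS p := fun p => by simp [σ]
  have h2 : ∀ p : Fin s, σ (Fin.natAdd r p) = Sᶜ.orderEmbOfFin hSc p := fun p => by simp [σ]
  refine ⟨σ, ?_, ?_⟩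
  · intro p q hpq h
    induction p using Fin.addCases with
    | left p =>
      induction q using Fin.addCases with
      | left q =>
        rw [h1, h1]
        exact (S.orderEmbOfFin hS).strictMono hpq
      | right q =>
        simp only [Fin.val_natAdd, Fin.val_castAdd] at h
        have := p.2
        omega
    | right p =>
      induction q using Fin.addCases with
      | left q =>
        simp only [Fin.lt_def, Fin.val_natAdd, Fin.val_castAdd] at hpq
        have := q.2
        omega
      | right q =>
        rw [h2, h2]
        exact (Sᶜ.orderEmbOfFin hSc).strictMono (by simpa using hpq)
  · refine (Finset.eq_of_subset_of_card_le ?_ ?_)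
    · rw [headImage_eq_map]
      intro k hk
      obtain ⟨p, -, rfl⟩ := Finset.mem_map.mp hk
      change σ (Fin.castAdd s p) ∈ S
      rw [h1]
      exact Finset.orderEmbOfFin_mem _ _ _
    · rw [hS, card_headImage (Nat.le_add_right r s)]

/-- Shuffles correspond to the subsets of arguments which are put first. -/
theorem sum_isShuffle {N r : ℕ} (hr : r ≤ N) {A : Type*} [AddCommMonoid A]
    (F : Finset (Fin N) → A) :
    ∑ σ ∈ (Finset.univ : Finset (Equiv.Perm (Fin N))).filter (IsShuffle r), F (headImage σ r)
      = ∑ S ∈ Finset.powersetCard r Finset.univ, F S := by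
  obtain ⟨s, rfl⟩ := Nat.exists_eq_add_of_le hr
  refine Finset.sum_bij (fun σ _ => headImage σ r) ?_ ?_ ?_ ?_
  · intro σ _
    rw [Finset.mem_powersetCard_univ]
    exact card_headImage hr σ
  · intro σ hσ τ hτ h
    simp only [Finset.mem_filter, Finset.mem_univ, true_and] at hσ hτ
    exact isShuffle_eq_of_headImage_eq hσ hτ h
  · intro S hS
    rw [Finset.mem_powersetCard_univ] at hS
    obtain ⟨σ, h1, h2⟩ := exists_isShuffle_headImage_eq S hS
    exact ⟨σ, by simpa using h1, h2⟩
  · intro σ _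
    rfl

theorem sum_powersetCard_one {N : ℕ} {A : Type*} [AddCommMonoid A] (f : Fin N → A) :
    ∑ S ∈ Finset.powersetCard 1 (Finset.univ : Finset (Fin N)), ∑ b ∈ S, f b = ∑ b, f b := by
  rw [Finset.powersetCard_one, Finset.sum_map]
  simp

theorem sum_powersetCard_compl {n : ℕ} {A : Type*} [AddCommMonoid A] (f : Fin (n + 1) → A) :
    ∑ S ∈ Finset.powersetCard n (Finset.univ : Finset (Fin (n + 1))), ∑ b ∈ Sᶜ, f b
      = ∑ b, f b := by
  rw [← sum_powersetCard_one]
  refine Finset.sum_nbij' compl compl ?_ ?_ (fun S _ => compl_compl S) (fun S _ => compl_compl S)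
    (fun _ _ => rfl)
  · intro S hS
    rw [Finset.mem_powersetCard_univ] at hS ⊢
    rw [Finset.card_compl, hS, Fintype.card_fin]; omega
  · intro S hS
    rw [Finset.mem_powersetCard_univ] at hS ⊢
    rw [Finset.card_compl, hS, Fintype.card_fin]; omega

theorem sum_powersetCard_two {N : ℕ} {A : Type*} [AddCommMonoid A] (f : Fin N → Fin N → A) :
    ∑ S ∈ Finset.powersetCard 2 (Finset.univ : Finset (Fin N)), ∑ b ∈ S, ∑ c ∈ S.erase b, f b c
      = ∑ b, ∑ c ∈ ({b} : Finset (Fin N))ᶜ, f b c := by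
  simp only [Finset.sum_sigma']
  refine Finset.sum_nbij' (fun x => ⟨x.2.1, x.2.2⟩) (fun x => ⟨{x.1, x.2}, x.1, x.2⟩) ?_ ?_ ?_ ?_ ?_
  · rintro ⟨S, b, c⟩ h
    simp only [Finset.mem_sigma, Finset.mem_erase] at h
    simp [h.2.2.1]
  · rintro ⟨b, c⟩ h
    simp only [Finset.mem_sigma, Finset.mem_univ, true_and, Finset.mem_compl,
      Finset.mem_singleton] at h
    simp only [Finset.mem_sigma, Finset.mem_powersetCard_univ, Finset.mem_erase]
    refine ⟨Finset.card_pair (Ne.symm h), by simp, h, by simp⟩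
  · rintro ⟨S, b, c⟩ h
    simp only [Finset.mem_sigma, Finset.mem_erase, Finset.mem_powersetCard_univ] at h
    have : ({b, c} : Finset (Fin N)) = S := by
      refine Finset.eq_of_subset_of_card_le ?_ ?_
      · intro k hk
        rcases Finset.mem_insert.mp hk with rfl | hk
        · exact h.2.1
        · rw [Finset.mem_singleton.mp hk]; exact h.2.2.2
      · rw [h.1, Finset.card_pair (Ne.symm h.2.2.1)]
    simp [this]
  · rintro ⟨b, c⟩ h
    rfl
  · rintro ⟨S, b, c⟩ h
    rfl

theorem sum_sum_powersetCard_succ {n : ℕ} {A : Type*} [AddCommMonoid A]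
    (F : Finset (Fin (n + 1)) → A) (h0 : F ∅ = 0) :
    ∑ i : Fin (n + 1), ∑ S ∈ Finset.powersetCard ((i : ℕ) + 1) Finset.univ, F S = ∑ S, F S := by
  rw [← Finset.powerset_univ, Finset.sum_powerset, Finset.card_univ, Fintype.card_fin,
    Finset.sum_range_succ', Finset.powersetCard_zero, Finset.sum_singleton, h0, add_zero,
    Finset.sum_range]

end Shuffles

/-! ### The anchor and the truncation -/

section Truncation

variable {d : ℕ}

theorem leibnizTerm_mem (φ : PolyFun d) {m : Fin 2 → ℕ} {x : Fin 2 → Polyvector d}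
    (hx : ∀ k, x k ∈ ⋀[PolyFun d]^(m k + 2) (VecField d)) :
    leibnizTerm φ x ∈ ⋀[PolyFun d]^(∑ k, (m k + 1)) (VecField d) := by
  rw [leibnizTerm_apply, Fin.sum_univ_two]
  refine sub_mem ?_ ?_
  · by_cases h : m 0 = 0
    · rw [h, show 0 + 1 + (m 1 + 1) = m 1 + 2 by omega]
      exact covDeriv_mem_exteriorPower _ (hx 1)
    · rw [anchorMap_of_mem_exteriorPower φ (k := m 0 + 2) (by omega) (hx 0), covDeriv_zero_left]
      exact zero_mem _
  · by_cases h : m 1 = 0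
    · rw [h, show m 0 + 1 + (0 + 1) = m 0 + 2 by omega, parity_of_mem_exteriorPower (hx 0)]
      refine covDeriv_mem_exteriorPower _ ?_
      rcases Int.units_eq_one_or (Int.negOnePow ((m 0 + 2 : ℕ) : ℤ)) with h | h <;>
        simpa [h] using hx 0
    · rw [anchorMap_of_mem_exteriorPower φ (k := m 1 + 2) (by omega) (hx 1), covDeriv_zero_left]
      exact zero_mem _

theorem polyBracket_mem (φ : PolyFun d) {n : ℕ} {m : Fin n → ℕ} {x : Fin n → Polyvector d}
    (hx : ∀ k, x k ∈ ⋀[PolyFun d]^(m k + 2) (VecField d)) :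
    polyBracket φ n x ∈ ⋀[PolyFun d]^(∑ k, (m k + 1)) (VecField d) := by
  refine add_mem (taylorBracket_mem φ (fun k => m k + 1) x hx) ?_
  by_cases hn : n = 2
  · subst hn
    exact leibnizTerm_mem φ hx
  · rw [correction_of_ne φ hn]
    exact zero_mem _

theorem contractD_covDeriv (φ : PolyFun d) (X : VecField d) (y : Polyvector d) :
    contractD φ (covDeriv X y) = covDeriv X (contractD φ y)
      - ∑ i, X (MvPolynomial.pderiv i φ) • thetaDeriv i y := by
  rw [contractD_eq_sum φ, contractD_eq_sum φ, map_sum, ← Finset.sum_sub_distrib]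
  refine Finset.sum_congr rfl fun i _ => ?_
  rw [covDeriv_smul, covDeriv_thetaDeriv]
  abel

theorem taylorBracket_two (φ : PolyFun d) (x : Fin 2 → Polyvector d) :
    taylorBracket φ 2 x = ∑ i, ∑ j, MvPolynomial.pderiv i (MvPolynomial.pderiv j φ) •
      (thetaDeriv i (x 0) * thetaDeriv j (x 1)) := by
  rw [taylorBracket_apply, ← (finTwoArrowEquiv (Fin d)).symm.sum_comp, Fintype.sum_prod_type]
  refine Finset.sum_congr rfl fun i _ => Finset.sum_congr rfl fun j _ => ?_
  rw [Fin.univ_val_map]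
  simp only [List.ofFn_succ, List.ofFn_zero, List.prod_cons, List.prod_nil, mul_one]
  rfl

/-- The anchor is compatible with the binary bracket. -/
theorem anchorMap_polyBracket_two (φ : PolyFun d) (x : Fin 2 → Polyvector d)
    (h0 : x 0 ∈ ⋀[PolyFun d]^2 (VecField d)) (h1 : x 1 ∈ ⋀[PolyFun d]^2 (VecField d)) :
    anchorMap φ (polyBracket φ 2 x) = ⁅anchorMap φ (x 0), anchorMap φ (x 1)⁆ := by
  have hmem : polyBracket φ 2 x ∈ ⋀[PolyFun d]^2 (VecField d) := by
    have := polyBracket_mem φ (m := fun _ => 0) (x := x) (by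
      intro k
      fin_cases k
      · exact h0
      · exact h1)
    simpa using this
  refine (ExteriorAlgebra.ι_inj (R := PolyFun d) _ _).mp ?_
  set X := anchorMap φ (x 0) with hX
  set Y := anchorMap φ (x 1) with hY
  have hX' : contractD φ (x 0) = -ExteriorAlgebra.ι (PolyFun d) X := by
    rw [hX, ι_anchorMap φ h0, neg_neg]
  have hY' : contractD φ (x 1) = -ExteriorAlgebra.ι (PolyFun d) Y := by
    rw [hY, ι_anchorMap φ h1, neg_neg]
  have hp : parity (x 0) = x 0 := by
    rw [parity_of_mem_exteriorPower h0]
    simp [Int.negOnePow_even]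
  have hcX : ∀ i, contractD φ (thetaDeriv i (x 0))
      = algebraMap (PolyFun d) (Polyvector d) (X (MvPolynomial.X i)) := by
    intro i
    rw [contractD_comm, hX', map_neg, neg_neg, contractD_ι]
  have hcY : ∀ i, contractD φ (thetaDeriv i (x 1))
      = algebraMap (PolyFun d) (Polyvector d) (Y (MvPolynomial.X i)) := by
    intro i
    rw [contractD_comm, hY', map_neg, neg_neg, contractD_ι]
  have hT : contractD φ (taylorBracket φ 2 x)
      = ∑ i, X (MvPolynomial.pderiv i φ) • thetaDeriv i (x 1)
        - ∑ i, Y (MvPolynomial.pderiv i φ) • thetaDeriv i (x 0) := by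
    have e1 : ∑ j, X (MvPolynomial.pderiv j φ) • thetaDeriv j (x 1)
        = ∑ i, ∑ j, (MvPolynomial.pderiv i (MvPolynomial.pderiv j φ) * X (MvPolynomial.X i)) •
          thetaDeriv j (x 1) := by
      rw [Finset.sum_comm]
      refine Finset.sum_congr rfl fun j _ => ?_
      rw [derivation_apply_eq_sum X, Finset.sum_smul]
      exact Finset.sum_congr rfl fun i _ => by rw [mul_comm]
    have e2 : ∑ i, Y (MvPolynomial.pderiv i φ) • thetaDeriv i (x 0)
        = ∑ i, ∑ j, (MvPolynomial.pderiv i (MvPolynomial.pderiv j φ) * Y (MvPolynomial.X j)) •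
          thetaDeriv i (x 0) := by
      refine Finset.sum_congr rfl fun i _ => ?_
      rw [derivation_apply_eq_sum Y, Finset.sum_smul]
      exact Finset.sum_congr rfl fun j _ => by rw [mul_comm, pderiv_comm]
    rw [e1, e2, taylorBracket_two, map_sum, ← Finset.sum_sub_distrib]
    refine Finset.sum_congr rfl fun i _ => ?_
    rw [map_sum, ← Finset.sum_sub_distrib]
    refine Finset.sum_congr rfl fun j _ => ?_
    have hpar : parity (thetaDeriv i (x 0)) = -thetaDeriv i (x 0) := by
      rw [parity_of_mem_exteriorPower (contractD_mem_exteriorPower _ h0)]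
      simp
    rw [map_smul, contractD_mul, hcX, hcY, hpar, neg_mul, ← Algebra.commutes, ← Algebra.smul_def,
      ← Algebra.smul_def, smul_add, smul_neg, smul_smul, smul_smul, sub_eq_add_neg]
  have hb : polyBracket φ 2 x = taylorBracket φ 2 x + (covDeriv X (x 1) - covDeriv Y (x 0)) := by
    change taylorBracket φ 2 x + leibnizTerm φ x = _
    rw [leibnizTerm_apply, hp]
  rw [ι_anchorMap φ hmem, hb, map_add, map_sub, hT, contractD_covDeriv, contractD_covDeriv, hX', hY',
    map_neg, map_neg, ← covDeriv_ι_sub_covDeriv_ι]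
  abel

/-- The projection of polyvector fields onto those of degree at least two. -/
noncomputable def truncLinear (d : ℕ) : Polyvector d →ₗ[PolyFun d] Polyvector d :=
  LinearMap.id - GradedAlgebra.proj (fun k : ℕ => ⋀[PolyFun d]^k (VecField d)) 0
    - GradedAlgebra.proj (fun k : ℕ => ⋀[PolyFun d]^k (VecField d)) 1

theorem truncLinear_of_mem {k : ℕ} {x : Polyvector d}
    (hx : x ∈ ⋀[PolyFun d]^k (VecField d)) :
    truncLinear d x = if 2 ≤ k then x else 0 := by
  have h : ∀ i, GradedAlgebra.proj (fun k : ℕ => ⋀[PolyFun d]^k (VecField d)) i x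
      = if k = i then x else 0 := by
    intro i
    rw [GradedAlgebra.proj_apply]
    split_ifs with h
    · subst h
      exact DirectSum.decompose_of_mem_same (fun k : ℕ => ⋀[PolyFun d]^k (VecField d)) hx
    · exact DirectSum.decompose_of_mem_ne (fun k : ℕ => ⋀[PolyFun d]^k (VecField d)) hx h
  simp only [truncLinear, LinearMap.sub_apply, LinearMap.id_apply, h]
  rcases k with _ | _ | k <;> simp

theorem truncLinear_mem (x : Polyvector d) : truncLinear d x ∈ truncPolyvector d := by
  induction x using polyvector_induction with
  | hadd x y hx hy => rw [map_add]; exact add_mem hx hy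
  | hmon f J =>
    rw [map_smul, truncLinear_of_mem (wedgePartial_mem_exteriorPower J)]
    refine Submodule.smul_mem _ _ ?_
    split_ifs with h
    · exact wedgePartial_mem_trunc J h
    · exact zero_mem _

end Truncation

/-! ### The higher Jacobi identities -/

section Jacobi

variable {d : ℕ}

/-- The composition of truncated brackets occurring in the Jacobi identity, for an inner bracket of
arity `r` and an outer bracket of arity `s + 1`. -/
noncomputable def jacobiSummand (φ : PolyFun d) {N r s : ℕ} (hN : r + s = N)
    (y : Fin N → Polyvector d) (σ : Equiv.Perm (Fin N)) : Polyvector d :=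
  polyBracket φ (s + 1)
    (Fin.cons (truncLinear d (polyBracket φ r fun p => y (σ ⟨p, by omega⟩)))
      fun p => y (σ ⟨r + p, by omega⟩))

/-- The correction due to the fact that the truncated differential vanishes on bivector fields. -/
noncomputable def truncationTerm (φ : PolyFun d) {N : ℕ} (m : Fin N → ℕ) (a : Fin N → ℤ)
    (y : Fin N → Polyvector d) (b : Fin N) : Polyvector d :=
  if m b = 0 then jacobiTerm φ a y {b} b else 0

/-- The connection term along the argument number `b`, if it has a nonzero anchor. -/
noncomputable def anchorTerm (φ : PolyFun d) {N : ℕ} (m : Fin N → ℕ) (a : Fin N → ℤ)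
    (y : Fin N → Polyvector d) (b c : Fin N) : Polyvector d :=
  if m b = 0 then connectionTerm φ a y b c else 0

/-- The part of the outer binary bracket of a composition of two binary brackets that involves two
derivatives of the coefficients of the arguments. -/
noncomputable def secondOrderTerm (φ : PolyFun d) (a : Fin 3 → ℤ) (y : Fin 3 → Polyvector d)
    (σ : Equiv.Perm (Fin 3)) : Polyvector d :=
  koszulSign a σ •
    (covDeriv (anchorMap φ (polyBracket φ 2 fun p : Fin 2 => y (σ ⟨p, by omega⟩))) (y (σ 2))
      - covDeriv (anchorMap φ (y (σ 2)))
        (parity (leibnizTerm φ fun p : Fin 2 => y (σ ⟨p, by omega⟩))))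

theorem truncLinear_polyBracket (φ : PolyFun d) {N : ℕ} {m : Fin N → ℕ} {a : Fin N → ℤ}
    {y : Fin N → Polyvector d} (hy : HomogeneousFamily m a y) {r : ℕ} (hr : 2 ≤ r)
    (f : Fin r → Fin N) :
    truncLinear d (polyBracket φ r fun p => y (f p)) = polyBracket φ r fun p => y (f p) := by
  rw [truncLinear_of_mem (polyBracket_mem φ fun p => hy.mem (f p)), if_pos]
  rw [Finset.sum_add_distrib]
  simp
  omega

theorem polyBracket_one (φ : PolyFun d) (x : Fin 1 → Polyvector d) :
    polyBracket φ 1 x = contractD φ (x 0) := by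
  rw [← taylorBracket_one]
  change taylorBracket φ 1 x + 0 = _
  rw [add_zero]

theorem truncLinear_polyBracket_one (φ : PolyFun d) {k : ℕ} {x : Fin 1 → Polyvector d}
    (hx : x 0 ∈ ⋀[PolyFun d]^(k + 2) (VecField d)) :
    truncLinear d (polyBracket φ 1 x) = if k = 0 then 0 else taylorBracket φ 1 x := by
  rw [polyBracket_one, taylorBracket_one,
    truncLinear_of_mem (contractD_mem_exteriorPower φ (k := k + 1) hx)]
  rcases k with _ | k <;> simp

/-- The `O`-multilinear part of the outer bracket: the terms with two odd derivatives of one argument,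
except for those lost by truncating the differential, and the terms from the correction of the inner
binary bracket. -/
theorem koszulSign_smul_taylorBracket_truncLinear (φ : PolyFun d) {N r s : ℕ} (hN : r + s = N)
    (hr : 1 ≤ r) {m : Fin N → ℕ} {a : Fin N → ℤ} {y : Fin N → Polyvector d}
    (hy : HomogeneousFamily m a y) (σ : Equiv.Perm (Fin N)) :
    koszulSign a σ • taylorBracket φ (s + 1)
      (Fin.cons (truncLinear d (polyBracket φ r fun p => y (σ ⟨p, by omega⟩)))
        fun p => y (σ ⟨r + p, by omega⟩))
      = ∑ k ∈ headImage σ r, jacobiTerm φ a y (headImage σ r) k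
        - (if r = 1 then ∑ b ∈ headImage σ r, truncationTerm φ m a y b else 0)
        - (if r = 2 then ∑ b ∈ headImage σ r, ∑ c ∈ (headImage σ r).erase b,
          anchorTerm φ m a y b c else 0) := by
  have key := koszulSign_smul_taylorBracket_taylorBracket φ hN hy σ
  obtain rfl | rfl | hr3 : r = 1 ∨ r = 2 ∨ 3 ≤ r := by omega
  · rw [if_pos rfl, if_neg (by omega), sub_zero]
    have hS : headImage σ 1 = {σ ⟨0, by omega⟩} := by
      subst hN
      rw [headImage_eq_map, Finset.univ_unique, Finset.map_singleton]
      rfl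
    rw [truncLinear_polyBracket_one φ (k := m (σ ⟨0, by omega⟩)) (hy.mem _)]
    split_ifs with h
    · have : taylorBracket φ (s + 1)
          (Fin.cons 0 fun p => y (σ ⟨1 + p, by omega⟩)) = 0 :=
        (taylorBracket φ (s + 1)).map_coord_zero 0 rfl
      rw [this, hS, Finset.sum_singleton, Finset.sum_singleton, truncationTerm, if_pos h, smul_zero,
        sub_self]
    · rw [key, hS, Finset.sum_singleton, Finset.sum_singleton, truncationTerm, if_neg h, sub_zero]
  · rw [if_neg (by omega), if_pos rfl, sub_zero]
    have hne : σ ⟨0, by omega⟩ ≠ σ ⟨1, by omega⟩ := fun h => by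
      have := congrArg Fin.val (σ.injective h)
      simp at this
    have hS : headImage σ 2 = {σ ⟨0, by omega⟩, σ ⟨1, by omega⟩} := by
      ext k
      simp only [mem_headImage, Finset.mem_insert, Finset.mem_singleton]
      rw [← σ.symm_apply_eq, ← σ.symm_apply_eq, Fin.ext_iff, Fin.ext_iff]
      change _ ↔ (σ.symm k : ℕ) = 0 ∨ (σ.symm k : ℕ) = 1
      omega
    rw [truncLinear_polyBracket φ hy le_rfl]
    change koszulSign a σ • taylorBracket φ (s + 1) (Fin.cons (taylorBracket φ 2 _
      + leibnizTerm φ _) _) = _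
    rw [MultilinearMap.cons_add, smul_add, key,
      koszulSign_smul_taylorBracket_leibnizTerm φ hN hy σ _ _ rfl rfl]
    have h2 : ∑ b ∈ headImage σ 2, ∑ c ∈ (headImage σ 2).erase b, anchorTerm φ m a y b c
        = anchorTerm φ m a y (σ ⟨0, by omega⟩) (σ ⟨1, by omega⟩)
          + anchorTerm φ m a y (σ ⟨1, by omega⟩) (σ ⟨0, by omega⟩) := by
      rw [hS, Finset.sum_pair hne, Finset.erase_insert (by rwa [Finset.mem_singleton]), Finset.sum_singleton]
      congr 1
      have : ({σ ⟨0, by omega⟩, σ ⟨1, by omega⟩} : Finset (Fin N)).erase (σ ⟨1, by omega⟩)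
          = {σ ⟨0, by omega⟩} := by
        rw [Finset.pair_comm, Finset.erase_insert (by rw [Finset.mem_singleton]; exact hne.symm)]
      rw [this, Finset.sum_singleton]
    rw [h2]
    simp only [anchorTerm]
    abel
  · rw [if_neg (by omega), if_neg (by omega), sub_zero, sub_zero,
      truncLinear_polyBracket φ hy (by omega), ← key]
    change koszulSign a σ • taylorBracket φ (s + 1) (Fin.cons (taylorBracket φ r _
      + correction φ r _) _) = _
    rw [correction_of_ne φ (by omega), add_zero]

/-- The part of the outer bracket that differentiates coefficients: the covariant derivative of the
inner bracket along the last argument, and for a binary inner bracket also second order terms. The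
nondegeneracy hypothesis excludes a pair of bivector fields, for which the truncated inner
differential is zero. -/
theorem koszulSign_smul_leibnizTerm_truncLinear (φ : PolyFun d) {N r : ℕ} (hN : r + 1 = N)
    (hr : 1 ≤ r) {m : Fin N → ℕ} {a : Fin N → ℤ} {y : Fin N → Polyvector d}
    (hy : HomogeneousFamily m a y) (hm : r = 1 → ∃ k, m k ≠ 0) (σ : Equiv.Perm (Fin N)) :
    koszulSign a σ • leibnizTerm φ
      (Fin.cons (truncLinear d (polyBracket φ r fun p => y (σ ⟨p, by omega⟩)))
        fun p => y (σ ⟨r + p, by omega⟩))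
      = ∑ b ∈ (headImage σ r)ᶜ, (truncationTerm φ m a y b
          + ∑ c ∈ ({b} : Finset (Fin N))ᶜ, anchorTerm φ m a y b c)
        + if h : N = 3 then secondOrderTerm φ (fun k => a (Fin.cast h.symm k))
          (fun k => y (Fin.cast h.symm k)) ((finCongr h).permCongr σ) else 0 := by
  have key := koszulSign_smul_covDeriv_taylorBracket φ hN hy σ (σ ⟨r, by omega⟩) rfl
  have hS : (headImage σ r)ᶜ = {σ ⟨r, by omega⟩} := by
    subst hN
    rw [compl_headImage_eq_map, Finset.univ_unique, Finset.map_singleton]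
    rfl
  set b : Fin N := σ ⟨r, by omega⟩ with hb
  have hbt : truncationTerm φ m a y b + ∑ c ∈ ({b} : Finset (Fin N))ᶜ, anchorTerm φ m a y b c
      = if m b = 0 then jacobiTerm φ a y {b} b + ∑ c ∈ ({b} : Finset (Fin N))ᶜ,
          connectionTerm φ a y b c else 0 := by
    simp only [truncationTerm, anchorTerm]
    split_ifs <;> simp
  rw [hS, Finset.sum_singleton, hbt]
  have hL : ∀ u : Polyvector d, leibnizTerm φ (Fin.cons u fun p : Fin 1 => y (σ ⟨r + p, by omega⟩))
      = covDeriv (anchorMap φ u) (y b) - covDeriv (anchorMap φ (y b)) (parity u) := fun u => rfl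
  rw [hL]
  obtain rfl | rfl | hr3 : r = 1 ∨ r = 2 ∨ 3 ≤ r := by omega
  · rw [dif_neg (by omega), add_zero]
    have ht := truncLinear_polyBracket_one φ (x := fun p => y (σ ⟨p, by omega⟩))
      (k := m (σ ⟨0, by omega⟩)) (hy.mem _)
    have h0 : anchorMap φ (truncLinear d (polyBracket φ 1 fun p => y (σ ⟨p, by omega⟩))) = 0 := by
      rw [ht]
      split_ifs
      · exact map_zero _
      · rw [taylorBracket_one, anchorMap_apply, contractD_contractD, map_zero, neg_zero]
    rw [h0, covDeriv_zero_left, zero_sub, smul_neg]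
    by_cases hmb : m b = 0
    · have hne : m (σ ⟨0, by omega⟩) ≠ 0 := by
        intro h
        obtain ⟨k, hk⟩ := hm rfl
        have : σ.symm k = ⟨0, by omega⟩ ∨ σ.symm k = ⟨1, by omega⟩ := by
          rw [Fin.ext_iff, Fin.ext_iff]
          change (σ.symm k : ℕ) = 0 ∨ (σ.symm k : ℕ) = 1
          omega
        rw [σ.symm_apply_eq, σ.symm_apply_eq] at this
        rcases this with rfl | rfl
        · exact hk h
        · exact hk hmb
      rw [ht, if_neg hne, key, neg_neg]
    · rw [anchorMap_of_mem_exteriorPower φ (k := m b + 2) (by omega) (hy.mem b),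
        covDeriv_zero_left, if_neg hmb, smul_zero, neg_zero]
  · subst hN
    rw [dif_pos rfl, truncLinear_polyBracket φ hy le_rfl]
    have e : polyBracket φ 2 (fun p => y (σ ⟨p, by omega⟩))
      = taylorBracket φ 2 (fun p => y (σ ⟨p, by omega⟩))
        + leibnizTerm φ (fun p => y (σ ⟨p, by omega⟩)) := rfl
    have hX : secondOrderTerm φ (fun k => a (Fin.cast rfl k)) (fun k => y (Fin.cast rfl k))
        ((finCongr rfl).permCongr σ)
        = koszulSign a σ •
          (covDeriv (anchorMap φ (polyBracket φ 2 fun p => y (σ ⟨p, by omega⟩))) (y b)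
            - covDeriv (anchorMap φ (y b))
              (parity (leibnizTerm φ fun p => y (σ ⟨p, by omega⟩)))) := rfl
    rw [hX, smul_sub, smul_sub]
    have e2 : covDeriv (anchorMap φ (y b)) (parity (polyBracket φ 2 fun p => y (σ ⟨p, by omega⟩)))
        = covDeriv (anchorMap φ (y b)) (parity (taylorBracket φ 2 fun p => y (σ ⟨p, by omega⟩)))
        + covDeriv (anchorMap φ (y b)) (parity (leibnizTerm φ fun p => y (σ ⟨p, by omega⟩))) := by
      rw [e, map_add, map_add]
    rw [e2, smul_add, key]
    abel
  · rw [dif_neg (by omega), add_zero, truncLinear_polyBracket φ hy (by omega)]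
    have h0 : anchorMap φ (polyBracket φ r fun p => y (σ ⟨p, by omega⟩)) = 0 := by
      refine anchorMap_of_mem_exteriorPower φ ?_ (polyBracket_mem φ fun p => hy.mem _)
      rw [Finset.sum_add_distrib]
      simp
      omega
    have e : polyBracket φ r (fun p => y (σ ⟨p, by omega⟩))
        = taylorBracket φ r (fun p => y (σ ⟨p, by omega⟩)) := by
      change taylorBracket φ r _ + correction φ r _ = _
      rw [correction_of_ne φ (by omega), add_zero]
    rw [h0, covDeriv_zero_left, zero_sub, e, smul_neg, key, neg_neg]

/-- The second order terms cancel, as the connection is flat and the anchor is a morphism. -/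
theorem sum_secondOrderTerm (φ : PolyFun d) {m : Fin 3 → ℕ} {a : Fin 3 → ℤ}
    {y : Fin 3 → Polyvector d} (hy : HomogeneousFamily m a y) :
    ∑ σ ∈ (Finset.univ : Finset (Equiv.Perm (Fin 3))).filter (IsShuffle 2),
      secondOrderTerm φ a y σ = 0 := by
  have hset : (Finset.univ : Finset (Equiv.Perm (Fin 3))).filter (IsShuffle 2)
      = {1, Equiv.swap 1 2, Equiv.swap 0 1 * Equiv.swap 1 2} := by decide
  have k2 : koszulSign a (Equiv.swap 1 2) = Int.negOnePow (a 1 * a 2) :=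
    koszulSign_adjacent_swap a (1 : Fin 2)
  have k3 : koszulSign a (Equiv.swap 0 1 * Equiv.swap 1 2)
      = Int.negOnePow (a 0 * a 1) * Int.negOnePow (a 0 * a 2) := by
    rw [koszulSign_mul]
    congr 1
    · exact koszulSign_adjacent_swap a (0 : Fin 2)
    · exact koszulSign_adjacent_swap (a ∘ Equiv.swap 0 1) (1 : Fin 2)
  have hanch : ∀ k, m k ≠ 0 → anchorMap φ (y k) = 0 := fun k hk =>
    anchorMap_of_mem_exteriorPower φ (k := m k + 2) (by omega) (hy.mem k)
  have hl0 : ∀ X : VecField d, ⁅X, (0 : VecField d)⁆ = 0 := fun X => by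
    ext1; simp [Derivation.commutator_apply]
  have h0l : ∀ X : VecField d, ⁅(0 : VecField d), X⁆ = 0 := fun X => by
    ext1; simp [Derivation.commutator_apply]
  have hlie : ∀ f : Fin 2 → Fin 3, anchorMap φ (polyBracket φ 2 fun p => y (f p))
      = ⁅anchorMap φ (y (f 0)), anchorMap φ (y (f 1))⁆ := by
    intro f
    by_cases h0 : m (f 0) = 0
    · by_cases h1 : m (f 1) = 0
      · exact anchorMap_polyBracket_two φ _ (by simpa [h0] using hy.mem (f 0))
          (by simpa [h1] using hy.mem (f 1))
      · rw [hanch _ h1, hl0]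
        refine anchorMap_of_mem_exteriorPower φ ?_ (polyBracket_mem φ fun p => hy.mem (f p))
        rw [Fin.sum_univ_two]
        omega
    · rw [hanch _ h0, h0l]
      refine anchorMap_of_mem_exteriorPower φ ?_ (polyBracket_mem φ fun p => hy.mem (f p))
      rw [Fin.sum_univ_two]
      omega
  have hpar : ∀ k, parity (y k) = -(Int.negOnePow (a k) • y k) := fun k => by
    rw [parity_of_mem_exteriorPower (hy.mem k), hy.negOnePow_deg, ← Units.neg_smul,
      ← Int.negOnePow_succ]
    rfl
  have hpp : ∀ x : Polyvector d, parity (parity x) = x := CliffordAlgebra.involute_involute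
  have hterm : ∀ (σ : Equiv.Perm (Fin 3)) (b c e : Fin 3), σ 0 = b → σ 1 = c → σ 2 = e →
      secondOrderTerm φ a y σ = koszulSign a σ •
        (covDeriv (anchorMap φ (y b)) (covDeriv (anchorMap φ (y c)) (y e))
          - covDeriv (anchorMap φ (y c)) (covDeriv (anchorMap φ (y b)) (y e))
          + Int.negOnePow (a c) •
            covDeriv (anchorMap φ (y e)) (covDeriv (anchorMap φ (y b)) (y c))
          + covDeriv (anchorMap φ (y e)) (covDeriv (anchorMap φ (y c)) (y b))) := by
    rintro σ b c e rfl rfl rfl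
    have h1 := hlie fun p : Fin 2 => σ ⟨p, by omega⟩
    have h2 : leibnizTerm φ (fun p : Fin 2 => y (σ ⟨p, by omega⟩))
        = covDeriv (anchorMap φ (y (σ 0))) (y (σ 1))
          - covDeriv (anchorMap φ (y (σ 1))) (parity (y (σ 0))) := rfl
    rw [secondOrderTerm, h1, h2, map_sub, ← covDeriv_parity, ← covDeriv_parity, hpp, map_sub]
    congr 1
    have h3 : covDeriv ⁅anchorMap φ (y (σ 0)), anchorMap φ (y (σ 1))⁆ (y (σ 2))
        = covDeriv (anchorMap φ (y (σ 0))) (covDeriv (anchorMap φ (y (σ 1))) (y (σ 2)))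
          - covDeriv (anchorMap φ (y (σ 1))) (covDeriv (anchorMap φ (y (σ 0))) (y (σ 2))) :=
      covDeriv_lie _ _ _
    have h4 : covDeriv (anchorMap φ (y (σ 2)))
        (covDeriv (anchorMap φ (y (σ 0))) (parity (y (σ 1))))
        = -(Int.negOnePow (a (σ 1)) • covDeriv (anchorMap φ (y (σ 2)))
          (covDeriv (anchorMap φ (y (σ 0))) (y (σ 1)))) := by
      rw [hpar]
      rcases Int.units_eq_one_or (Int.negOnePow (a (σ 1))) with h | h <;> simp [h]
    rw [h4]
    refine (congrArg (· - _) h3).trans ?_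
    abel
  rw [hset, Finset.sum_insert (by decide), Finset.sum_insert (by decide), Finset.sum_singleton,
    hterm 1 0 1 2 rfl rfl rfl, hterm (Equiv.swap 1 2) 0 2 1 (by decide) (by decide) (by decide),
    hterm (Equiv.swap 0 1 * Equiv.swap 1 2) 1 2 0 (by decide) (by decide) (by decide),
    koszulSign_one, k2, k3]
  have hodd : ∀ k, a k = -1 ∨ anchorMap φ (y k) = 0 := fun k => by
    by_cases hk : m k = 0
    · left
      rw [hy.deg, hk]
      rfl
    · exact Or.inr (hanch k hk)
  -- an argument with a nonzero anchor is odd, which reduces all signs to those of single arguments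
  have hneg : ∀ k x, Int.negOnePow (a k) • covDeriv (anchorMap φ (y k)) x
      = -covDeriv (anchorMap φ (y k)) x := fun k x => by
    rcases hodd k with h | h
    · rw [h, Int.negOnePow_neg, Int.negOnePow_one, Units.neg_smul, one_smul]
    · rw [h, covDeriv_zero_left, smul_zero, neg_zero]
  have hmul : ∀ i k x, Int.negOnePow (a i * a k) • covDeriv (anchorMap φ (y k)) x
      = Int.negOnePow (a i) • covDeriv (anchorMap φ (y k)) x := fun i k x => by
    rcases hodd k with h | h
    · rw [h, mul_neg_one, Int.negOnePow_neg]
    · rw [h, covDeriv_zero_left, smul_zero, smul_zero]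
  have hu : ∀ (u : ℤˣ) (X : VecField d) (x : Polyvector d), covDeriv X (u • x) = u • covDeriv X x := fun u X x => by
    rcases Int.units_eq_one_or u with h | h <;> simp [h]
  have hneg' : ∀ j k x, Int.negOnePow (a k) •
      covDeriv (anchorMap φ (y j)) (covDeriv (anchorMap φ (y k)) x)
      = -covDeriv (anchorMap φ (y j)) (covDeriv (anchorMap φ (y k)) x) := fun j k x => by
    rw [← hu, hneg, map_neg]
  have hmul' : ∀ i j k x, Int.negOnePow (a i * a k) •
      covDeriv (anchorMap φ (y j)) (covDeriv (anchorMap φ (y k)) x)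
      = Int.negOnePow (a i) •
        covDeriv (anchorMap φ (y j)) (covDeriv (anchorMap φ (y k)) x) := fun i j k x => by
    rw [← hu, hmul, hu]
  have hsq : ∀ (u : ℤˣ) (x : Polyvector d), u • u • x = x := fun u x => by
    rw [smul_smul, Int.units_mul_self_eq_one, one_smul]
  have t3 : Int.negOnePow (a 1 * a 2) • Int.negOnePow (a 2) •
      covDeriv (anchorMap φ (y 1)) (covDeriv (anchorMap φ (y 0)) (y 2))
      = covDeriv (anchorMap φ (y 1)) (covDeriv (anchorMap φ (y 0)) (y 2)) := by
    rw [smul_comm, mul_comm (a 1), hmul 2 1, hsq]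
  have t5 : Int.negOnePow (a 0 * a 1) • Int.negOnePow (a 0 * a 2) •
      covDeriv (anchorMap φ (y 1)) (covDeriv (anchorMap φ (y 2)) (y 0))
      = covDeriv (anchorMap φ (y 1)) (covDeriv (anchorMap φ (y 2)) (y 0)) := by
    rw [hmul' 0 1 2, smul_comm, hmul 0 1, hsq]
  have t6 : Int.negOnePow (a 0 * a 1) • Int.negOnePow (a 0 * a 2) •
      covDeriv (anchorMap φ (y 2)) (covDeriv (anchorMap φ (y 1)) (y 0))
      = covDeriv (anchorMap φ (y 2)) (covDeriv (anchorMap φ (y 1)) (y 0)) := by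
    rw [hmul 0 2, smul_comm, hmul' 0 2 1, hsq]
  have t7 : Int.negOnePow (a 0 * a 1) • Int.negOnePow (a 0 * a 2) • Int.negOnePow (a 2) •
      covDeriv (anchorMap φ (y 0)) (covDeriv (anchorMap φ (y 1)) (y 2))
      = -covDeriv (anchorMap φ (y 0)) (covDeriv (anchorMap φ (y 1)) (y 2)) := by
    rw [smul_comm (Int.negOnePow (a 0 * a 2)), mul_comm (a 0) (a 2), hmul 2 0, hsq, hmul' 0 0 1,
      hneg]
  have t8 : Int.negOnePow (a 0 * a 1) • Int.negOnePow (a 0 * a 2) •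
      covDeriv (anchorMap φ (y 0)) (covDeriv (anchorMap φ (y 2)) (y 1))
      = -(Int.negOnePow (a 1) •
        covDeriv (anchorMap φ (y 0)) (covDeriv (anchorMap φ (y 2)) (y 1))) := by
    rw [hmul' 0 0 2, hneg, smul_neg, mul_comm (a 0), hmul 1 0]
  simp only [smul_add, smul_sub, one_smul, mul_smul]
  rw [t3, t5, t6, t7, t8, hmul' 1 0 2, hmul 1 2, hmul' 1 1 2, hneg]
  abel

theorem koszulSign_smul_jacobiSummand (φ : PolyFun d) {N r s : ℕ} (hN : r + s = N) (hr : 1 ≤ r)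
    {m : Fin N → ℕ} {a : Fin N → ℤ} {y : Fin N → Polyvector d} (hy : HomogeneousFamily m a y)
    (hm : s = 1 → r = 1 → ∃ k, m k ≠ 0) (σ : Equiv.Perm (Fin N)) :
    koszulSign a σ • jacobiSummand φ hN y σ
      = (∑ k ∈ headImage σ r, jacobiTerm φ a y (headImage σ r) k
        - (if r = 1 then ∑ b ∈ headImage σ r, truncationTerm φ m a y b else 0)
        - (if r = 2 then ∑ b ∈ headImage σ r, ∑ c ∈ (headImage σ r).erase b,
          anchorTerm φ m a y b c else 0)
        + (if s = 1 then ∑ b ∈ (headImage σ r)ᶜ, (truncationTerm φ m a y b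
          + ∑ c ∈ ({b} : Finset (Fin N))ᶜ, anchorTerm φ m a y b c) else 0))
        + (if s = 1 then if h : N = 3 then secondOrderTerm φ (fun k => a (Fin.cast h.symm k))
          (fun k => y (Fin.cast h.symm k)) ((finCongr h).permCongr σ) else 0 else 0) := by
  have h1 := koszulSign_smul_taylorBracket_truncLinear φ hN hr hy σ
  change koszulSign a σ • (taylorBracket φ (s + 1) _ + correction φ (s + 1) _) = _
  rw [smul_add, h1]
  by_cases hs : s = 1
  · subst hs
    rw [if_pos rfl, if_pos rfl, add_assoc _ _ (dite _ _ _)]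
    congr 1
    exact koszulSign_smul_leibnizTerm_truncLinear φ hN hr hy (hm rfl) σ
  · rw [if_neg hs, if_neg hs, correction_of_ne φ (by omega), smul_zero, add_zero, add_zero]

/-- The higher Jacobi identity for homogeneous arguments: summed over all subsets of the arguments,
the multilinear terms cancel by symmetry of the higher derivatives of `φ`, the connection terms and
the truncation terms of the inner and of the outer bracket cancel each other, and the second order
terms for three arguments cancel by flatness. -/
theorem sum_jacobiSummand (φ : PolyFun d) {n : ℕ} {m : Fin (n + 1) → ℕ} {a : Fin (n + 1) → ℤ}
    {y : Fin (n + 1) → Polyvector d} (hy : HomogeneousFamily m a y)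
    (hm : n ≤ 1 → ∃ k, m k ≠ 0) :
    ∑ i : Fin (n + 1),
      ∑ σ ∈ (Finset.univ : Finset (Equiv.Perm (Fin (n + 1)))).filter (IsShuffle ((i : ℕ) + 1)),
        koszulSign a σ • jacobiSummand φ (r := (i : ℕ) + 1) (s := n - i) (by omega) y σ = 0 := by
  have h1 : ∀ i : Fin (n + 1),
      ∑ σ ∈ (Finset.univ : Finset (Equiv.Perm (Fin (n + 1)))).filter (IsShuffle ((i : ℕ) + 1)),
        koszulSign a σ • jacobiSummand φ (r := (i : ℕ) + 1) (s := n - i) (by omega) y σ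
      = (∑ S ∈ Finset.powersetCard ((i : ℕ) + 1) Finset.univ, ∑ k ∈ S, jacobiTerm φ a y S k
        - (if (i : ℕ) + 1 = 1 then ∑ S ∈ Finset.powersetCard ((i : ℕ) + 1) Finset.univ,
            ∑ b ∈ S, truncationTerm φ m a y b else 0)
        - (if (i : ℕ) + 1 = 2 then ∑ S ∈ Finset.powersetCard ((i : ℕ) + 1) Finset.univ,
            ∑ b ∈ S, ∑ c ∈ S.erase b, anchorTerm φ m a y b c else 0)
        + (if n - (i : ℕ) = 1 then ∑ S ∈ Finset.powersetCard ((i : ℕ) + 1) Finset.univ,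
            ∑ b ∈ Sᶜ, (truncationTerm φ m a y b
              + ∑ c ∈ ({b} : Finset (Fin (n + 1)))ᶜ, anchorTerm φ m a y b c) else 0))
        + (if n - (i : ℕ) = 1 then
            ∑ σ ∈ (Finset.univ : Finset (Equiv.Perm (Fin (n + 1)))).filter
              (IsShuffle ((i : ℕ) + 1)),
            if h : n + 1 = 3 then secondOrderTerm φ (fun k => a (Fin.cast h.symm k))
              (fun k => y (Fin.cast h.symm k)) ((finCongr h).permCongr σ) else 0 else 0) := by
    intro i
    rw [Finset.sum_congr rfl fun σ _ => koszulSign_smul_jacobiSummand φ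
      (r := (i : ℕ) + 1) (s := n - i) (by omega) (by omega) hy (fun _ _ => hm (by omega)) σ,
      Finset.sum_add_distrib]
    congr 1
    · rw [sum_isShuffle (r := (i : ℕ) + 1) (by omega) fun S : Finset (Fin (n + 1)) =>
        ∑ k ∈ S, jacobiTerm φ a y S k
        - (if (i : ℕ) + 1 = 1 then ∑ b ∈ S, truncationTerm φ m a y b else 0)
        - (if (i : ℕ) + 1 = 2 then ∑ b ∈ S, ∑ c ∈ S.erase b, anchorTerm φ m a y b c else 0)
        + (if n - (i : ℕ) = 1 then ∑ b ∈ Sᶜ, (truncationTerm φ m a y b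
          + ∑ c ∈ ({b} : Finset (Fin (n + 1)))ᶜ, anchorTerm φ m a y b c) else 0),
        Finset.sum_add_distrib, Finset.sum_sub_distrib, Finset.sum_sub_distrib]
      congr 1
      · congr 1
        · congr 1
          split_ifs
          · rfl
          · exact Finset.sum_const_zero
        · split_ifs
          · rfl
          · exact Finset.sum_const_zero
      · split_ifs
        · rfl
        · exact Finset.sum_const_zero
    · by_cases hi : n - (i : ℕ) = 1
      · simp only [if_pos hi]
      · simp only [if_neg hi, Finset.sum_const_zero]
  rw [Finset.sum_congr rfl fun i _ => h1 i, Finset.sum_add_distrib, Finset.sum_add_distrib,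
    Finset.sum_sub_distrib, Finset.sum_sub_distrib,
    sum_sum_powersetCard_succ (fun S : Finset (Fin (n + 1)) => ∑ k ∈ S, jacobiTerm φ a y S k)
      Finset.sum_empty, sum_jacobiTerm]
  have t1 : ∑ i : Fin (n + 1), (if (i : ℕ) + 1 = 1 then
      ∑ S ∈ Finset.powersetCard ((i : ℕ) + 1) Finset.univ, ∑ b ∈ S, truncationTerm φ m a y b else 0)
      = ∑ b, truncationTerm φ m a y b := by
    rw [Finset.sum_eq_single ⟨0, by omega⟩, if_pos rfl]
    · exact sum_powersetCard_one _
    · intro i _ hi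
      rw [if_neg]
      intro h
      exact hi (Fin.ext (by change (i : ℕ) = 0; omega))
    · simp
  rw [t1]
  rcases n with _ | n
  · obtain ⟨k, hk⟩ := hm (by omega)
    have hk0 : k = 0 := Fin.ext (by omega)
    subst hk0
    simp [truncationTerm, hk]
  have t2 : ∑ i : Fin (n + 1 + 1), (if (i : ℕ) + 1 = 2 then
      ∑ S ∈ Finset.powersetCard ((i : ℕ) + 1) Finset.univ,
        ∑ b ∈ S, ∑ c ∈ S.erase b, anchorTerm φ m a y b c else 0)
      = ∑ b, ∑ c ∈ ({b} : Finset (Fin (n + 1 + 1)))ᶜ, anchorTerm φ m a y b c := by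
    rw [Finset.sum_eq_single ⟨1, by omega⟩, if_pos rfl]
    · exact sum_powersetCard_two _
    · intro i _ hi
      rw [if_neg]
      intro h
      exact hi (Fin.ext (by change (i : ℕ) = 1; omega))
    · simp
  have t3 : ∑ i : Fin (n + 1 + 1), (if n + 1 - (i : ℕ) = 1 then
      ∑ S ∈ Finset.powersetCard ((i : ℕ) + 1) Finset.univ,
        ∑ b ∈ Sᶜ, (truncationTerm φ m a y b
          + ∑ c ∈ ({b} : Finset (Fin (n + 1 + 1)))ᶜ, anchorTerm φ m a y b c) else 0)
      = ∑ b, (truncationTerm φ m a y b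
          + ∑ c ∈ ({b} : Finset (Fin (n + 1 + 1)))ᶜ, anchorTerm φ m a y b c) := by
    rw [Finset.sum_eq_single ⟨n, by omega⟩, if_pos (by simp)]
    · exact sum_powersetCard_compl _
    · intro i _ hi
      rw [if_neg]
      intro h
      exact hi (Fin.ext (by change (i : ℕ) = n; omega))
    · simp
  rw [t2, t3, Finset.sum_add_distrib]
  have t4 : ∑ i : Fin (n + 1 + 1), (if n + 1 - (i : ℕ) = 1 then
      ∑ σ ∈ (Finset.univ : Finset (Equiv.Perm (Fin (n + 1 + 1)))).filter
        (IsShuffle ((i : ℕ) + 1)),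
      if h : n + 1 + 1 = 3 then secondOrderTerm φ (fun k => a (Fin.cast h.symm k))
        (fun k => y (Fin.cast h.symm k)) ((finCongr h).permCongr σ) else 0 else 0) = 0 := by
    by_cases h : n = 1
    · subst h
      rw [Fin.sum_univ_three, if_neg (by simp), if_pos (by simp), if_neg (by simp), zero_add,
        add_zero]
      exact sum_secondOrderTerm φ hy
    · refine Finset.sum_eq_zero fun i _ => ?_
      rw [Finset.sum_eq_zero fun σ _ => dif_neg (by omega), ite_self]
  rw [t4]
  abel

end Jacobi

/-! ### Graded symmetry of the brackets -/

section Symmetry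

variable {d : ℕ}

theorem taylorBracket_comp_perm (φ : PolyFun d) {n : ℕ} {m : Fin n → ℕ} {a : Fin n → ℤ}
    {y : Fin n → Polyvector d} (hy : HomogeneousFamily m a y) (σ : Equiv.Perm (Fin n)) :
    taylorBracket φ n (fun k => y (σ k)) = koszulSign a σ • taylorBracket φ n y := by
  rw [taylorBracket_apply, taylorBracket_apply, Finset.smul_sum,
    ← (Equiv.arrowCongr σ.symm (Equiv.refl (Fin d))).sum_comp]
  refine Finset.sum_congr rfl fun ι _ => ?_
  have h1 : (Finset.univ : Finset (Fin n)).val.map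
      (Equiv.arrowCongr σ.symm (Equiv.refl (Fin d)) ι) = Finset.univ.val.map ι := by
    change Finset.univ.val.map (fun k => ι (σ k)) = _
    rw [← Function.comp_def, ← Multiset.map_map]
    congr 1
    exact congrArg Finset.val (Finset.map_univ_equiv σ)
  have h2 : ∀ k, HasParity (a k) (thetaDeriv (ι k) (y k)) := fun k =>
    (hasParity_of_mem_exteriorPower (contractD_mem_exteriorPower _ (hy.mem k))).congr
      ⟨m k + 1, by rw [hy.deg]; push_cast; ring⟩
  rw [h1, smul_comm (koszulSign a σ)]
  congr 1
  rw [← koszulSign_smul_prod_ofFn σ a (fun k => thetaDeriv (ι k) (y k))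
    fun k l _ => mul_comm_of_hasParity a _ h2 k l, smul_smul, Int.units_mul_self_eq_one, one_smul]
  rfl

theorem leibnizTerm_comp_perm (φ : PolyFun d) {m : Fin 2 → ℕ} {a : Fin 2 → ℤ}
    {y : Fin 2 → Polyvector d} (hy : HomogeneousFamily m a y) (σ : Equiv.Perm (Fin 2)) :
    leibnizTerm φ (fun k => y (σ k)) = koszulSign a σ • leibnizTerm φ y := by
  have hσ : σ = 1 ∨ σ = Equiv.swap 0 1 := by
    revert σ
    decide
  rcases hσ with rfl | rfl
  · rw [koszulSign_one, one_smul]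
    rfl
  have hsign : koszulSign a (Equiv.swap 0 1) = Int.negOnePow (a 0 * a 1) :=
    koszulSign_adjacent_swap a (0 : Fin 1)
  have hpar : ∀ k, parity (y k) = -(Int.negOnePow (a k) • y k) := fun k => by
    rw [parity_of_mem_exteriorPower (hy.mem k), hy.negOnePow_deg, ← Units.neg_smul,
      ← Int.negOnePow_succ]
    rfl
  have hu : ∀ (u : ℤˣ) (X : VecField d) (x : Polyvector d),
      covDeriv X (u • x) = u • covDeriv X x := fun u X x => by
    rcases Int.units_eq_one_or u with h | h <;> simp [h]
  have hmul : ∀ i k x, Int.negOnePow (a i * a k) • covDeriv (anchorMap φ (y k)) x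
      = Int.negOnePow (a i) • covDeriv (anchorMap φ (y k)) x := fun i k x => by
    by_cases h : m k = 0
    · have hk : a k = -1 := by rw [hy.deg, h]; rfl
      rw [hk, mul_neg_one, Int.negOnePow_neg]
    · rw [anchorMap_of_mem_exteriorPower φ (k := m k + 2) (by omega) (hy.mem k), covDeriv_zero_left,
        smul_zero, smul_zero]
  rw [hsign, leibnizTerm_apply, leibnizTerm_apply, Equiv.swap_apply_left, Equiv.swap_apply_right,
    smul_sub, hpar, hpar, map_neg, map_neg, hu, hu, smul_neg, smul_comm _ (Int.negOnePow (a 0)), hmul 0 1,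
    mul_comm (a 0), hmul 1 0, smul_smul, Int.units_mul_self_eq_one, one_smul]
  abel

theorem polyBracket_comp_perm (φ : PolyFun d) {n : ℕ} {m : Fin n → ℕ} {a : Fin n → ℤ}
    {y : Fin n → Polyvector d} (hy : HomogeneousFamily m a y) (σ : Equiv.Perm (Fin n)) :
    polyBracket φ n (fun k => y (σ k)) = koszulSign a σ • polyBracket φ n y := by
  change taylorBracket φ n _ + correction φ n _ = _ • (taylorBracket φ n y + correction φ n y)
  rw [smul_add, taylorBracket_comp_perm φ hy]
  congr 1
  by_cases hn : n = 2
  · subst hn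
    exact leibnizTerm_comp_perm φ hy σ
  · rw [correction_of_ne φ hn, correction_of_ne φ hn, smul_zero]

end Symmetry

/-! ### The graded module of the truncated Koszul complex -/

section Grading

variable {d : ℕ}

theorem truncLinear_of_mem_trunc {x : Polyvector d} (hx : x ∈ truncPolyvector d) :
    truncLinear d x = x := by
  refine Submodule.iSup_induction _ (motive := fun x => truncLinear d x = x) hx ?_ (map_zero _) ?_
  · intro k x hx
    rw [truncLinear_of_mem hx, if_pos (by omega)]
  · intro x y hx hy
    rw [map_add, hx, hy]

theorem mem_truncGrading_negSucc {k : ℕ} {x : truncPolyvector d} :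
    x ∈ truncGrading d (Int.negSucc k) ↔ (x : Polyvector d) ∈ ⋀[PolyFun d]^(k + 2) (VecField d) :=
  Iff.rfl

theorem truncGrading_of_nonneg {i : ℤ} (hi : 0 ≤ i) : truncGrading d i = ⊥ := by
  obtain ⟨n, rfl⟩ := Int.eq_ofNat_of_zero_le hi
  rfl

theorem eq_zero_or_homogeneousFamily {n : ℕ} {a : Fin n → ℤ} {x : Fin n → truncPolyvector d}
    (hx : ∀ k, x k ∈ truncGrading d (a k)) :
    (∃ k, x k = 0) ∨ ∃ m, HomogeneousFamily m a fun k => (x k : Polyvector d) := by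
  by_cases h : ∀ k, a k < 0
  · right
    choose m hm using fun k => Int.eq_negSucc_of_lt_zero (h k)
    refine ⟨m, ⟨fun k => ?_, fun k => ?_⟩⟩
    · have := hx k
      rw [hm k] at this
      exact this
    · rw [hm k, Int.negSucc_eq]
  · left
    push Not at h
    obtain ⟨k, hk⟩ := h
    have := hx k
    rw [truncGrading_of_nonneg hk] at this
    exact ⟨k, this⟩

theorem isInternal_truncGrading (d : ℕ) : DirectSum.IsInternal (truncGrading d) := by
  classical
  constructor
  · have h : ∀ (k : ℕ) (x : DirectSum ℤ fun i => truncGrading d i),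
        GradedAlgebra.proj (fun k : ℕ => ⋀[PolyFun d]^k (VecField d)) (k + 2)
          (DirectSum.coeAddMonoidHom (truncGrading d) x : truncPolyvector d)
        = ((x (Int.negSucc k) : truncPolyvector d) : Polyvector d) := by
      intro k x
      induction x using DirectSum.induction_on with
      | zero => simp
      | add x y hx hy => simp only [map_add, Submodule.coe_add, hx, hy, DirectSum.add_apply]
      | of i x =>
        rw [DirectSum.coeAddMonoidHom_of, GradedAlgebra.proj_apply]
        obtain ⟨x, hx⟩ := x
        rcases i with i | i
        · have : x = 0 := hx
          subst this
          have h0 : (⟨0, hx⟩ : truncGrading d (Int.ofNat i)) = 0 := rfl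
          rw [h0]
          simp
        · by_cases hik : i = k
          · subst hik
            rw [DirectSum.of_eq_same]
            exact DirectSum.decompose_of_mem_same (fun k : ℕ => ⋀[PolyFun d]^k (VecField d)) hx
          · rw [DirectSum.of_eq_of_ne _ _ _ (by simpa using Ne.symm hik)]
            exact DirectSum.decompose_of_mem_ne (fun k : ℕ => ⋀[PolyFun d]^k (VecField d))
              (mem_truncGrading_negSucc.mp hx) fun h : i + 2 = k + 2 => hik (by omega)
    intro x y hxy
    refine DFinsupp.ext fun i => ?_
    rcases i with i | k
    · exact Subtype.ext ((show (x (Int.ofNat i) : truncPolyvector d) = 0 from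
          (x (Int.ofNat i)).2).trans
        (show (y (Int.ofNat i) : truncPolyvector d) = 0 from
          (y (Int.ofNat i)).2).symm)
    · exact Subtype.ext (Subtype.ext (by rw [← h k x, ← h k y, hxy]))
  · rintro ⟨x, hx⟩
    refine Submodule.iSup_induction' _ (motive := fun x hx => ∃ z,
      DirectSum.coeAddMonoidHom (truncGrading d) z = (⟨x, hx⟩ : truncPolyvector d)) ?_ ?_ ?_ hx
    · intro k x hx
      exact ⟨DirectSum.of (fun i => truncGrading d i) (Int.negSucc k)
        ⟨⟨x, Submodule.mem_iSup_of_mem k hx⟩, hx⟩, DirectSum.coeAddMonoidHom_of _ _ _⟩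
    · exact ⟨0, map_zero _⟩
    · rintro x y _ _ ⟨z, hz⟩ ⟨w, hw⟩
      exact ⟨z + w, by rw [map_add, hz, hw]; rfl⟩

/-- The coefficients of a vector field. -/
noncomputable def vecFieldEquiv (d : ℕ) : VecField d ≃ₗ[PolyFun d] Fin d → PolyFun d where
  toFun X i := X (MvPolynomial.X i)
  map_add' _ _ := rfl
  map_smul' _ _ := rfl
  invFun f := MvPolynomial.mkDerivation ℂ f
  left_inv _ := MvPolynomial.derivation_ext fun i => MvPolynomial.mkDerivation_X ℂ _ i
  right_inv _ := funext fun i => MvPolynomial.mkDerivation_X ℂ _ i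

instance : Module.Free (PolyFun d) (VecField d) :=
  Module.Free.of_equiv (vecFieldEquiv d).symm

theorem free_truncGrading (d : ℕ) (i : ℤ) : Module.Free (PolyFun d) (truncGrading d i) := by
  rcases i with i | k
  · exact inferInstanceAs (Module.Free (PolyFun d) (⊥ : Submodule (PolyFun d) (truncPolyvector d)))
  · exact Module.Free.of_equiv (Submodule.comapSubtypeEquivOfLe
      (le_iSup (fun k : ℕ => ⋀[PolyFun d]^(k + 2) (VecField d)) k)).symm

end Grading

/-! ### The universal Lie `∞`-algebroid -/

section Structure

variable {d : ℕ}

/-- The projection of polyvector fields onto the truncated Koszul complex. -/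
noncomputable def truncProj (d : ℕ) : Polyvector d →ₗ[PolyFun d] truncPolyvector d :=
  (truncLinear d).codRestrict _ truncLinear_mem

theorem truncProj_units_smul (u : ℤˣ) (x : Polyvector d) :
    truncProj d (u • x) = u • truncProj d x := by
  rcases Int.units_eq_one_or u with h | h
  · rw [h, one_smul, one_smul]
  · rw [h, Units.neg_smul, Units.neg_smul, one_smul, one_smul, map_neg]

/-- The bracket of arity `n + 1` on the truncated Koszul complex. The projection only matters for
the differential of bivector fields. -/
noncomputable def truncBracket (φ : PolyFun d) (n : ℕ) :
    MultilinearMap ℂ (fun _ : Fin (n + 1) => truncPolyvector d) (truncPolyvector d) :=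
  ((truncProj d).restrictScalars ℂ).compMultilinearMap
    ((polyBracket φ (n + 1)).compLinearMap fun _ => (truncPolyvector d).subtype.restrictScalars ℂ)

theorem coe_truncBracket (φ : PolyFun d) (n : ℕ) (x : Fin (n + 1) → truncPolyvector d) :
    (truncBracket φ n x : Polyvector d)
      = truncLinear d (polyBracket φ (n + 1) fun k => (x k : Polyvector d)) := rfl

theorem truncBracket_mem (φ : PolyFun d) (n : ℕ) (a : Fin (n + 1) → ℤ)
    (x : Fin (n + 1) → truncPolyvector d) (hx : ∀ k, x k ∈ truncGrading d (a k)) :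
    truncBracket φ n x ∈ truncGrading d (∑ k, a k + 1) := by
  rcases eq_zero_or_homogeneousFamily hx with ⟨k, hk⟩ | ⟨m, hm⟩
  · rw [(truncBracket φ n).map_coord_zero k hk]
    exact zero_mem _
  · have h := polyBracket_mem φ hm.mem
    have ha : ∑ k, a k = -((∑ k, (m k + 1) : ℕ) : ℤ) := by
      push_cast
      rw [← Finset.sum_neg_distrib]
      exact Finset.sum_congr rfl fun k _ => hm.deg k
    by_cases h2 : 2 ≤ ∑ k, (m k + 1)
    · obtain ⟨q, hq⟩ := Nat.exists_eq_add_of_le' h2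
      have hq' : ∑ k, a k + 1 = Int.negSucc q := by
        rw [ha, hq, Int.negSucc_eq]
        push_cast
        ring
      rw [hq', mem_truncGrading_negSucc, coe_truncBracket, truncLinear_of_mem h, if_pos h2, ← hq]
      exact h
    · have h0 : truncBracket φ n x = 0 :=
        Subtype.ext (by rw [coe_truncBracket, truncLinear_of_mem h, if_neg h2]; rfl)
      rw [h0]
      exact zero_mem _

theorem truncBracket_comp_perm (φ : PolyFun d) (n : ℕ) (a : Fin (n + 1) → ℤ)
    (x : Fin (n + 1) → truncPolyvector d) (hx : ∀ k, x k ∈ truncGrading d (a k))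
    (σ : Equiv.Perm (Fin (n + 1))) :
    truncBracket φ n (fun k => x (σ k)) = koszulSign a σ • truncBracket φ n x := by
  rcases eq_zero_or_homogeneousFamily hx with ⟨k, hk⟩ | ⟨m, hm⟩
  · rw [(truncBracket φ n).map_coord_zero k hk, (truncBracket φ n).map_coord_zero (σ.symm k)
      (by rw [σ.apply_symm_apply, hk]), smul_zero]
  · change truncProj d (polyBracket φ (n + 1) fun k => (x (σ k) : Polyvector d)) =
      koszulSign a σ • truncProj d (polyBracket φ (n + 1) fun k => (x k : Polyvector d))
    rw [← truncProj_units_smul, ← polyBracket_comp_perm φ hm σ]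

/-- On bivector fields the truncated differential vanishes. -/
theorem truncLinear_polyBracket_of_bivector (φ : PolyFun d) {r : ℕ} (hr : r = 1)
    {x : Fin r → Polyvector d} (hx : ∀ p, x p ∈ ⋀[PolyFun d]^2 (VecField d)) :
    truncLinear d (polyBracket φ r x) = 0 := by
  subst hr
  rw [truncLinear_polyBracket_one φ (k := 0) (hx 0), if_pos rfl]

theorem truncBracket_jacobi (φ : PolyFun d) (n : ℕ) (a : Fin (n + 1) → ℤ)
    (x : Fin (n + 1) → truncPolyvector d) (hx : ∀ k, x k ∈ truncGrading d (a k)) :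
    ∑ i : Fin (n + 1),
      ∑ σ ∈ (Finset.univ : Finset (Equiv.Perm (Fin (n + 1)))).filter (IsShuffle ((i : ℕ) + 1)),
        koszulSign a σ •
          truncBracket φ (n - i)
            (Fin.cons (truncBracket φ i fun k : Fin ((i : ℕ) + 1) => x (σ ⟨k, by omega⟩))
              fun k : Fin (n - i) => x (σ ⟨(i : ℕ) + 1 + k, by omega⟩)) = 0 := by
  rcases eq_zero_or_homogeneousFamily hx with ⟨k, hk⟩ | ⟨m, hm⟩
  · refine Finset.sum_eq_zero fun i _ => Finset.sum_eq_zero fun σ _ => ?_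
    by_cases h : (σ.symm k : ℕ) < (i : ℕ) + 1
    · have h0 : truncBracket φ i (fun k : Fin ((i : ℕ) + 1) => x (σ ⟨k, by omega⟩)) = 0 :=
        (truncBracket φ i).map_coord_zero ⟨σ.symm k, h⟩ (by
          change x (σ (σ.symm k)) = 0
          rw [σ.apply_symm_apply, hk])
      rw [h0, (truncBracket φ (n - i)).map_coord_zero 0 rfl, smul_zero]
    · have h1 := (σ.symm k).2
      rw [(truncBracket φ (n - i)).map_coord_zero
        (Fin.succ ⟨(σ.symm k : ℕ) - ((i : ℕ) + 1), by omega⟩), smul_zero]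
      rw [Fin.cons_succ]
      have : (⟨(i : ℕ) + 1 + ((σ.symm k : ℕ) - ((i : ℕ) + 1)), by omega⟩ : Fin (n + 1))
          = σ.symm k := Fin.ext (by
            change (i : ℕ) + 1 + ((σ.symm k : ℕ) - ((i : ℕ) + 1)) = (σ.symm k : ℕ)
            omega)
      rw [this, σ.apply_symm_apply, hk]
  have hterm : ∀ (i : Fin (n + 1)) (σ : Equiv.Perm (Fin (n + 1))),
      truncBracket φ (n - i)
        (Fin.cons (truncBracket φ i fun k : Fin ((i : ℕ) + 1) => x (σ ⟨k, by omega⟩))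
          fun k : Fin (n - i) => x (σ ⟨(i : ℕ) + 1 + k, by omega⟩))
      = truncProj d (jacobiSummand φ (r := (i : ℕ) + 1) (s := n - i) (by omega)
        (fun k => (x k : Polyvector d)) σ) := by
    intro i σ
    change truncProj d (polyBracket φ (n - i + 1) _) = truncProj d (polyBracket φ (n - i + 1) _)
    congr 2
    funext k
    refine Fin.cases ?_ (fun k => ?_) k
    · rfl
    · rfl
  by_cases hd : n ≤ 1 → ∃ k, m k ≠ 0
  · simp only [hterm, ← truncProj_units_smul, ← map_sum]
    rw [sum_jacobiSummand φ hm hd, map_zero]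
  · -- at most two arguments, all of them bivector fields
    push Not at hd
    obtain ⟨hn, hm0⟩ := hd
    have hx2 : ∀ k, (x k : Polyvector d) ∈ ⋀[PolyFun d]^2 (VecField d) := fun k => by
      have := hm.mem k
      rwa [hm0 k] at this
    refine Finset.sum_eq_zero fun i _ => Finset.sum_eq_zero fun σ _ => ?_
    by_cases hi : (i : ℕ) = 0
    · have h0 : truncBracket φ i (fun k : Fin ((i : ℕ) + 1) => x (σ ⟨k, by omega⟩)) = 0 :=
        Subtype.ext (truncLinear_polyBracket_of_bivector φ (by omega) fun p => hx2 _)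
      rw [h0, (truncBracket φ (n - i)).map_coord_zero 0 rfl, smul_zero]
    · have h0 : truncBracket φ (n - i)
          (Fin.cons (truncBracket φ i fun k : Fin ((i : ℕ) + 1) => x (σ ⟨k, by omega⟩))
            fun k : Fin (n - i) => x (σ ⟨(i : ℕ) + 1 + k, by omega⟩)) = 0 := by
        refine Subtype.ext (truncLinear_polyBracket_of_bivector φ (by omega) fun p => ?_)
        refine Fin.cases ?_ (fun k => hx2 _) p
        have h := polyBracket_mem φ (n := (i : ℕ) + 1) (m := fun _ => 0)
          (x := fun k => (x (σ ⟨k, by omega⟩) : Polyvector d)) fun k => hx2 _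
        have h1 : ∑ _k : Fin ((i : ℕ) + 1), (0 + 1) = 2 := by
          simp
          omega
        rw [h1] at h
        change truncLinear d (polyBracket φ ((i : ℕ) + 1)
          fun k => (x (σ ⟨k, by omega⟩) : Polyvector d)) ∈ _
        rw [truncLinear_of_mem h, if_pos le_rfl]
        exact h
      rw [h0, smul_zero]

theorem truncBracket_smul (φ : PolyFun d) {n : ℕ} (hn : n ≠ 1)
    (x : Fin (n + 1) → truncPolyvector d) (k : Fin (n + 1)) (f : PolyFun d) :
    truncBracket φ n (Function.update x k (f • x k)) = f • truncBracket φ n x := by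
  have h : ∀ z : Fin (n + 1) → truncPolyvector d, truncBracket φ n z
      = truncProj d (taylorBracket φ (n + 1) fun k => (z k : Polyvector d)) := fun z => by
    change truncProj d (taylorBracket φ (n + 1) _ + correction φ (n + 1) _) = _
    rw [correction_of_ne φ (by omega), add_zero]
    rfl
  have h1 : (fun l => (Function.update x k (f • x k) l : Polyvector d))
      = Function.update (fun l => (x l : Polyvector d)) k (f • (x k : Polyvector d)) := by
    funext l
    by_cases hl : l = k
    · subst hl
      simp
    · simp [hl]
  rw [h, h, h1, MultilinearMap.map_update_smul, Function.update_eq_self, map_smul]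

theorem truncProj_coe (x : truncPolyvector d) : truncProj d (x : Polyvector d) = x :=
  Subtype.ext (truncLinear_of_mem_trunc x.2)

theorem truncBracket_leibniz (φ : PolyFun d) (x y : truncPolyvector d) (f : PolyFun d) :
    truncBracket φ 1 ![x, f • y]
      = anchorMap φ (x : Polyvector d) f • y + f • truncBracket φ 1 ![x, y] := by
  have h : ∀ x y : truncPolyvector d, truncBracket φ 1 ![x, y]
      = truncProj d (∑ i, ∑ j, MvPolynomial.pderiv i (MvPolynomial.pderiv j φ) •
        (thetaDeriv i (x : Polyvector d) * thetaDeriv j (y : Polyvector d))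
        + (covDeriv (anchorMap φ (x : Polyvector d)) (y : Polyvector d)
          - covDeriv (anchorMap φ (y : Polyvector d)) (parity (x : Polyvector d)))) := by
    intro x y
    change truncProj d (taylorBracket φ 2 _ + leibnizTerm φ _) = _
    rw [taylorBracket_two]
    rfl
  have hy : anchorMap φ (x : Polyvector d) f • y
      = truncProj d (anchorMap φ (x : Polyvector d) f • (y : Polyvector d)) := by
    rw [map_smul, truncProj_coe]
  rw [h, h, hy, ← map_smul (truncProj d) f, ← map_add]
  congr 1
  simp only [Submodule.coe_smul, map_smul, covDeriv_smul, covDeriv_smul_left, mul_smul_comm,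
    smul_add, smul_sub, Finset.smul_sum, smul_comm f]
  abel

/-- The Lie `∞`-algebroid structure on the truncated Koszul complex of `φ`. -/
noncomputable def koszulAlgebroid (φ : PolyFun d) :
    LieInftyAlgebroid ℂ (PolyFun d) (truncGrading d) where
  isInternal := isInternal_truncGrading d
  negatively_graded _ hi := truncGrading_of_nonneg hi
  projective i := by
    have := free_truncGrading d i
    infer_instance
  bracket := truncBracket φ
  anchor := anchorMap φ ∘ₗ (truncPolyvector d).subtype
  bracket_mem := truncBracket_mem φ
  bracket_symm := truncBracket_comp_perm φ
  jacobi := truncBracket_jacobi φ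
  bracket_smul _ hn := truncBracket_smul φ hn
  leibniz := truncBracket_leibniz φ
  anchor_eq_zero i hi x hx := by
    rcases i with i | k
    · rw [show x = 0 from hx, map_zero]
    · exact anchorMap_of_mem_exteriorPower φ (k := k + 2)
        (fun h => hi (by rw [show k = 0 by omega]; rfl)) hx
  anchor_differential x hx := by
    change anchorMap φ (truncLinear d (polyBracket φ 1 fun k => ((![x] k : _) : Polyvector d))) = 0
    have h3 : (x : Polyvector d) ∈ ⋀[PolyFun d]^(1 + 2) (VecField d) := hx
    rw [truncLinear_polyBracket_one φ (k := 1) h3, if_neg one_ne_zero, taylorBracket_one,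
      anchorMap_apply, contractD_contractD, map_zero, neg_zero]
  anchor_bracket x hx y hy := by
    have h2 := anchorMap_polyBracket_two φ ![(x : Polyvector d), (y : Polyvector d)] hx hy
    have hm := polyBracket_mem φ (n := 2) (m := fun _ => 0)
      (x := ![(x : Polyvector d), (y : Polyvector d)]) (by
        intro k
        fin_cases k
        · exact hx
        · exact hy)
    have he : (fun k => ((![x, y] k : truncPolyvector d) : Polyvector d))
        = ![(x : Polyvector d), (y : Polyvector d)] := by
      funext k
      fin_cases k <;> rfl
    change anchorMap φ (truncLinear d (polyBracket φ 2 fun k =>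
      ((![x, y] k : truncPolyvector d) : Polyvector d))) = _
    rw [he, truncLinear_of_mem hm, if_pos (by simp), h2]
    rfl

end Structure

/-! ### The brackets of coordinate polyvector fields -/

section Coordinates

variable {d : ℕ}

theorem thetaDeriv_wedgePartial (i : Fin d) (J : List (Fin d)) :
    thetaDeriv i (wedgePartial J) = ∑ s : Fin J.length,
      (if i = J.get s then (-1 : PolyFun d) ^ (s : ℕ) else 0) •
        wedgePartial (J.eraseIdx s) := by
  induction J with
  | nil => simpa [wedgePartial_nil] using contractD_algebraMap (MvPolynomial.X i) 1
  | cons j J ih =>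
    rw [wedgePartial_cons, contractD_ι_mul, ih]
    change _ = ∑ s : Fin (J.length + 1), _
    rw [Fin.sum_univ_succ, Finset.mul_sum, sub_eq_add_neg, ← Finset.sum_neg_distrib]
    congr 1
    · simp [MvPolynomial.pderiv_X, Pi.single_apply]
    · refine Finset.sum_congr rfl fun s _ => ?_
      rw [mul_smul_comm, ← wedgePartial_cons, ← neg_smul]
      congr 1
      change _ = if i = J.get s then (-1 : PolyFun d) ^ ((s : ℕ) + 1) else 0
      split_ifs
      · rw [pow_succ, mul_neg_one]
      · rw [neg_zero]

theorem wedgePartial_flatten (L : List (List (Fin d))) :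
    wedgePartial L.flatten = (L.map wedgePartial).prod := by
  induction L with
  | nil => exact wedgePartial_nil
  | cons J L ih => rw [List.flatten_cons, wedgePartial_append, ih, List.map_cons, List.prod_cons]

theorem taylorBracket_wedgePartial (φ : PolyFun d) {n : ℕ} (I : Fin n → List (Fin d)) :
    taylorBracket φ n (fun k => wedgePartial (I k)) = koszulBracket φ I := by
  have h : ∀ ι : Fin n → Fin d, (List.ofFn fun k => thetaDeriv (ι k) (wedgePartial (I k))).prod
      = ∑ s : (k : Fin n) → Fin (I k).length,
        (if ι = fun k => (I k).get (s k) then ∏ k, (-1 : PolyFun d) ^ (s k : ℕ) else 0) •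
          wedgePartial (List.ofFn fun k => (I k).eraseIdx (s k)).flatten := by
    intro ι
    have h1 := (MultilinearMap.mkPiAlgebraFin (PolyFun d) n (Polyvector d)).map_sum
      (fun k (s : Fin (I k).length) => (if ι k = (I k).get s then (-1 : PolyFun d) ^ (s : ℕ) else 0) •
        wedgePartial ((I k).eraseIdx s))
    rw [MultilinearMap.mkPiAlgebraFin_apply] at h1
    simp only [thetaDeriv_wedgePartial]
    rw [h1]
    refine Finset.sum_congr rfl fun s _ => ?_
    rw [MultilinearMap.map_smul_univ, Finset.prod_ite_zero, MultilinearMap.mkPiAlgebraFin_apply,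
      wedgePartial_flatten, List.map_ofFn]
    congr 2
    simp [funext_iff]
  rw [taylorBracket_apply, koszulBracket]
  simp only [h, Finset.smul_sum]
  rw [Finset.sum_comm]
  refine Finset.sum_congr rfl fun s _ => ?_
  rw [Finset.sum_eq_single fun k => (I k).get (s k)]
  · rw [if_pos rfl, smul_smul, mul_comm, iterPartial_ofFn]
  · intro ι _ hι
    rw [if_neg hι, zero_smul, smul_zero]
  · simp

theorem polyBracket_wedgePartial (φ : PolyFun d) {n : ℕ} (I : Fin n → List (Fin d)) :
    polyBracket φ n (fun k => wedgePartial (I k)) = koszulBracket φ I := by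
  rw [← taylorBracket_wedgePartial]
  change taylorBracket φ n _ + correction φ n _ = _
  by_cases hn : n = 2
  · subst hn
    change _ + leibnizTerm φ _ = _
    rw [leibnizTerm_apply, covDeriv_parity, covDeriv_wedgePartial, covDeriv_wedgePartial, map_zero,
      sub_zero, add_zero]
  · rw [correction_of_ne φ hn, add_zero]

theorem truncBracket_truncPartial (φ : PolyFun d) (n : ℕ) (I : Fin (n + 1) → List (Fin d))
    (hI : ∀ k, 2 ≤ (I k).length) (h3 : n = 0 → ∀ k, 3 ≤ (I k).length) :
    (truncBracket φ n (fun k => truncPartial (I k) (hI k)) : Polyvector d) = koszulBracket φ I := by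
  rw [coe_truncBracket]
  change truncLinear d (polyBracket φ (n + 1) fun k => wedgePartial (I k)) = _
  have hm := polyBracket_mem φ (n := n + 1) (m := fun k => (I k).length - 2)
    (x := fun k => wedgePartial (I k)) fun k => by
      rw [Nat.sub_add_cancel (hI k)]
      exact wedgePartial_mem_exteriorPower _
  rw [truncLinear_of_mem hm, if_pos, polyBracket_wedgePartial]
  rw [Finset.sum_add_distrib]
  rcases n with _ | n
  · have := h3 rfl 0
    simp
    omega
  · simp
    omega

theorem truncBracket_zero (φ : PolyFun d) {i : ℤ} (hi : i ≤ -2) {x : truncPolyvector d}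
    (hx : x ∈ truncGrading d i) :
    (truncBracket φ 0 ![x] : Polyvector d) = contractD φ (x : Polyvector d) := by
  obtain ⟨k, rfl⟩ := Int.eq_negSucc_of_lt_zero (show i < 0 by omega)
  have hk : k ≠ 0 := by
    rintro rfl
    simp at hi
  rw [coe_truncBracket, truncLinear_polyBracket_one φ (k := k) (mem_truncGrading_negSucc.mp hx),
    if_neg hk, taylorBracket_one]
  rfl

theorem anchorMap_truncPartial (φ : PolyFun d) (i j : Fin d) :
    anchorMap φ (truncPartial [i, j] le_rfl : truncPolyvector d) =
      MvPolynomial.pderiv j φ • (MvPolynomial.pderiv i : VecField d)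
        - MvPolynomial.pderiv i φ • (MvPolynomial.pderiv j : VecField d) := by
  refine (ExteriorAlgebra.ι_inj (R := PolyFun d) _ _).mp ?_
  change ExteriorAlgebra.ι (PolyFun d) (anchorMap φ (wedgePartial [i, j])) = _
  rw [ι_anchorMap φ (wedgePartial_mem_exteriorPower [i, j])]
  have hj : wedgePartial [j] = ExteriorAlgebra.ι (PolyFun d) (MvPolynomial.pderiv j : VecField d) := by
    rw [wedgePartial_cons, wedgePartial_nil, mul_one]
  rw [wedgePartial_cons, contractD_ι_mul, hj, contractD_ι, map_sub, map_smul, map_smul,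
    ← Algebra.commutes, ← Algebra.smul_def]
  abel

end Coordinates

/-! ### Universality -/

section Universality

variable {d : ℕ}

theorem anchorMap_mem_foliation (φ : PolyFun d) {x : Polyvector d}
    (hx : x ∈ ⋀[PolyFun d]^2 (VecField d)) : anchorMap φ x φ = 0 := by
  have h := congrArg (contractD φ) (ι_anchorMap φ hx)
  rw [contractD_ι, map_neg, contractD_contractD, neg_zero] at h
  exact (ExteriorAlgebra.algebraMap_inj (VecField d) _ 0).mp (h.trans (map_zero _).symm)

/-- The hook, i.e. minus the contraction, from bivector fields to the foliation. -/
noncomputable def koszulHook (φ : PolyFun d) : truncGrading d (-1) →ₗ[PolyFun d] foliation φ where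
  toFun x := ⟨anchorMap φ ((x : truncPolyvector d) : Polyvector d),
    anchorMap_mem_foliation φ x.2⟩
  map_add' _ _ := Subtype.ext (map_add (anchorMap φ) _ _)
  map_smul' _ _ := Subtype.ext (map_smul (anchorMap φ) _ _)

theorem contractD_eq_zero_iff_truncBracket {φ : PolyFun d} (hφ : IsKoszulPolynomial φ) {k : ℕ}
    {x : truncPolyvector d} (hx : x ∈ truncGrading d (Int.negSucc k)) :
    contractD φ (x : Polyvector d) = 0
      ↔ ∃ y ∈ truncGrading d (Int.negSucc (k + 1)), truncBracket φ 0 ![y] = x := by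
  refine (hφ (k + 2) (by omega) _ (mem_truncGrading_negSucc.mp hx)).trans ?_
  constructor
  · rintro ⟨y, hy, hyx⟩
    have hy' : (⟨y, Submodule.mem_iSup_of_mem (k + 1) hy⟩ : truncPolyvector d)
        ∈ truncGrading d (Int.negSucc (k + 1)) := hy
    exact ⟨_, hy', Subtype.ext ((truncBracket_zero φ (by rw [Int.negSucc_eq]; omega) hy').trans hyx)⟩
  · rintro ⟨y, hy, rfl⟩
    exact ⟨y, hy, (truncBracket_zero φ (by rw [Int.negSucc_eq]; omega) hy).symm⟩

theorem koszulAlgebroid_isUniversalFor {φ : PolyFun d} (hφ : IsKoszulPolynomial φ) :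
    (koszulAlgebroid φ).IsUniversalFor (koszulHook φ) where
  anchor_hook _ := rfl
  hook_bracket x y := Subtype.ext ((koszulAlgebroid φ).anchor_bracket x x.2 y y.2).symm
  hook_surjective := by
    rintro ⟨X, hX⟩
    have hX' : X φ = 0 := hX
    obtain ⟨y, hy, hyX⟩ := (hφ 1 le_rfl _ (ι_mem_exteriorPower_one X)).mp
      (by rw [contractD_ι, hX', map_zero])
    refine ⟨⟨⟨-y, neg_mem (Submodule.mem_iSup_of_mem 0 hy)⟩, neg_mem hy⟩, Subtype.ext ?_⟩
    refine (ExteriorAlgebra.ι_inj (R := PolyFun d) _ _).mp ?_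
    change ExteriorAlgebra.ι (PolyFun d) (anchorMap φ (-y)) = _
    rw [ι_anchorMap φ (neg_mem hy), map_neg, neg_neg, hyX]
  exact_hook x := by
    refine Iff.trans ?_ (contractD_eq_zero_iff_truncBracket hφ (k := 0) x.2)
    have h := ι_anchorMap φ (x := ((x : truncPolyvector d) : Polyvector d)) x.2
    constructor
    · intro hx
      have h0 : anchorMap φ ((x : truncPolyvector d) : Polyvector d) = 0 := congrArg Subtype.val hx
      rw [h0, map_zero] at h
      exact neg_eq_zero.mp h.symm
    · intro hx
      rw [hx, neg_zero, ← map_zero (ExteriorAlgebra.ι (PolyFun d))] at h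
      exact Subtype.ext ((ExteriorAlgebra.ι_inj (R := PolyFun d) _ _).mp h)
  exact_differential i hi x hx := by
    have h := truncBracket_zero φ hi hx
    obtain ⟨k, rfl⟩ := Int.eq_negSucc_of_lt_zero (show i < 0 by omega)
    rw [show Int.negSucc k - 1 = Int.negSucc (k + 1) by
      rw [Int.negSucc_eq, Int.negSucc_eq]; push_cast; ring]
    refine Iff.trans ?_ (contractD_eq_zero_iff_truncBracket hφ hx)
    rw [← h]
    exact (Submodule.coe_eq_zero (x := truncBracket φ 0 ![x])).symm

end Universality

/-! ### Uniqueness -/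

section Uniqueness

/-- Multilinear maps that agree on tuples from a spanning set are equal. -/
theorem multilinearMap_eq_of_eqOn_span {R M N : Type*} [CommSemiring R] [AddCommMonoid M]
    [AddCommMonoid N] [Module R M] [Module R N] {n : ℕ}
    {F G : MultilinearMap R (fun _ : Fin n => M) N} {S : Set M} (hS : Submodule.span R S = ⊤)
    (h : ∀ x : Fin n → M, (∀ k, x k ∈ S) → F x = G x) : F = G := by
  classical
  have key : ∀ (s : Finset (Fin n)) (x : Fin n → M), (∀ k ∉ s, x k ∈ S) → F x = G x := by
    intro s
    induction s using Finset.induction_on with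
    | empty => exact fun x hx => h x fun k => hx k (Finset.notMem_empty k)
    | insert a s _ ih =>
      intro x hx
      have hspan : ∀ v ∈ Submodule.span R S,
          F (Function.update x a v) = G (Function.update x a v) := by
        intro v hv
        induction hv using Submodule.span_induction with
        | mem v hv =>
          refine ih _ fun k hk => ?_
          by_cases hka : k = a
          · rw [hka, Function.update_self]
            exact hv
          · rw [Function.update_of_ne hka]
            exact hx k (by simp [hka, hk])
        | zero => rw [MultilinearMap.map_update_zero, MultilinearMap.map_update_zero]
        | add v w _ _ hv hw => rw [MultilinearMap.map_update_add, MultilinearMap.map_update_add, hv, hw]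
        | smul c v _ hv => rw [MultilinearMap.map_update_smul, MultilinearMap.map_update_smul, hv]
      have := hspan (x a) (hS ▸ Submodule.mem_top)
      rwa [Function.update_eq_self] at this
  exact MultilinearMap.ext fun x => key Finset.univ x fun k hk => absurd (Finset.mem_univ k) hk

namespace LieInftyAlgebroid

variable {K O : Type*} [Field K] [CharZero K] [CommRing O] [Algebra K O]
  {E : Type*} [AddCommGroup E] [Module K E] [Module O E] [IsScalarTower K O E]
  {𝓔 : ℤ → Submodule O E}

theorem ext_bracket_anchor {L L' : LieInftyAlgebroid K O 𝓔} (hb : L.bracket = L'.bracket)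
    (ha : L.anchor = L'.anchor) : L = L' := by
  cases L
  cases L'
  subst hb
  subst ha
  rfl

/-- A bracket other than the binary one as an `O`-multilinear map. -/
def multilinearBracket (L : LieInftyAlgebroid K O 𝓔) (n : ℕ) (hn : n ≠ 1) :
    MultilinearMap O (fun _ : Fin (n + 1) => E) E where
  toFun := L.bracket n
  map_update_add' x i u v := by
    exact (L.bracket n).map_update_add x i u v
  map_update_smul' x i f u := by
    rename_i inst
    obtain rfl : inst = instDecidableEqFin (n + 1) := Subsingleton.elim _ _
    have h := L.bracket_smul n hn (Function.update x i u) i f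
    rwa [Function.update_self, Function.update_idem] at h

theorem bracket_pair_symm (L : LieInftyAlgebroid K O 𝓔) {i j : ℤ} {x y : E} (hx : x ∈ 𝓔 i)
    (hy : y ∈ 𝓔 j) :
    L.bracket 1 ![x, y] = koszulSign ![j, i] (Equiv.swap 0 1) • L.bracket 1 ![y, x] := by
  rw [← L.bracket_symm 1 ![j, i] ![y, x] (by
    intro k
    fin_cases k
    · exact hy
    · exact hx)]
  congr 1
  funext k
  fin_cases k <;> rfl

/-- The binary brackets of two Lie `∞`-algebroids with the same anchor agree on multiples of
homogeneous elements if they agree on these elements. -/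
theorem bracket_one_smul_smul_eq {L L' : LieInftyAlgebroid K O 𝓔} (ha : L.anchor = L'.anchor)
    {i j : ℤ} {x y : E} (hx : x ∈ 𝓔 i) (hy : y ∈ 𝓔 j)
    (h : L.bracket 1 ![x, y] = L'.bracket 1 ![x, y]) (f g : O) :
    L.bracket 1 ![f • x, g • y] = L'.bracket 1 ![f • x, g • y] := by
  have h1 : L.bracket 1 ![y, x] = L'.bracket 1 ![y, x] := by
    rw [L.bracket_pair_symm hy hx, L'.bracket_pair_symm hy hx, h]
  have h2 : L.bracket 1 ![y, f • x] = L'.bracket 1 ![y, f • x] := by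
    rw [L.leibniz, L'.leibniz, h1, ha]
  rw [L.leibniz, L'.leibniz, L.bracket_pair_symm (Submodule.smul_mem _ f hx) hy,
    L'.bracket_pair_symm (Submodule.smul_mem _ f hx) hy, h2, ha]

end LieInftyAlgebroid

variable {d : ℕ}

theorem truncPolyvector_induction {p : truncPolyvector d → Prop} (h0 : p 0)
    (hadd : ∀ x y, p x → p y → p (x + y))
    (hmon : ∀ (f : PolyFun d) (J : List (Fin d)) (hJ : 2 ≤ J.length), p (f • truncPartial J hJ))
    (x : truncPolyvector d) : p x := by
  obtain ⟨x, hx⟩ := x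
  refine Submodule.iSup_induction' _ (motive := fun x hx => p ⟨x, hx⟩) ?_ h0
    (fun x y hx hy => hadd ⟨x, hx⟩ ⟨y, hy⟩) hx
  intro k x hx
  have h : ∃ hx : x ∈ truncPolyvector d, p ⟨x, hx⟩ := by
    refine exteriorPower_induction_wedgePartial (p := fun x => ∃ hx : x ∈ truncPolyvector d, p ⟨x, hx⟩)
      ⟨zero_mem _, h0⟩ ?_ ?_ hx
    · rintro x y ⟨hx, hpx⟩ ⟨hy, hpy⟩
      exact ⟨add_mem hx hy, hadd _ _ hpx hpy⟩
    · intro f J hJ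
      exact ⟨Submodule.smul_mem _ _ (wedgePartial_mem_trunc J (by omega)), hmon f J (by omega)⟩
  exact h.2

theorem truncPartial_mem (J : List (Fin d)) (hJ : 2 ≤ J.length) :
    truncPartial J hJ ∈ truncGrading d (Int.negSucc (J.length - 2)) := by
  rw [mem_truncGrading_negSucc, Nat.sub_add_cancel hJ]
  exact wedgePartial_mem_exteriorPower J

/-- A Lie `∞`-algebroid structure on the truncated Koszul complex is determined by its anchor on
bivector fields and by its brackets of coordinate polyvector fields. -/
theorem algebroid_eq_of_truncPartial {L L' : LieInftyAlgebroid ℂ (PolyFun d) (truncGrading d)}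
    (ha : ∀ x ∈ truncGrading d (-1), L.anchor x = L'.anchor x)
    (hb : ∀ (n : ℕ) (I : Fin (n + 1) → List (Fin d)) (hI : ∀ k, 2 ≤ (I k).length),
      (n = 0 → ∀ k, 3 ≤ (I k).length) →
      L.bracket n (fun k => truncPartial (I k) (hI k))
        = L'.bracket n (fun k => truncPartial (I k) (hI k))) :
    L = L' := by
  have hanchor : L.anchor = L'.anchor := by
    refine LinearMap.ext fun x => ?_
    induction x using truncPolyvector_induction with
    | h0 => rw [map_zero, map_zero]
    | hadd x y hx hy => rw [map_add, map_add, hx, hy]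
    | hmon f J hJ =>
      rw [map_smul, map_smul]
      congr 1
      have hmem := truncPartial_mem J hJ
      by_cases h2 : Int.negSucc (J.length - 2) = -1
      · rw [h2] at hmem
        exact ha _ hmem
      · rw [L.anchor_eq_zero _ h2 _ hmem, L'.anchor_eq_zero _ h2 _ hmem]
  refine LieInftyAlgebroid.ext_bracket_anchor (funext fun n => ?_) hanchor
  -- the unary bracket of a bivector field vanishes for reasons of degree
  have hzero : ∀ (M : LieInftyAlgebroid ℂ (PolyFun d) (truncGrading d)) (I : Fin 1 → List (Fin d))
      (hI : ∀ k, 2 ≤ (I k).length), ¬ 3 ≤ (I 0).length →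
      M.bracket 0 (fun k => truncPartial (I k) (hI k)) = 0 := by
    intro M I hI h
    have h1 := M.bracket_mem 0 (fun k => Int.negSucc ((I k).length - 2)) _
      fun k => truncPartial_mem (I k) (hI k)
    have h2 : (I 0).length = 2 := le_antisymm (by omega) (hI 0)
    rw [Fin.sum_univ_one, h2] at h1
    exact h1
  have hI : ∀ (I : Fin (n + 1) → List (Fin d)) (hI : ∀ k, 2 ≤ (I k).length),
      L.bracket n (fun k => truncPartial (I k) (hI k))
        = L'.bracket n (fun k => truncPartial (I k) (hI k)) := by
    intro I hI
    by_cases h : n = 0 → ∀ k, 3 ≤ (I k).length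
    · exact hb n I hI h
    · push Not at h
      obtain ⟨rfl, k, hk⟩ := h
      have hk0 : k = 0 := Fin.ext (by omega)
      subst hk0
      rw [hzero L I hI (by omega), hzero L' I hI (by omega)]
  by_cases hn : n = 1
  · subst hn
    refine multilinearMap_eq_of_eqOn_span
      (S := {x | ∃ (f : PolyFun d) (J : List (Fin d)) (hJ : 2 ≤ J.length), f • truncPartial J hJ = x})
      ?_ ?_
    · refine eq_top_iff.mpr fun x _ => ?_
      induction x using truncPolyvector_induction with
      | h0 => exact zero_mem _
      | hadd x y hx hy => exact add_mem (hx trivial) (hy trivial)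
      | hmon f J hJ => exact Submodule.subset_span ⟨f, J, hJ, rfl⟩
    · intro x hx
      obtain ⟨f, I, hf, hfx⟩ := hx 0
      obtain ⟨g, J, hg, hgx⟩ := hx 1
      have hx' : x = ![f • truncPartial I hf, g • truncPartial J hg] := by
        funext k
        fin_cases k
        · exact hfx.symm
        · exact hgx.symm
      rw [hx']
      refine LieInftyAlgebroid.bracket_one_smul_smul_eq hanchor (truncPartial_mem I hf)
        (truncPartial_mem J hg) ?_ f g
      have h := hI ![I, J] (by
        intro k
        fin_cases k
        · exact hf
        · exact hg)
      have he : ∀ hIJ : ∀ k, 2 ≤ (![I, J] k).length, (fun k => truncPartial (![I, J] k) (hIJ k))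
          = ![truncPartial I hf, truncPartial J hg] := by
        intro hIJ
        funext k
        fin_cases k <;> rfl
      rwa [he] at h
  · have h : L.multilinearBracket n hn = L'.multilinearBracket n hn := by
      refine multilinearMap_eq_of_eqOn_span
        (S := {x | ∃ (J : List (Fin d)) (hJ : 2 ≤ J.length), truncPartial J hJ = x}) ?_ ?_
      · refine eq_top_iff.mpr fun x _ => ?_
        induction x using truncPolyvector_induction with
        | h0 => exact zero_mem _
        | hadd x y hx hy => exact add_mem (hx trivial) (hy trivial)
        | hmon f J hJ => exact Submodule.smul_mem _ _ (Submodule.subset_span ⟨J, hJ, rfl⟩)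
      · intro x hx
        choose I hJ hx using hx
        obtain rfl : (fun k => truncPartial (I k) (hJ k)) = x := funext hx
        exact hI I hJ
    exact MultilinearMap.ext fun x => congrArg (fun F => F x) h

end Uniqueness

theorem mainTheorem8 (d : ℕ) (φ : PolyFun d) (hφ : IsKoszulPolynomial φ) :
    (∀ i : ℤ, Module.Free (PolyFun d) (truncGrading d i)) ∧
    ∃! L : LieInftyAlgebroid ℂ (PolyFun d) (truncGrading d),
      -- the differential is the contraction with the differential of `φ`
      (∀ i : ℤ, i ≤ -2 → ∀ x ∈ truncGrading d i,
        (L.bracket 0 ![x] : Polyvector d) = contractD φ (x : Polyvector d)) ∧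
      -- the anchor is minus the contraction with the differential of `φ`
      (∀ x ∈ truncGrading d (-1),
        ExteriorAlgebra.ι (PolyFun d) (L.anchor x) = -contractD φ (x : Polyvector d)) ∧
      (∀ i j : Fin d, L.anchor (truncPartial [i, j] le_rfl) =
        MvPolynomial.pderiv j φ • (MvPolynomial.pderiv i : VecField d)
          - MvPolynomial.pderiv i φ • (MvPolynomial.pderiv j : VecField d)) ∧
      -- the brackets of all arities; the unary bracket is zero on bivector fields
      (∀ (n : ℕ) (I : Fin (n + 1) → List (Fin d)) (hI : ∀ k, 2 ≤ (I k).length),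
        (n = 0 → ∀ k, 3 ≤ (I k).length) →
        (L.bracket n (fun k => truncPartial (I k) (hI k)) : Polyvector d) = koszulBracket φ I) ∧
      -- universality for the foliation, the hook being minus the contraction
      ∃ π : truncGrading d (-1) →ₗ[PolyFun d] foliation φ,
        (∀ x : truncGrading d (-1),
          ExteriorAlgebra.ι (PolyFun d) (π x : VecField d)
            = -contractD φ ((x : truncPolyvector d) : Polyvector d)) ∧
        L.IsUniversalFor π := by
  refine ⟨free_truncGrading d, koszulAlgebroid φ, ⟨fun i hi x hx => truncBracket_zero φ hi hx,
    fun x hx => ι_anchorMap φ hx, anchorMap_truncPartial φ, truncBracket_truncPartial φ,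
    koszulHook φ, fun x => ι_anchorMap φ x.2, koszulAlgebroid_isUniversalFor hφ⟩, ?_⟩
  rintro L ⟨-, hanchor, -, hbracket, -⟩
  refine algebroid_eq_of_truncPartial (fun x hx => ?_) fun n I hI h3 => Subtype.ext ?_
  · exact (ExteriorAlgebra.ι_inj (R := PolyFun d) _ _).mp
      ((hanchor x hx).trans (ι_anchorMap φ hx).symm)
  · exact (hbracket n I hI h3).trans (truncBracket_truncPartial φ n I hI h3).symm
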